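/- **Setting.** Let $k$ be any field and $H$ a Hopf algebra of finite dimension $d$ over $k$, with (bijective) antipode $S$. Let $D(H)=H^{*\mathrm{cop}}\otimes H$ be its Drinfeld double: as a coalgebra it is the tensor product of $H^{*\mathrm{cop}}$ and $H$, both factors are subalgebras, and $$(p\otimes h)(q\otimes l)=\sum p\cdot q\bigl(S^{-1}(h_{(3)})\,?\,h_{(1)}\bigr)\otimes h_{(2)}l\qquad(p,q\in H^*,\ h,l\in H).$$ Let $(h_i)$ be a basis of $H$ with dual basis $(h_i^*)$, let $R=\sum_i h_i\otimes h_i^*\in D(H)\otimes D(H)$ be the universal $R$-matrix, and let $u=\sum_i S(h_i^*)\,h_i\in D(H)$ be the Drinfeld element, where here and below $S$ also denotes the antipode of $D(H)$. Put $z=uS(u)$. A nonzero module is indecomposable if it is not the direct sum of two nonzero submodules. A constituent of a module is a simple module isomorphic to a subquotient of it. Linkage is the equivalence relation on simple $D(H)$-modules generated by: $W_1\sim W_2$ if both are constituents of one indecomposable $D(H)$-module. For an indecomposable $D(H)$-module $V$ let $[V]$ be the linkage class of any constituent of $V$, and let $N_V$ be the greatest common divisor of the dimensions over $k$ of the modules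 in $[V]$. For $a\in D(H)$ and an extension field $K\supseteq k$, an eigenvalue of $a$ on a $D(H)$-module $V$ in $K$ is an eigenvalue of $a$ on $K\otimes_kV$. "A root of unity of order dividing $n$" means an element of finite multiplicative order, with this order dividing $n$. **Theorem 4.8.** The element $z$ is central in $D(H)$, and the following hold. 1. Let $V$ be an indecomposable $D(H)$-module. If $k$ is algebraically closed, then $z$ has exactly one eigenvalue on $V$, and it is a root of unity of order dividing $d^2N_V$. For arbitrary $k$ and every extension field $K$ of $k$: if $K$ is algebraically closed, $z$ has an eigenvalue on $V$ in $K$; any two eigenvalues of $z$ on $V$ in $K$ are conjugate over $k$, i.e. have the same minimal polynomial over $k$; and each of them is a root of unity of order dividing $d^2N_V$. 2. Let $V$ be an indecomposable $D(H)$-module. For every extension field $K$ of $k$, every eigenvalue of $u$ on $V$ in $K$ is a root of unity of order dividing $2d^2N_V$. Consequently, on any $D(H)$-module, every eigenvalue of $u$ in any extension field $K$ of $k$ is a root of unity. -/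

import Mathlib

open scoped TensorProduct
open Coalgebra HopfAlgebra

namespace HopfAux

/-! Shortcut instances, used locally below, that make the rewriting faster. -/

theorem zeroHomClass_linearMap {k M N : Type*} [Field k] [AddCommMonoid M] [AddCommMonoid N]
    [Module k M] [Module k N] : ZeroHomClass (M →ₗ[k] N) M N := inferInstance

theorem zeroHomClass_linearEquiv {k M N : Type*} [Field k] [AddCommMonoid M] [AddCommMonoid N]
    [Module k M] [Module k N] : ZeroHomClass (M ≃ₗ[k] N) M N := inferInstance

theorem addHomClass_linearMap {k M N : Type*} [Field k] [AddCommMonoid M] [AddCommMonoid N]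
    [Module k M] [Module k N] : AddHomClass (M →ₗ[k] N) M N := inferInstance

theorem addHomClass_linearEquiv {k M N : Type*} [Field k] [AddCommMonoid M] [AddCommMonoid N]
    [Module k M] [Module k N] : AddHomClass (M ≃ₗ[k] N) M N := inferInstance

section
attribute [local instance] HopfAux.zeroHomClass_linearMap HopfAux.zeroHomClass_linearEquiv
  HopfAux.addHomClass_linearMap HopfAux.addHomClass_linearEquiv
variable {k H : Type*} [Field k] [Ring H] [HopfAlgebra k H]

theorem coassoc4 (h : H) :
    TensorProduct.assoc k H H (H ⊗[k] H)
      (TensorProduct.map (comul (R := k)) (comul (R := k)) (comul (R := k) h)) =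
    TensorProduct.map LinearMap.id
      ((TensorProduct.assoc k H H H).toLinearMap ∘ₗ TensorProduct.map (comul (R := k)) LinearMap.id)
      (TensorProduct.map LinearMap.id (comul (R := k)) (comul (R := k) h)) := by
  have : (TensorProduct.assoc k H H (H ⊗[k] H)).toLinearMap ∘ₗ
      (TensorProduct.map (comul (R := k)) (comul (R := k))) ∘ₗ (comul (R := k) (A := H)) =
    TensorProduct.map LinearMap.id
      ((TensorProduct.assoc k H H H).toLinearMap ∘ₗ TensorProduct.map (comul (R := k)) LinearMap.id)
      ∘ₗ (TensorProduct.map LinearMap.id (comul (R := k))) ∘ₗ comul (R := k) := by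
    simp only [coassoc_simps]
  exact congr($this h)

theorem antipode_mul_id_apply (h : H) :
    LinearMap.mul' k H (TensorProduct.map (antipode k) LinearMap.id (comul (R := k) h)) =
      algebraMap k H (counit (R := k) h) :=
  mul_antipode_rTensor_comul_apply h

theorem id_mul_antipode_apply (h : H) :
    LinearMap.mul' k H (TensorProduct.map LinearMap.id (antipode k) (comul (R := k) h)) =
      algebraMap k H (counit (R := k) h) :=
  mul_antipode_lTensor_comul_apply h

theorem comul_antipode_aux :
    WithConv.toConv (TensorProduct.map (antipode k (A := H)) (antipode k) ∘ₗ
      (TensorProduct.comm k H H).toLinearMap ∘ₗ comul (R := k)) *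
      WithConv.toConv (comul (R := k) (A := H)) = 1 := by
  ext h
  rw [LinearMap.convMul_apply]
  let G : H ⊗[k] (H ⊗[k] (H ⊗[k] H)) →ₗ[k] H ⊗[k] H :=
    LinearMap.mul' k (H ⊗[k] H) ∘ₗ TensorProduct.map
      (TensorProduct.map (antipode k) (antipode k) ∘ₗ (TensorProduct.comm k H H).toLinearMap)
      LinearMap.id ∘ₗ (TensorProduct.assoc k H H (H ⊗[k] H)).symm.toLinearMap
  have h1 : ∀ t : H ⊗[k] H, LinearMap.mul' k (H ⊗[k] H) (TensorProduct.map
      (TensorProduct.map (antipode k (A := H)) (antipode k) ∘ₗ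
      (TensorProduct.comm k H H).toLinearMap ∘ₗ comul (R := k)) (comul (R := k)) t) =
      G (TensorProduct.assoc k H H (H ⊗[k] H)
      (TensorProduct.map (comul (R := k)) (comul (R := k)) t)) := by
    intro t
    induction t with
    | zero => simp
    | add x y hx hy => simp only [map_add, hx, hy]
    | tmul a b => simp [G]
  have h2 : ∀ t : H ⊗[k] (H ⊗[k] H), G (TensorProduct.map LinearMap.id
      ((TensorProduct.assoc k H H H).toLinearMap ∘ₗ
        TensorProduct.map (comul (R := k)) LinearMap.id) t) =
      (TensorProduct.mk k H H 1) (LinearMap.mul' k H (TensorProduct.map (antipode k)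
        ((TensorProduct.lid k H).toLinearMap ∘ₗ TensorProduct.map (counit (R := k)) LinearMap.id)
        t)) := by
    intro t
    induction t with
    | zero => simp
    | add x y hx hy => simp only [map_add, hx, hy]
    | tmul a bc =>
      induction bc with
      | zero => simp
      | add x y hx hy => simp only [TensorProduct.tmul_add, map_add, hx, hy]
      | tmul b c =>
        have : ∀ s : H ⊗[k] H, G (a ⊗ₜ TensorProduct.assoc k H H H (s ⊗ₜ c)) =
            LinearMap.mul' k H (TensorProduct.map (antipode k) LinearMap.id s) ⊗ₜ
              (antipode k a * c) := by
          intro s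
          induction s with
          | zero => simp
          | add x y hx hy => simp only [TensorProduct.tmul_add, TensorProduct.add_tmul, map_add, hx, hy]
          | tmul p q => simp [G]
        simp [this, antipode_mul_id_apply, Algebra.algebraMap_eq_smul_one, TensorProduct.smul_tmul']
  simp only []
  rw [h1, coassoc4, h2]
  have h3 : TensorProduct.map (antipode k)
      ((TensorProduct.lid k H).toLinearMap ∘ₗ TensorProduct.map (counit (R := k)) LinearMap.id)
        (TensorProduct.map LinearMap.id (comul (R := k)) (comul (R := k) h)) =
      TensorProduct.map (antipode k) LinearMap.id (comul (R := k) h) := by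
    have : TensorProduct.map (antipode k)
      ((TensorProduct.lid k H).toLinearMap ∘ₗ TensorProduct.map (counit (R := k)) LinearMap.id) ∘ₗ
        (TensorProduct.map LinearMap.id (comul (R := k))) ∘ₗ (comul (R := k)) =
      TensorProduct.map (antipode k) LinearMap.id ∘ₗ (comul (R := k) (A := H)) := by
      have hid : (TensorProduct.lid k H).toLinearMap ∘ₗ
          TensorProduct.map (counit (R := k)) LinearMap.id ∘ₗ (comul (R := k) (A := H)) =
          LinearMap.id := by
        ext x
        exact congr(TensorProduct.lid k H $(rTensor_counit_comul (R := k) x)).trans (by simp)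
      rw [← LinearMap.comp_assoc, ← TensorProduct.map_comp, LinearMap.comp_assoc, hid,
        LinearMap.comp_id]
    exact congr($this h)
  rw [h3, antipode_mul_id_apply, LinearMap.convOne_apply]
  simp [Algebra.algebraMap_eq_smul_one, Algebra.TensorProduct.one_def]

theorem comul_antipode (h : H) :
    comul (R := k) (antipode k h) = TensorProduct.map (antipode k (A := H)) (antipode k)
      (TensorProduct.comm k H H (comul (R := k) h)) := by
  have := left_inv_eq_right_inv (comul_antipode_aux (k := k) (H := H)) LinearMap.comul_right_inv
  exact congr($(this).ofConv h).symm

theorem hopfModule_coinv {M : Type*} [AddCommMonoid M] [Module k M]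
    (ρ : M →ₗ[k] M ⊗[k] H) (act : M ⊗[k] H →ₗ[k] M)
    (hρ : ∀ m, TensorProduct.assoc k M H H (TensorProduct.map ρ LinearMap.id (ρ m)) =
      TensorProduct.map LinearMap.id (comul (R := k)) (ρ m))
    (hc : ∀ m h, ρ (act (m ⊗ₜ h)) = TensorProduct.map act (LinearMap.mul' k H)
      (TensorProduct.tensorTensorTensorComm k M H H H (ρ m ⊗ₜ comul (R := k) h))) (m : M) :
    ρ (act (TensorProduct.map LinearMap.id (antipode k) (ρ m))) =
      act (TensorProduct.map LinearMap.id (antipode k) (ρ m)) ⊗ₜ 1 := by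
  let G : M ⊗[k] (H ⊗[k] (H ⊗[k] H)) →ₗ[k] M ⊗[k] H :=
    TensorProduct.map act (LinearMap.mul' k H) ∘ₗ
      (TensorProduct.tensorTensorTensorComm k M H H H).toLinearMap ∘ₗ
      TensorProduct.map LinearMap.id (TensorProduct.map (antipode k) (antipode k) ∘ₗ
        (TensorProduct.comm k H H).toLinearMap) ∘ₗ
      (TensorProduct.assoc k M H (H ⊗[k] H)).symm.toLinearMap
  have h1 : ∀ t : M ⊗[k] H, ρ (act (TensorProduct.map LinearMap.id (antipode k) t)) =
      G (TensorProduct.assoc k M H (H ⊗[k] H) (TensorProduct.map ρ (comul (R := k)) t)) := by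
    intro t
    induction t with
    | zero => simp
    | add x y hx hy => simp only [map_add, hx, hy]
    | tmul a b => simp [G, hc, comul_antipode]
  have h2 : TensorProduct.assoc k M H (H ⊗[k] H) (TensorProduct.map ρ (comul (R := k)) (ρ m)) =
      TensorProduct.map LinearMap.id (TensorProduct.map LinearMap.id (comul (R := k)))
        (TensorProduct.map LinearMap.id (comul (R := k)) (ρ m)) := by
    rw [← hρ]
    generalize ρ m = t
    induction t with
    | zero => simp
    | add x y hx hy => simp only [map_add, hx, hy]
    | tmul a b =>
      simp only [TensorProduct.map_tmul, LinearMap.id_apply]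
      generalize ρ a = t
      induction t with
      | zero => simp
      | add x y hx hy => simp only [map_add, hx, hy, TensorProduct.add_tmul]
      | tmul a b => simp
  have h3 : ∀ t : M ⊗[k] H, G (TensorProduct.map LinearMap.id
      (TensorProduct.map LinearMap.id (comul (R := k)))
        (TensorProduct.map LinearMap.id (comul (R := k)) t)) =
      act (TensorProduct.map LinearMap.id (antipode k) t) ⊗ₜ 1 := by
    intro t
    induction t with
    | zero => simp
    | add x y hx hy => simp only [map_add, hx, hy, TensorProduct.add_tmul]
    | tmul a b =>
      simp only [TensorProduct.map_tmul, LinearMap.id_apply]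
      have e1 : TensorProduct.map LinearMap.id (comul (R := k)) (comul (R := k) b) =
        TensorProduct.assoc k H H H
          (TensorProduct.map (comul (R := k)) LinearMap.id (comul (R := k) b)) :=
        (coassoc_apply b).symm
      rw [e1]
      have e2 : ∀ s : H ⊗[k] H, G (a ⊗ₜ TensorProduct.assoc k H H H
          (TensorProduct.map (comul (R := k)) LinearMap.id s)) =
          act (a ⊗ₜ antipode k (TensorProduct.lid k H
            (TensorProduct.map (counit (R := k)) LinearMap.id s))) ⊗ₜ 1 := by
        intro s
        induction s with
        | zero => simp
        | add x y hx hy =>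
          simp only [map_add, hx, hy, TensorProduct.add_tmul, TensorProduct.tmul_add]
        | tmul p q =>
          simp only [TensorProduct.map_tmul, LinearMap.id_apply, TensorProduct.lid_tmul, map_smul,
            TensorProduct.tmul_smul]
          have e3 : ∀ s : H ⊗[k] H, G (a ⊗ₜ TensorProduct.assoc k H H H (s ⊗ₜ q)) =
              act (a ⊗ₜ antipode k q) ⊗ₜ
                (LinearMap.mul' k H (TensorProduct.map LinearMap.id (antipode k) s)) := by
            intro s
            induction s with
            | zero => simp
            | add x y hx hy =>
              simp only [map_add, hx, hy, TensorProduct.add_tmul, TensorProduct.tmul_add]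
            | tmul p' q' => simp [G]
          rw [e3, id_mul_antipode_apply, Algebra.algebraMap_eq_smul_one, TensorProduct.tmul_smul,
            TensorProduct.smul_tmul']
      rw [e2]
      have e4 := congr(TensorProduct.lid k H $(rTensor_counit_comul (R := k) b))
      simp only [LinearMap.rTensor_def, TensorProduct.lid_tmul, one_smul] at e4
      rw [e4]
  rw [h1, h2, h3]

theorem hopfModule_sum {M : Type*} [AddCommMonoid M] [Module k M]
    (ρ : M →ₗ[k] M ⊗[k] H) (act : M ⊗[k] H →ₗ[k] M)
    (hρ : ∀ m, TensorProduct.assoc k M H H (TensorProduct.map ρ LinearMap.id (ρ m)) =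
      TensorProduct.map LinearMap.id (comul (R := k)) (ρ m))
    (hε : ∀ m, TensorProduct.rid k M (TensorProduct.map LinearMap.id (counit (R := k)) (ρ m)) = m)
    (h1 : ∀ m, act (m ⊗ₜ 1) = m)
    (ha : ∀ m a b, act (act (m ⊗ₜ a) ⊗ₜ b) = act (m ⊗ₜ (a * b))) (m : M) :
    act (TensorProduct.map (act ∘ₗ TensorProduct.map LinearMap.id (antipode k) ∘ₗ ρ)
      LinearMap.id (ρ m)) = m := by
  let G : M ⊗[k] (H ⊗[k] H) →ₗ[k] M := act ∘ₗ TensorProduct.map LinearMap.id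
    (LinearMap.mul' k H ∘ₗ TensorProduct.map (antipode k) LinearMap.id)
  have e1 : ∀ t : M ⊗[k] H, act (TensorProduct.map (act ∘ₗ TensorProduct.map LinearMap.id
      (antipode k) ∘ₗ ρ) LinearMap.id t) =
      G (TensorProduct.assoc k M H H (TensorProduct.map ρ LinearMap.id t)) := by
    intro t
    induction t with
    | zero => simp
    | add x y hx hy => simp only [map_add, hx, hy]
    | tmul a b =>
      simp only [TensorProduct.map_tmul, LinearMap.id_apply, LinearMap.comp_apply]
      generalize ρ a = t
      induction t with
      | zero => simp
      | add x y hx hy => simp only [map_add, hx, hy, TensorProduct.add_tmul]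
      | tmul p q => simp [G, ha]
  rw [e1, hρ]
  have e2 : ∀ t : M ⊗[k] H, G (TensorProduct.map LinearMap.id (comul (R := k)) t) =
      TensorProduct.rid k M (TensorProduct.map LinearMap.id (counit (R := k)) t) := by
    intro t
    induction t with
    | zero => simp
    | add x y hx hy => simp only [map_add, hx, hy]
    | tmul a b =>
      simp [G, antipode_mul_id_apply, Algebra.algebraMap_eq_smul_one, h1]
  rw [e2, hε]

noncomputable def dact : (H →ₗ[k] k) ⊗[k] H →ₗ[k] (H →ₗ[k] k) :=
  TensorProduct.lift
    { toFun := fun f =>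
        { toFun := fun h => f ∘ₗ LinearMap.mulRight k (antipode k h)
          map_add' := fun a b => by ext x; simp [mul_add]
          map_smul' := fun c a => by ext x; simp }
      map_add' := fun f g => by ext; simp
      map_smul' := fun c f => by ext; simp }

@[simp] theorem dact_tmul (f : H →ₗ[k] k) (h x : H) :
    dact (f ⊗ₜ h) x = f (x * antipode k h) := rfl

theorem smul_antipode_aux (f : H →ₗ[k] k) (x h : H) :
    LinearMap.mul' k H (TensorProduct.map (((TensorProduct.rid k H).toLinearMap ∘ₗ
      TensorProduct.map LinearMap.id f ∘ₗ comul (R := k)) ∘ₗ LinearMap.mulLeft k x ∘ₗ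
        antipode k) LinearMap.id (comul (R := k) h)) =
    TensorProduct.rid k H (TensorProduct.map LinearMap.id (dact (f ⊗ₜ h)) (comul (R := k) x)) := by
  let J : H ⊗[k] H →ₗ[k] H ⊗[k] (H ⊗[k] H) →ₗ[k] H := TensorProduct.lift
    { toFun := fun p =>
        { toFun := fun q => (TensorProduct.lid k H).toLinearMap ∘ₗ
            TensorProduct.map (f ∘ₗ LinearMap.mulLeft k q ∘ₗ antipode k)
              (LinearMap.mulLeft k p ∘ₗ LinearMap.mul' k H ∘ₗ
                TensorProduct.map (antipode k) LinearMap.id)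
          map_add' := fun a b => by ext; simp [add_mul, add_smul]
          map_smul' := fun c a => by ext; simp [mul_smul] }
      map_add' := fun a b => by ext; simp [add_mul]
      map_smul' := fun c a => by ext; simp }
  have hJ : ∀ p q a b c, J (p ⊗ₜ q) (a ⊗ₜ (b ⊗ₜ c)) =
      f (q * antipode k a) • (p * (antipode k b * c)) := by
    intro p q a b c; simp [J]
  have e1 : ∀ t : H ⊗[k] H, LinearMap.mul' k H (TensorProduct.map
      (((TensorProduct.rid k H).toLinearMap ∘ₗ
      TensorProduct.map LinearMap.id f ∘ₗ comul (R := k)) ∘ₗ LinearMap.mulLeft k x ∘ₗ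
        antipode k) LinearMap.id t) = J (comul (R := k) x) (TensorProduct.assoc k H H H
          (TensorProduct.map (comul (R := k)) LinearMap.id t)) := by
    intro t
    induction t with
    | zero => simp
    | add x y hx hy => simp only [map_add, hx, hy]
    | tmul a b =>
      simp only [TensorProduct.map_tmul, LinearMap.id_apply, LinearMap.comp_apply,
        LinearMap.mulLeft_apply, Bialgebra.comul_mul, comul_antipode]
      generalize comul (R := k) a = t
      generalize comul (R := k) x = r
      induction t with
      | zero => simp
      | add y z hy hz => simp only [map_add, hy, hz, mul_add, TensorProduct.add_tmul]
      | tmul c d =>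
        induction r with
        | zero => simp
        | add y z hy hz => simp only [map_add, hy, hz, add_mul, LinearMap.add_apply, TensorProduct.add_tmul]
        | tmul p q => simp [hJ, mul_assoc]
  have e2 := coassoc_apply (R := k) h
  simp only [LinearMap.lTensor_def, LinearMap.rTensor_def] at e2
  rw [e1, e2]
  have e3 : ∀ (p q : H) (t : H ⊗[k] H), J (p ⊗ₜ q)
      (TensorProduct.map LinearMap.id (comul (R := k)) t) =
      f (q * antipode k (TensorProduct.rid k H
        (TensorProduct.map LinearMap.id (counit (R := k)) t))) • p := by
    intro p q t
    induction t with
    | zero => simp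
    | add x y hx hy => simp only [map_add, hx, hy, mul_add, add_smul]
    | tmul a b =>
      have e4 : ∀ s : H ⊗[k] H, J (p ⊗ₜ q) (a ⊗ₜ s) = f (q * antipode k a) • (p *
          LinearMap.mul' k H (TensorProduct.map (antipode k) LinearMap.id s)) := by
        intro s
        induction s with
        | zero => simp
        | add x y hx hy => simp only [map_add, hx, hy, TensorProduct.tmul_add, mul_add, smul_add]
        | tmul b c => simp [hJ]
      simp only [TensorProduct.map_tmul, LinearMap.id_apply]
      rw [e4, antipode_mul_id_apply]
      simp [Algebra.algebraMap_eq_smul_one, smul_smul, mul_comm]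
  have e4 := congr(TensorProduct.rid k H $(lTensor_counit_comul (R := k) h))
  simp only [LinearMap.lTensor_def, TensorProduct.rid_tmul, one_smul] at e4
  generalize comul (R := k) x = r
  induction r with
  | zero => simp
  | add y z hy hz => simp only [map_add, hy, hz, LinearMap.add_apply]
  | tmul p q => rw [e3, e4]; simp

variable [FiniteDimensional k H]

theorem dualTensorHom_inj {N : Type*} [AddCommGroup N] [Module k N] :
    Function.Injective (dualTensorHom k H N) :=
  (dualTensorHomEquiv k H N).injective


noncomputable def coact : (H →ₗ[k] k) →ₗ[k] (H →ₗ[k] k) ⊗[k] H :=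
  (dualTensorHomEquiv k H H).symm.toLinearMap ∘ₗ
    { toFun := fun f => (TensorProduct.rid k H).toLinearMap ∘ₗ
        TensorProduct.map LinearMap.id f ∘ₗ comul (R := k)
      map_add' := fun f g => by
        ext x; simp [TensorProduct.map_add_right]
      map_smul' := fun c f => by
        ext x; simp [TensorProduct.map_smul_right] }

theorem dualTensorHom_coact (f : H →ₗ[k] k) : dualTensorHom k H H (coact f) =
    (TensorProduct.rid k H).toLinearMap ∘ₗ TensorProduct.map LinearMap.id f ∘ₗ comul (R := k) :=
  (dualTensorHomEquiv k H H).apply_symm_apply _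

theorem coact_coassoc (f : H →ₗ[k] k) :
    TensorProduct.assoc k (H →ₗ[k] k) H H (TensorProduct.map coact LinearMap.id (coact f)) =
      TensorProduct.map LinearMap.id (comul (R := k)) (coact f) := by
  apply dualTensorHom_inj
  have e1 : ∀ t : (H →ₗ[k] k) ⊗[k] H, dualTensorHom k H (H ⊗[k] H)
      (TensorProduct.map LinearMap.id (comul (R := k)) t) =
      comul (R := k) ∘ₗ dualTensorHom k H H t := by
    intro t
    induction t with
    | zero => simp
    | add x y hx hy => simp only [map_add, hx, hy, LinearMap.comp_add]
    | tmul a b => ext x; simp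
  have e2 : ∀ t : (H →ₗ[k] k) ⊗[k] H, dualTensorHom k H (H ⊗[k] H)
      (TensorProduct.assoc k (H →ₗ[k] k) H H (TensorProduct.map coact LinearMap.id t)) =
      TensorProduct.map LinearMap.id (dualTensorHom k H H t) ∘ₗ comul (R := k) := by
    intro t
    induction t with
    | zero => simp
    | add x y hx hy =>
      simp only [map_add, hx, hy, TensorProduct.map_add_right, LinearMap.add_comp]
    | tmul a b =>
      have e3 : ∀ s : (H →ₗ[k] k) ⊗[k] H, dualTensorHom k H (H ⊗[k] H)
          (TensorProduct.assoc k (H →ₗ[k] k) H H (s ⊗ₜ b)) =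
          (TensorProduct.mk k H H).flip b ∘ₗ dualTensorHom k H H s := by
        intro s
        induction s with
        | zero => simp
        | add x y hx hy =>
          simp only [map_add, hx, hy, TensorProduct.add_tmul, LinearMap.comp_add]
        | tmul a b => ext x; simp [TensorProduct.smul_tmul']
      simp only [TensorProduct.map_tmul, LinearMap.id_apply]
      rw [e3, dualTensorHom_coact]
      ext x
      simp only [LinearMap.comp_apply]
      generalize comul (R := k) x = t
      induction t with
      | zero => simp
      | add x y hx hy => simp only [map_add, hx, hy]
      | tmul p q => simp
  rw [e1, e2, dualTensorHom_coact]
  ext x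
  simp only [LinearMap.comp_apply]
  have e4 := (coassoc_apply (R := k) x)
  simp only [LinearMap.lTensor_def, LinearMap.rTensor_def] at e4
  have e5 : ∀ t : H ⊗[k] H, TensorProduct.map LinearMap.id ((TensorProduct.rid k H).toLinearMap ∘ₗ
      TensorProduct.map LinearMap.id f ∘ₗ comul (R := k)) t =
      TensorProduct.map LinearMap.id ((TensorProduct.rid k H).toLinearMap ∘ₗ
        TensorProduct.map LinearMap.id f) (TensorProduct.map LinearMap.id (comul (R := k)) t) := by
    intro t
    induction t with
    | zero => simp
    | add x y hx hy => simp only [map_add, hx, hy]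
    | tmul p q => simp
  rw [e5, ← e4]
  generalize comul (R := k) x = t
  induction t with
  | zero => simp
  | add x y hx hy => simp only [map_add, hx, hy]
  | tmul p q =>
    simp only [TensorProduct.map_tmul, LinearMap.id_apply, LinearEquiv.coe_coe,
      TensorProduct.rid_tmul, map_smul]
    generalize comul (R := k) p = t
    induction t with
    | zero => simp
    | add x y hx hy => simp only [map_add, hx, hy, TensorProduct.add_tmul, smul_add]
    | tmul p q => simp

theorem coact_counit (f : H →ₗ[k] k) :
    TensorProduct.rid k (H →ₗ[k] k)
      (TensorProduct.map LinearMap.id (counit (R := k)) (coact f)) = f := by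
  have e1 : ∀ t : (H →ₗ[k] k) ⊗[k] H, TensorProduct.rid k (H →ₗ[k] k)
      (TensorProduct.map LinearMap.id (counit (R := k)) t) =
      counit (R := k) ∘ₗ dualTensorHom k H H t := by
    intro t
    induction t with
    | zero => simp
    | add x y hx hy => simp only [map_add, hx, hy, LinearMap.comp_add]
    | tmul a b => ext x; simp [mul_comm]
  rw [e1, dualTensorHom_coact]
  ext x
  have e4 := congr(f (TensorProduct.lid k H $(rTensor_counit_comul (R := k) x)))
  simp only [LinearMap.rTensor_def, TensorProduct.lid_tmul, one_smul] at e4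
  rw [← e4]
  simp only [LinearMap.comp_apply]
  generalize comul (R := k) x = t
  induction t with
  | zero => simp
  | add x y hx hy => simp only [map_add, hx, hy]
  | tmul p q => simp [mul_comm]

theorem coact_dact (f : H →ₗ[k] k) (h : H) :
    coact (dact (f ⊗ₜ h)) = TensorProduct.map dact (LinearMap.mul' k H)
      (TensorProduct.tensorTensorTensorComm k (H →ₗ[k] k) H H H (coact f ⊗ₜ comul (R := k) h)) := by
  apply dualTensorHom_inj
  rw [dualTensorHom_coact]
  ext x
  have e1 : ∀ (t : (H →ₗ[k] k) ⊗[k] H) (s : H ⊗[k] H), dualTensorHom k H H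
      (TensorProduct.map dact (LinearMap.mul' k H)
      (TensorProduct.tensorTensorTensorComm k (H →ₗ[k] k) H H H (t ⊗ₜ s))) x =
      LinearMap.mul' k H (TensorProduct.map (dualTensorHom k H H t ∘ₗ LinearMap.mulLeft k x ∘ₗ
        antipode k) LinearMap.id s) := by
    intro t s
    induction t with
    | zero => simp
    | add x y hx hy =>
      simp only [map_add, hx, hy, TensorProduct.add_tmul, LinearMap.add_apply,
        LinearMap.add_comp, TensorProduct.map_add_left]
    | tmul a b =>
      induction s with
      | zero => simp
      | add x y hx hy => simp only [map_add, hx, hy, TensorProduct.tmul_add, LinearMap.add_apply]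
      | tmul c d => simp
  rw [e1, dualTensorHom_coact, smul_antipode_aux]
  rfl

theorem exists_integral : ∃ l : H →ₗ[k] k, l ≠ 0 ∧ coact l = l ⊗ₜ 1 := by
  by_contra! hcon
  have hP : ∀ f : H →ₗ[k] k,
      dact (TensorProduct.map LinearMap.id (antipode k) (coact f)) = 0 := by
    intro f
    by_contra hf
    exact hcon _ hf (hopfModule_coinv coact dact coact_coassoc coact_dact f)
  have hs := hopfModule_sum (k := k) (H := H) coact dact coact_coassoc coact_counit
    (fun m => by ext; simp)
    (fun m a b => by ext; simp [HopfAlgebra.antipode_mul_antidistrib, mul_assoc])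
    (counit (R := k))
  have h0 : (dact ∘ₗ TensorProduct.map LinearMap.id (antipode k) ∘ₗ coact :
      (H →ₗ[k] k) →ₗ[k] (H →ₗ[k] k)) = 0 := by
    ext1 f; exact hP f
  rw [h0] at hs
  have := congr($hs 1)
  simp at this

theorem antipode_injective : Function.Injective (antipode k (A := H)) := by
  rw [injective_iff_map_eq_zero]
  intro h hh
  obtain ⟨l, hl, hc⟩ := exists_integral (k := k) (H := H)
  obtain ⟨x, hx⟩ : ∃ x, l x ≠ 0 := by
    by_contra! hcon
    exact hl (LinearMap.ext hcon)
  have h1 := coact_dact l h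
  have h2 : dact (l ⊗ₜ h) = 0 := by ext y; simp [hh]
  rw [h2, map_zero, hc] at h1
  have h3 : TensorProduct.map dact (LinearMap.mul' k H)
      (TensorProduct.tensorTensorTensorComm k (H →ₗ[k] k) H H H ((l ⊗ₜ 1) ⊗ₜ comul (R := k) h)) =
      TensorProduct.map (dact ∘ₗ TensorProduct.mk k (H →ₗ[k] k) H l) LinearMap.id
        (comul (R := k) h) := by
    generalize comul (R := k) h = t
    induction t with
    | zero => simp
    | add x y hx hy => simp only [map_add, hx, hy, TensorProduct.tmul_add]
    | tmul a b => simp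
  rw [h3] at h1
  let A : (H →ₗ[k] k) ⊗[k] (H ⊗[k] H) →ₗ[k] (H →ₗ[k] k) ⊗[k] H :=
    TensorProduct.map (dact ∘ₗ TensorProduct.map LinearMap.id (antipode k)) LinearMap.id ∘ₗ
      (TensorProduct.assoc k (H →ₗ[k] k) H H).symm.toLinearMap
  have h4 : ∀ t : H ⊗[k] H, A (TensorProduct.map LinearMap.id (comul (R := k))
      (TensorProduct.map (dact ∘ₗ TensorProduct.mk k (H →ₗ[k] k) H l) LinearMap.id t)) =
      TensorProduct.map (dact ∘ₗ TensorProduct.mk k (H →ₗ[k] k) H l ∘ₗ LinearMap.mul' k H ∘ₗ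
        TensorProduct.map LinearMap.id (antipode k)) LinearMap.id
        ((TensorProduct.assoc k H H H).symm
          (TensorProduct.map LinearMap.id (comul (R := k)) t)) := by
    intro t
    induction t with
    | zero => simp
    | add x y hx hy => simp only [map_add, hx, hy]
    | tmul a b =>
      simp only [TensorProduct.map_tmul, LinearMap.id_apply]
      generalize comul (R := k) b = t
      induction t with
      | zero => simp
      | add x y hx hy => simp only [map_add, hx, hy, TensorProduct.tmul_add]
      | tmul c d =>
        simp only [A, LinearMap.comp_apply, LinearEquiv.coe_coe, TensorProduct.assoc_symm_tmul,
          TensorProduct.map_tmul, LinearMap.id_apply, TensorProduct.mk_apply,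
          LinearMap.mul'_apply]
        congr 1
        ext y
        simp [HopfAlgebra.antipode_mul_antidistrib, mul_assoc]
  have h5 := h4 (comul (R := k) h)
  rw [← h1, map_zero, map_zero] at h5
  have e2 := coassoc_symm_apply (R := k) h
  simp only [LinearMap.lTensor_def, LinearMap.rTensor_def] at e2
  rw [e2] at h5
  have h6 : ∀ t : H ⊗[k] H, TensorProduct.map (dact ∘ₗ TensorProduct.mk k (H →ₗ[k] k) H l ∘ₗ
      LinearMap.mul' k H ∘ₗ TensorProduct.map LinearMap.id (antipode k)) LinearMap.id
        (TensorProduct.map (comul (R := k)) LinearMap.id t) =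
      l ⊗ₜ TensorProduct.lid k H (TensorProduct.map (counit (R := k)) LinearMap.id t) := by
    intro t
    induction t with
    | zero => simp
    | add x y hx hy => simp only [map_add, hx, hy, TensorProduct.tmul_add]
    | tmul a b =>
      simp only [TensorProduct.map_tmul, LinearMap.comp_apply, id_mul_antipode_apply,
        Algebra.algebraMap_eq_smul_one, TensorProduct.mk_apply, TensorProduct.tmul_smul, map_smul,
        LinearMap.id_apply, TensorProduct.lid_tmul, ← TensorProduct.smul_tmul']
      congr 2
      ext y
      simp
  rw [h6] at h5
  have e4 := congr(TensorProduct.lid k H $(rTensor_counit_comul (R := k) h))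
  simp only [LinearMap.rTensor_def, TensorProduct.lid_tmul, one_smul] at e4
  rw [e4] at h5
  have h7 := congr(dualTensorHom k H H $h5 x)
  simp only [map_zero, LinearMap.zero_apply, dualTensorHom_apply] at h7
  exact (smul_eq_zero.mp h7.symm).resolve_left hx

theorem antipode_bijective : Function.Bijective (antipode k (A := H)) :=
  ⟨antipode_injective, LinearMap.injective_iff_surjective.mp antipode_injective⟩


end
end HopfAux

noncomputable section DoubleAlgebra

attribute [local instance] HopfAux.zeroHomClass_linearMap HopfAux.zeroHomClass_linearEquiv
  HopfAux.addHomClass_linearMap HopfAux.addHomClass_linearEquiv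

universe u v
set_option linter.unusedSectionVars false
variable (k : Type u) (H : Type v) [Field k] [Ring H] [HopfAlgebra k H] [FiniteDimensional k H]

/-- The inverse of the antipode of a finite-dimensional Hopf algebra. -/
def antipodeInv : H →ₗ[k] H :=
  (LinearEquiv.ofBijective (antipode k (A := H)) HopfAux.antipode_bijective).symm.toLinearMap

/-- The dual algebra of `H`: linear functionals with the convolution product
`(p * q) x = ∑ p x₍₁₎ q x₍₂₎` and unit the counit of `H`. -/
abbrev HDual : Type (max u v) := WithConv (H →ₗ[k] k)

variable {k H}

theorem antipode_antipodeInv (h : H) : antipode k (antipodeInv k H h) = h :=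
  (LinearEquiv.ofBijective (antipode k (A := H)) HopfAux.antipode_bijective).apply_symm_apply h

theorem antipodeInv_antipode (h : H) : antipodeInv k H (antipode k h) = h :=
  (LinearEquiv.ofBijective (antipode k (A := H)) HopfAux.antipode_bijective).symm_apply_apply h

theorem antipodeInv_mul (a b : H) :
    antipodeInv k H (a * b) = antipodeInv k H b * antipodeInv k H a := by
  apply (HopfAux.antipode_bijective (k := k) (H := H)).1
  rw [HopfAlgebra.antipode_mul_antidistrib]
  simp only [antipode_antipodeInv]

theorem antipodeInv_one : antipodeInv k H 1 = 1 := by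
  apply (HopfAux.antipode_bijective (k := k) (H := H)).1
  rw [antipode_antipodeInv, antipode_one]

theorem counit_antipodeInv (h : H) : counit (R := k) (antipodeInv k H h) = counit (R := k) h := by
  rw [← counit_antipode (R := k), antipode_antipodeInv]

theorem comul_antipodeInv (h : H) : comul (R := k) (antipodeInv k H h) =
    TensorProduct.map (antipodeInv k H) (antipodeInv k H)
      (TensorProduct.comm k H H (comul (R := k) h)) := by
  have h1 := HopfAux.comul_antipode (k := k) (antipodeInv k H h)
  rw [antipode_antipodeInv] at h1
  rw [h1]
  generalize comul (R := k) (antipodeInv k H h) = t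
  induction t with
  | zero => simp
  | add x y hx hy => simp only [map_add, ← hx, ← hy]
  | tmul a b => simp [antipodeInv_antipode]

/-- The left action `(a ⇀ q) x = q (x * a)` of `H` on its dual. -/
def dualLeft : H →ₐ[k] Module.End k (HDual k H) :=
  AlgHom.ofLinearMap
    { toFun := fun a =>
        { toFun := fun q => WithConv.toConv (q.ofConv ∘ₗ LinearMap.mulRight k a)
          map_add' := fun p q => by ext; simp
          map_smul' := fun c q => by ext; simp }
      map_add' := fun a b => by ext; simp [mul_add]
      map_smul' := fun c a => by ext; simp }
    (by ext; simp) (fun a b => by ext; simp [mul_assoc])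

/-- The left action `q ↼ S⁻¹ a`, that is `x ↦ q (S⁻¹ a * x)`, of `H` on its dual. -/
def dualRightInv : H →ₐ[k] Module.End k (HDual k H) :=
  AlgHom.ofLinearMap
    { toFun := fun a =>
        { toFun := fun q => WithConv.toConv (q.ofConv ∘ₗ LinearMap.mulLeft k (antipodeInv k H a))
          map_add' := fun p q => by ext; simp
          map_smul' := fun c q => by ext; simp }
      map_add' := fun a b => by ext; simp [add_mul]
      map_smul' := fun c a => by ext; simp }
    (by ext; simp [antipodeInv_one]) (fun a b => by ext; simp [antipodeInv_mul])

theorem dualLeft_apply (a x : H) (q : HDual k H) : dualLeft a q x = q (x * a) := rfl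

theorem dualRightInv_apply (a x : H) (q : HDual k H) :
    dualRightInv a q x = q (antipodeInv k H a * x) := rfl

theorem dualLeft_mul (a : H) (p q : HDual k H) : dualLeft a (p * q) =
    LinearMap.mul' k (HDual k H) (TensorProduct.map (dualLeft.toLinearMap.flip p)
      (dualLeft.toLinearMap.flip q) (comul (R := k) a)) := by
  ext x
  change (p * q) (x * a) = _
  rw [LinearMap.convMul_apply, Bialgebra.comul_mul]
  generalize comul (R := k) a = t
  induction t with
  | zero => simp
  | add y z hy hz =>
    simp only [mul_add, map_add, hy, hz, WithConv.ofConv_add, LinearMap.add_apply]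
  | tmul b c =>
    simp only [TensorProduct.map_tmul, LinearMap.mul'_apply, LinearMap.convMul_apply]
    generalize comul (R := k) x = t
    induction t with
    | zero => simp
    | add y z hy hz => simp only [add_mul, map_add, hy, hz]
    | tmul y z => simp [dualLeft_apply]

theorem dualRightInv_mul (a : H) (p q : HDual k H) : dualRightInv a (p * q) =
    LinearMap.mul' k (HDual k H) (TensorProduct.map (dualRightInv.toLinearMap.flip p)
      (dualRightInv.toLinearMap.flip q) (TensorProduct.comm k H H (comul (R := k) a))) := by
  ext x
  change (p * q) (antipodeInv k H a * x) = _
  rw [LinearMap.convMul_apply, Bialgebra.comul_mul, comul_antipodeInv]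
  generalize TensorProduct.comm k H H (comul (R := k) a) = t
  induction t with
  | zero => simp
  | add y z hy hz =>
    simp only [add_mul, map_add, hy, hz, WithConv.ofConv_add, LinearMap.add_apply]
  | tmul b c =>
    simp only [TensorProduct.map_tmul, LinearMap.mul'_apply, LinearMap.convMul_apply]
    generalize comul (R := k) x = t
    induction t with
    | zero => simp
    | add y z hy hz => simp only [mul_add, map_add, hy, hz]
    | tmul y z => simp [dualRightInv_apply]

theorem dualLeft_one (a : H) : dualLeft a (1 : HDual k H) = counit (R := k) a • 1 := by
  ext x
  simp [dualLeft_apply, LinearMap.convOne_apply, mul_comm]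

theorem dualRightInv_one (a : H) : dualRightInv a (1 : HDual k H) = counit (R := k) a • 1 := by
  ext x
  simp [dualRightInv_apply, LinearMap.convOne_apply, counit_antipodeInv]

theorem dualLeft_dualRightInv (a b : H) (q : HDual k H) :
    dualLeft a (dualRightInv b q) = dualRightInv b (dualLeft a q) := by
  ext x
  simp [dualLeft_apply, dualRightInv_apply, mul_assoc]

variable (k H) in
/-- The iterated coproduct `h ↦ h₍₁₎ ⊗ (h₍₂₎ ⊗ h₍₃₎)`. -/
def comul₃ : H →ₗ[k] H ⊗[k] (H ⊗[k] H) :=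
  TensorProduct.map LinearMap.id (comul (R := k)) ∘ₗ comul (R := k)

/-- Left multiplication by `p ⊗ 1` on `H* ⊗ H`. -/
def leftDual : HDual k H →ₗ[k] Module.End k (HDual k H ⊗[k] H) :=
  (TensorProduct.mapBilinear (RingHom.id k) (HDual k H) H (HDual k H) H).flip LinearMap.id ∘ₗ
    LinearMap.mul k (HDual k H)

theorem leftDual_tmul (p q : HDual k H) (l : H) :
    leftDual p (q ⊗ₜ[k] l) = (p * q) ⊗ₜ l := rfl

/-- The operator `q ⊗ l ↦ q (S⁻¹ c * ? * a) ⊗ b * l` attached to `a ⊗ (b ⊗ c)`. -/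
def crossOp : H ⊗[k] (H ⊗[k] H) →ₗ[k] Module.End k (HDual k H ⊗[k] H) :=
  TensorProduct.homTensorHomMap (RingHom.id k) (HDual k H) H (HDual k H) H ∘ₗ
    TensorProduct.map
      (LinearMap.mul' k (Module.End k (HDual k H)) ∘ₗ
        TensorProduct.map dualLeft.toLinearMap dualRightInv.toLinearMap)
      (LinearMap.mul k H) ∘ₗ
    (TensorProduct.assoc k H H H).symm.toLinearMap ∘ₗ
    TensorProduct.map LinearMap.id (TensorProduct.comm k H H).toLinearMap

theorem crossOp_tmul (a b c l : H) (q : HDual k H) :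
    crossOp (a ⊗ₜ[k] (b ⊗ₜ[k] c)) (q ⊗ₜ[k] l) = dualLeft a (dualRightInv c q) ⊗ₜ (b * l) := rfl

/-- Left multiplication by `1 ⊗ h` on `H* ⊗ H`:
`q ⊗ l ↦ ∑ q (S⁻¹ h₍₃₎ * ? * h₍₁₎) ⊗ h₍₂₎ * l`. -/
def leftH : H →ₗ[k] Module.End k (HDual k H ⊗[k] H) := crossOp ∘ₗ comul₃ k H

theorem leftDual_one : leftDual (1 : HDual k H) = 1 := by
  ext q l : 3
  simp [leftDual_tmul]

theorem leftDual_mul (p q : HDual k H) : leftDual (p * q) = leftDual p * leftDual q := by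
  ext r l : 3
  simp [leftDual_tmul, mul_assoc]

theorem crossOp_mul (s t : H ⊗[k] (H ⊗[k] H)) : crossOp (s * t) = crossOp s * crossOp t := by
  induction s with
  | zero => simp
  | add x y hx hy => simp only [add_mul, map_add, hx, hy]
  | tmul a bc =>
    induction bc with
    | zero => simp
    | add x y hx hy => simp only [TensorProduct.tmul_add, add_mul, map_add, hx, hy]
    | tmul b c =>
      induction t with
      | zero => simp
      | add x y hx hy => simp only [mul_add, map_add, hx, hy]
      | tmul a' bc' =>
        induction bc' with
        | zero => simp
        | add x y hx hy => simp only [TensorProduct.tmul_add, mul_add, map_add, hx, hy]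
        | tmul b' c' =>
          refine TensorProduct.ext' fun q l => ?_
          simp only [Algebra.TensorProduct.tmul_mul_tmul, Module.End.mul_apply, crossOp_tmul,
            map_mul, dualLeft_dualRightInv, mul_assoc]

theorem comul₃_mul (a b : H) : comul₃ k H (a * b) = comul₃ k H a * comul₃ k H b := by
  simp only [comul₃, LinearMap.comp_apply, Bialgebra.comul_mul]
  exact map_mul (Algebra.TensorProduct.map (AlgHom.id k H) (Bialgebra.comulAlgHom k H)) _ _

theorem comul₃_one : comul₃ k H 1 = 1 ⊗ₜ (1 ⊗ₜ 1) := by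
  simp [comul₃, Algebra.TensorProduct.one_def]

theorem leftH_mul (a b : H) : leftH (k := k) (a * b) = leftH a * leftH b := by
  simp only [leftH, LinearMap.comp_apply, comul₃_mul, crossOp_mul]

theorem leftH_one : leftH (k := k) (1 : H) = 1 := by
  refine TensorProduct.ext' fun q l => ?_
  simp [leftH, comul₃_one, crossOp_tmul]

theorem leftH_one_tmul_one (h : H) : leftH h ((1 : HDual k H) ⊗ₜ[k] (1 : H)) = 1 ⊗ₜ h := by
  have h1 : ∀ t : H ⊗[k] (H ⊗[k] H), crossOp t ((1 : HDual k H) ⊗ₜ[k] (1 : H)) =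
      1 ⊗ₜ TensorProduct.lid k H (TensorProduct.map (counit (R := k))
        ((TensorProduct.rid k H).toLinearMap ∘ₗ
          TensorProduct.map LinearMap.id (counit (R := k))) t) := by
    intro t
    induction t with
    | zero => simp
    | add x y hx hy => simp only [map_add, LinearMap.add_apply, hx, hy, TensorProduct.tmul_add]
    | tmul a bc =>
      induction bc with
      | zero => simp
      | add x y hx hy =>
        simp only [map_add, LinearMap.add_apply, hx, hy, TensorProduct.tmul_add]
      | tmul b c =>
        rw [crossOp_tmul, dualRightInv_one, map_smul, dualLeft_one]
        simp only [mul_one, TensorProduct.map_tmul, LinearMap.comp_apply, LinearEquiv.coe_coe,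
          TensorProduct.rid_tmul, LinearMap.id_apply,
          TensorProduct.tmul_smul, ← TensorProduct.smul_tmul']
        rw [map_smul, TensorProduct.lid_tmul, TensorProduct.tmul_smul, TensorProduct.tmul_smul,
          smul_comm]
  rw [leftH, LinearMap.comp_apply, h1]
  congr 1
  have h2 : ((TensorProduct.rid k H).toLinearMap ∘ₗ
      TensorProduct.map LinearMap.id (counit (R := k))) ∘ₗ comul (R := k) (A := H) =
      LinearMap.id := by
    ext x
    exact congr(TensorProduct.rid k H $(lTensor_counit_comul (R := k) x)).trans (by simp)
  have h3 : TensorProduct.map (counit (R := k)) ((TensorProduct.rid k H).toLinearMap ∘ₗ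
      TensorProduct.map LinearMap.id (counit (R := k))) (comul₃ k H h) =
      TensorProduct.map (counit (R := k)) LinearMap.id (comul (R := k) h) := by
    rw [comul₃, LinearMap.comp_apply, ← LinearMap.comp_apply (TensorProduct.map _ _),
      ← TensorProduct.map_comp, h2, LinearMap.comp_id]
  rw [h3]
  exact congr(TensorProduct.lid k H $(rTensor_counit_comul (R := k) h)).trans (by simp)

/-- Left multiplication on the double: `p ⊗ h` acts as `p ⊗ 1` after `1 ⊗ h`. -/
def leftMul : HDual k H ⊗[k] H →ₗ[k] Module.End k (HDual k H ⊗[k] H) :=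
  LinearMap.mul' k (Module.End k (HDual k H ⊗[k] H)) ∘ₗ TensorProduct.map leftDual leftH

theorem leftMul_tmul (p : HDual k H) (h : H) :
    leftMul (p ⊗ₜ[k] h) = leftDual p * leftH h := rfl

theorem comul₅ (h : H) :
    TensorProduct.assoc k H H (H ⊗[k] (H ⊗[k] H))
      (TensorProduct.map (comul (R := k)) (TensorProduct.map LinearMap.id (comul (R := k)))
        (comul₃ k H h)) =
    TensorProduct.map LinearMap.id
      ((TensorProduct.map LinearMap.id (TensorProduct.assoc k H H H).toLinearMap ∘ₗ
        (TensorProduct.assoc k H (H ⊗[k] H) H).toLinearMap) ∘ₗ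
        TensorProduct.map (comul₃ k H) LinearMap.id) (comul₃ k H h) := by
  have : (TensorProduct.assoc k H H (H ⊗[k] (H ⊗[k] H))).toLinearMap ∘ₗ
      TensorProduct.map (comul (R := k)) (TensorProduct.map LinearMap.id (comul (R := k))) ∘ₗ
        comul₃ k H =
    TensorProduct.map LinearMap.id
      ((TensorProduct.map LinearMap.id (TensorProduct.assoc k H H H).toLinearMap ∘ₗ
        (TensorProduct.assoc k H (H ⊗[k] H) H).toLinearMap) ∘ₗ
        TensorProduct.map (comul₃ k H) LinearMap.id) ∘ₗ comul₃ k H := by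
    simp only [comul₃, coassoc_simps]
  exact congr($this h)

/-- The straightening relation between `H` and its dual. -/
theorem leftH_mul_leftDual (h : H) (q : HDual k H) :
    leftH h * leftDual q = leftMul (leftH h (q ⊗ₜ[k] (1 : H))) := by
  obtain ⟨F, hF⟩ : ∃ F : H ⊗[k] (H ⊗[k] (H ⊗[k] (H ⊗[k] H))) →ₗ[k]
      Module.End k (HDual k H ⊗[k] H), ∀ a x y z c : H, F (a ⊗ₜ (x ⊗ₜ (y ⊗ₜ (z ⊗ₜ c)))) =
      leftDual (dualLeft a (dualRightInv c q)) * crossOp (x ⊗ₜ (y ⊗ₜ z)) := by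
    let E : H ⊗[k] H →ₗ[k] Module.End k (HDual k H ⊗[k] H) := leftDual ∘ₗ
      (LinearMap.applyₗ q) ∘ₗ LinearMap.mul' k (Module.End k (HDual k H)) ∘ₗ
        TensorProduct.map dualLeft.toLinearMap dualRightInv.toLinearMap
    exact ⟨LinearMap.mul' k (Module.End k (HDual k H ⊗[k] H)) ∘ₗ TensorProduct.map E crossOp ∘ₗ
      (TensorProduct.assoc k H H (H ⊗[k] (H ⊗[k] H))).symm.toLinearMap ∘ₗ
      TensorProduct.map LinearMap.id
        ((TensorProduct.comm k (H ⊗[k] (H ⊗[k] H)) H).toLinearMap ∘ₗ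
        (TensorProduct.assoc k H (H ⊗[k] H) H).symm.toLinearMap ∘ₗ
        TensorProduct.map LinearMap.id (TensorProduct.assoc k H H H).symm.toLinearMap),
      fun _ _ _ _ _ => rfl⟩
  have h1 : ∀ t : H ⊗[k] (H ⊗[k] H), crossOp t * leftDual q =
      F (TensorProduct.assoc k H H (H ⊗[k] (H ⊗[k] H))
      (TensorProduct.map (comul (R := k)) (TensorProduct.map LinearMap.id (comul (R := k))) t)) := by
    intro t
    induction t with
    | zero => simp
    | add x y hx hy => simp only [map_add, add_mul, hx, hy]
    | tmul a bc =>
      induction bc with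
      | zero => simp
      | add x y hx hy => simp only [map_add, add_mul, TensorProduct.tmul_add, hx, hy]
      | tmul b c =>
        refine TensorProduct.ext' fun r l => ?_
        rw [Module.End.mul_apply, leftDual_tmul, crossOp_tmul, dualRightInv_mul]
        simp only [TensorProduct.map_tmul, LinearMap.id_apply]
        generalize comul (R := k) c = t
        induction t with
        | zero => simp
        | add x y hx hy =>
          simp only [map_add, TensorProduct.tmul_add, TensorProduct.add_tmul,
            LinearMap.add_apply, hx, hy]
        | tmul c₁ c₂ =>
          simp only [TensorProduct.comm_tmul, TensorProduct.map_tmul, LinearMap.mul'_apply,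
            dualLeft_mul]
          generalize comul (R := k) a = t
          induction t with
          | zero => simp
          | add x y hx hy =>
            simp only [map_add, TensorProduct.tmul_add, TensorProduct.add_tmul,
              LinearMap.add_apply, hx, hy]
          | tmul a₁ a₂ =>
            rw [TensorProduct.assoc_tmul, hF]
            simp [leftDual_tmul, crossOp_tmul]
  have h2 : ∀ t : H ⊗[k] (H ⊗[k] H), F (TensorProduct.map LinearMap.id
      ((TensorProduct.map LinearMap.id (TensorProduct.assoc k H H H).toLinearMap ∘ₗ
        (TensorProduct.assoc k H (H ⊗[k] H) H).toLinearMap) ∘ₗ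
        TensorProduct.map (comul₃ k H) LinearMap.id) t) =
      leftMul (crossOp t (q ⊗ₜ[k] (1 : H))) := by
    intro t
    induction t with
    | zero => simp
    | add x y hx hy => simp only [map_add, LinearMap.add_apply, hx, hy]
    | tmul a bc =>
      induction bc with
      | zero => simp
      | add x y hx hy =>
        simp only [map_add, TensorProduct.tmul_add, LinearMap.add_apply, hx, hy]
      | tmul b c =>
        rw [crossOp_tmul, leftMul_tmul, mul_one, leftH, LinearMap.comp_apply]
        simp only [TensorProduct.map_tmul, LinearMap.id_apply, LinearMap.comp_apply]
        generalize comul₃ k H b = t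
        induction t with
        | zero => simp
        | add x y hx hy =>
          rw [TensorProduct.add_tmul, map_add, map_add, TensorProduct.tmul_add, map_add, hx, hy,
            map_add, mul_add]
        | tmul x yz =>
          induction yz with
          | zero => simp
          | add y z hy hz =>
            rw [TensorProduct.tmul_add, TensorProduct.add_tmul, map_add, map_add,
              TensorProduct.tmul_add, map_add, hy, hz, map_add, mul_add]
          | tmul y z => exact hF a x y z c
  rw [leftH, LinearMap.comp_apply, h1, comul₅, h2]

theorem leftMul_leftMul (x y : HDual k H ⊗[k] H) :
    leftMul (leftMul x y) = leftMul x * leftMul y := by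
  have h1 : ∀ (p : HDual k H) (t : HDual k H ⊗[k] H),
      leftMul (leftDual p t) = leftDual p * leftMul t := by
    intro p t
    induction t with
    | zero => simp
    | add x y hx hy => simp only [map_add, mul_add, hx, hy]
    | tmul q l => rw [leftDual_tmul, leftMul_tmul, leftMul_tmul, leftDual_mul, mul_assoc]
  have h2 : ∀ (t : H ⊗[k] (H ⊗[k] H)) (q : HDual k H) (l : H),
      leftMul (crossOp t (q ⊗ₜ[k] l)) = leftMul (crossOp t (q ⊗ₜ[k] (1 : H))) * leftH l := by
    intro t q l
    induction t with
    | zero => simp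
    | add x y hx hy => simp only [map_add, LinearMap.add_apply, add_mul, hx, hy]
    | tmul a bc =>
      induction bc with
      | zero => simp
      | add x y hx hy =>
        simp only [map_add, LinearMap.add_apply, TensorProduct.tmul_add, add_mul, hx, hy]
      | tmul b c =>
        simp only [crossOp_tmul, leftMul_tmul, leftH_mul, mul_one, mul_assoc]
  induction x with
  | zero => simp
  | add x z hx hz => simp only [map_add, LinearMap.add_apply, add_mul, hx, hz]
  | tmul p h =>
    induction y with
    | zero => simp
    | add x z hx hz => simp only [map_add, mul_add, hx, hz]
    | tmul q l =>
      rw [leftMul_tmul, Module.End.mul_apply, h1, leftH, LinearMap.comp_apply, h2,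
        ← LinearMap.comp_apply crossOp, ← leftH, ← leftH_mul_leftDual, leftMul_tmul]
      simp only [mul_assoc]

/-- The underlying space `H* ⊗ H` of the Drinfeld double. -/
def DrinfeldDouble (k : Type u) (H : Type v) [Field k] [Ring H] [HopfAlgebra k H] :
    Type (max u v) :=
  HDual k H ⊗[k] H

namespace DrinfeldDouble

instance : AddCommGroup (DrinfeldDouble k H) := inferInstanceAs (AddCommGroup (HDual k H ⊗[k] H))

instance : Module k (DrinfeldDouble k H) := inferInstanceAs (Module k (HDual k H ⊗[k] H))

instance : FiniteDimensional k (DrinfeldDouble k H) :=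
  Module.Finite.equiv (TensorProduct.congr (WithConv.linearEquiv k (H →ₗ[k] k)).symm
    (LinearEquiv.refl k H))

/-- The element `p ⊗ h`. -/
def mk (p : HDual k H) (h : H) : DrinfeldDouble k H := p ⊗ₜ[k] h

/-- The product is `(p ⊗ h) (q ⊗ l) = ∑ p * q (S⁻¹ h₍₃₎ * ? * h₍₁₎) ⊗ h₍₂₎ * l`. -/
instance : Ring (DrinfeldDouble k H) :=
  { (inferInstance : AddCommGroup (DrinfeldDouble k H)) with
    mul := fun x y => leftMul (k := k) (H := H) x y
    one := (1 : HDual k H) ⊗ₜ[k] (1 : H)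
    left_distrib := fun x y z => map_add (leftMul (k := k) (H := H) x) y z
    right_distrib := fun x y z => congr($(map_add (leftMul (k := k) (H := H)) x y) z)
    zero_mul := fun x => congr($(map_zero (leftMul (k := k) (H := H))) x)
    mul_zero := fun x => map_zero (leftMul (k := k) (H := H) x)
    mul_assoc := fun x y z => congr($(leftMul_leftMul (k := k) (H := H) x y) z)
    one_mul := fun x => by
      change leftMul ((1 : HDual k H) ⊗ₜ[k] (1 : H)) x = x
      rw [leftMul_tmul, leftDual_one, leftH_one]
      rfl
    mul_one := fun x => by
      change leftMul (k := k) (H := H) x ((1 : HDual k H) ⊗ₜ[k] (1 : H)) = x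
      induction x using TensorProduct.induction_on with
      | zero => simp
      | add x y hx hy =>
        rw [map_add, LinearMap.add_apply]
        exact congr($hx + $hy)
      | tmul p h =>
        rw [leftMul_tmul, Module.End.mul_apply, leftH_one_tmul_one, leftDual_tmul, mul_one] }

instance : Algebra k (DrinfeldDouble k H) :=
  Algebra.ofModule (fun c x y => congr($(map_smul (leftMul (k := k) (H := H)) c x) y))
    (fun c x y => map_smul (leftMul (k := k) (H := H) x) c y)

/-- The product in Sweedler notation. -/
theorem mk_mul_mk (p q : HDual k H) (h l : H) {ι κ : Type*} (r : Coalgebra.Repr k h ι)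
    (s : ∀ i, Coalgebra.Repr k (r.right i) κ) :
    mk p h * mk q l = ∑ i ∈ r.index, ∑ j ∈ (s i).index,
      mk (p * WithConv.toConv (q.ofConv ∘ₗ
          LinearMap.mulLeft k (antipodeInv k H ((s i).right j)) ∘ₗ
          LinearMap.mulRight k (r.left i)))
        ((s i).left j * l) := by
  change leftMul (p ⊗ₜ[k] h) (q ⊗ₜ[k] l) = _
  have h1 : comul₃ k H h = ∑ i ∈ r.index, ∑ j ∈ (s i).index,
      r.left i ⊗ₜ[k] ((s i).left j ⊗ₜ[k] (s i).right j) := by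
    rw [comul₃, LinearMap.comp_apply, ← r.eq, map_sum]
    refine Finset.sum_congr rfl fun i _ => ?_
    rw [TensorProduct.map_tmul, LinearMap.id_apply, ← (s i).eq, TensorProduct.tmul_sum]
  rw [leftMul_tmul, Module.End.mul_apply, leftH, LinearMap.comp_apply, h1]
  simp only [map_sum, LinearMap.sum_apply, crossOp_tmul, leftDual_tmul]
  rfl

end DrinfeldDouble
end DoubleAlgebra

noncomputable section DoubleHopf

attribute [local instance] HopfAux.zeroHomClass_linearMap HopfAux.zeroHomClass_linearEquiv
  HopfAux.addHomClass_linearMap HopfAux.addHomClass_linearEquiv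

universe u v
set_option linter.unusedSectionVars false
variable {k : Type u} {H : Type v} [Field k] [Ring H] [HopfAlgebra k H] [FiniteDimensional k H]

/-- Evaluation of the left tensor factor at `x`: `p ⊗ n ↦ p x • n`. -/
def evalLeft {N : Type*} [AddCommGroup N] [Module k N] (x : H) :
    HDual k H ⊗[k] N →ₗ[k] N :=
  (TensorProduct.lid k N).toLinearMap ∘ₗ
    TensorProduct.map (LinearMap.applyₗ x ∘ₗ (WithConv.linearEquiv k (H →ₗ[k] k)).toLinearMap)
      LinearMap.id

theorem evalLeft_tmul {N : Type*} [AddCommGroup N] [Module k N] (x : H) (p : HDual k H) (n : N) :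
    evalLeft x (p ⊗ₜ[k] n) = p x • n := rfl

theorem evalLeft_eq {N : Type*} [AddCommGroup N] [Module k N] (x : H)
    (t : HDual k H ⊗[k] N) : evalLeft x t = dualTensorHom k H N (TensorProduct.congr
      (WithConv.linearEquiv k (H →ₗ[k] k)) (LinearEquiv.refl k N) t) x := by
  induction t with
  | zero => simp
  | add x y hx hy => simp only [map_add, LinearMap.add_apply, hx, hy]
  | tmul p n => rfl

theorem evalLeft_ext {N : Type*} [AddCommGroup N] [Module k N] {s t : HDual k H ⊗[k] N}
    (h : ∀ x, evalLeft x s = evalLeft x t) : s = t := by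
  apply (TensorProduct.congr
    (WithConv.linearEquiv k (H →ₗ[k] k)) (LinearEquiv.refl k N)).injective
  apply HopfAux.dualTensorHom_inj
  ext x
  rw [← evalLeft_eq, ← evalLeft_eq, h]

/-- The coproduct of `H*cop`: `p ↦ ∑ p₍₁₎ ⊗ p₍₂₎` with `∑ p₍₁₎ x * p₍₂₎ y = p (y * x)`. -/
def dualComul : HDual k H →ₗ[k] HDual k H ⊗[k] HDual k H :=
  (TensorProduct.congr (WithConv.linearEquiv k (H →ₗ[k] k))
    (LinearEquiv.refl k (HDual k H))).symm.toLinearMap ∘ₗ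
    (dualTensorHomEquiv k H (HDual k H)).symm.toLinearMap ∘ₗ dualLeft.toLinearMap.flip

theorem evalLeft_dualComul (x : H) (p : HDual k H) : evalLeft x (dualComul p) = dualLeft x p := by
  rw [evalLeft_eq, dualComul, LinearMap.comp_apply, LinearEquiv.coe_coe,
    LinearEquiv.apply_symm_apply, LinearMap.comp_apply]
  exact congr($((dualTensorHomEquiv k H (HDual k H)).apply_symm_apply
    (dualLeft.toLinearMap.flip p)) x)

/-- The counit of `H*cop`: evaluation at `1`. -/
def dualCounit : HDual k H →ₗ[k] k :=
  LinearMap.applyₗ (1 : H) ∘ₗ (WithConv.linearEquiv k (H →ₗ[k] k)).toLinearMap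

theorem dualCounit_apply (p : HDual k H) : dualCounit p = p 1 := rfl

theorem evalLeft_map {N N' : Type*} [AddCommGroup N] [Module k N] [AddCommGroup N'] [Module k N']
    (x : H) (f : N →ₗ[k] N') (t : HDual k H ⊗[k] N) :
    evalLeft x (TensorProduct.map LinearMap.id f t) = f (evalLeft x t) := by
  induction t with
  | zero => simp
  | add x y hx hy => simp only [map_add, hx, hy]
  | tmul p n => simp [evalLeft_tmul]

variable (k H) in
/-- The coalgebra `H*cop`. -/
@[reducible] def dualCopCoalgebra : Coalgebra k (HDual k H) where
  comul := dualComul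
  counit := dualCounit
  coassoc := by
    ext1 p
    apply evalLeft_ext (N := HDual k H ⊗[k] HDual k H)
    intro x
    apply evalLeft_ext
    intro y
    simp only [LinearMap.comp_apply, LinearMap.lTensor_def, LinearMap.rTensor_def,
      LinearEquiv.coe_coe]
    rw [evalLeft_map, evalLeft_dualComul, evalLeft_dualComul, ← Module.End.mul_apply, ← map_mul,
      ← evalLeft_dualComul (y * x) p]
    generalize dualComul p = t
    induction t with
    | zero => simp
    | add x y hx hy => simp only [map_add, hx, hy]
    | tmul a b =>
      have h1 : ∀ s : HDual k H ⊗[k] HDual k H,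
          evalLeft x (TensorProduct.assoc k (HDual k H) (HDual k H) (HDual k H) (s ⊗ₜ b)) =
            evalLeft x s ⊗ₜ b := by
        intro s
        induction s with
        | zero => simp
        | add x y hx hy => simp only [map_add, TensorProduct.add_tmul, hx, hy]
        | tmul c d => simp [evalLeft_tmul, TensorProduct.smul_tmul']
      simp only [TensorProduct.map_tmul, LinearMap.id_apply]
      rw [h1, evalLeft_dualComul, evalLeft_tmul, evalLeft_tmul, dualLeft_apply]
  rTensor_counit_comp_comul := by
    ext1 p
    simp only [LinearMap.comp_apply, LinearMap.rTensor_def]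
    apply (TensorProduct.lid k (HDual k H)).injective
    have h1 : ∀ t : HDual k H ⊗[k] HDual k H, TensorProduct.lid k (HDual k H)
        (TensorProduct.map dualCounit LinearMap.id t) = evalLeft 1 t := by
      intro t; rfl
    rw [h1, evalLeft_dualComul, map_one]
    simp
  lTensor_counit_comp_comul := by
    ext1 p
    simp only [LinearMap.comp_apply, LinearMap.lTensor_def]
    apply evalLeft_ext
    intro x
    rw [evalLeft_map, evalLeft_dualComul]
    simp [evalLeft_tmul, dualCounit_apply, dualLeft_apply]

theorem evalLeft_mul (x : H) (s t : HDual k H ⊗[k] HDual k H) :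
    evalLeft x (TensorProduct.map (LinearMap.mul' k (HDual k H)) (LinearMap.mul' k (HDual k H))
      (TensorProduct.tensorTensorTensorComm k (HDual k H) (HDual k H) (HDual k H) (HDual k H)
        (s ⊗ₜ t))) =
    LinearMap.mul' k (HDual k H) (TensorProduct.map
      (dualTensorHom k H (HDual k H) (TensorProduct.congr
        (WithConv.linearEquiv k (H →ₗ[k] k)) (LinearEquiv.refl k (HDual k H)) s))
      (dualTensorHom k H (HDual k H) (TensorProduct.congr
        (WithConv.linearEquiv k (H →ₗ[k] k)) (LinearEquiv.refl k (HDual k H)) t))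
      (comul (R := k) x)) := by
  induction s with
  | zero => simp
  | add y z hy hz => simp only [TensorProduct.add_tmul, map_add, hy, hz,
      TensorProduct.map_add_left, LinearMap.add_apply]
  | tmul p p' =>
    induction t with
    | zero => simp
    | add y z hy hz => simp only [TensorProduct.tmul_add, map_add, hy, hz,
        TensorProduct.map_add_right, LinearMap.add_apply]
    | tmul q q' =>
      simp only [TensorProduct.tensorTensorTensorComm_tmul, TensorProduct.map_tmul,
        LinearMap.mul'_apply, evalLeft_tmul, LinearMap.convMul_apply]
      generalize comul (R := k) x = r
      induction r with
      | zero => simp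
      | add y z hy hz => simp only [map_add, add_smul, hy, hz]
      | tmul y z =>
        simp only [TensorProduct.map_tmul, LinearMap.mul'_apply, dualTensorHom_apply,
          TensorProduct.congr_tmul, LinearEquiv.refl_apply, WithConv.linearEquiv_apply]
        rw [mul_comm (p.ofConv y), mul_smul, mul_smul_comm]
        congr 1
        exact (smul_mul_assoc _ _ _).symm

theorem dualComul_mul (p q : HDual k H) : dualComul (p * q) =
    TensorProduct.map (LinearMap.mul' k (HDual k H)) (LinearMap.mul' k (HDual k H))
      (TensorProduct.tensorTensorTensorComm k (HDual k H) (HDual k H) (HDual k H) (HDual k H)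
        (dualComul p ⊗ₜ dualComul q)) := by
  apply evalLeft_ext
  intro x
  rw [evalLeft_mul, evalLeft_dualComul, dualLeft_mul]
  congr 2
  congr 1
  · ext1 y; exact (evalLeft_dualComul y p).symm.trans (evalLeft_eq _ _)
  · ext1 y; exact (evalLeft_dualComul y q).symm.trans (evalLeft_eq _ _)

theorem dualComul_one : dualComul (1 : HDual k H) = 1 := by
  apply evalLeft_ext
  intro x
  rw [evalLeft_dualComul, dualLeft_one, Algebra.TensorProduct.one_def, evalLeft_tmul]
  simp [LinearMap.convOne_apply]

theorem dualComul_dualLeft (a : H) (p : HDual k H) : dualComul (dualLeft a p) =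
    TensorProduct.map (dualLeft a) LinearMap.id (dualComul p) := by
  apply evalLeft_ext
  intro x
  rw [evalLeft_dualComul, ← Module.End.mul_apply, ← map_mul, ← evalLeft_dualComul]
  generalize dualComul p = t
  induction t with
  | zero => simp
  | add x y hx hy => simp only [map_add, hx, hy]
  | tmul p q => rfl

theorem dualComul_dualRightInv (a : H) (p : HDual k H) : dualComul (dualRightInv a p) =
    TensorProduct.map LinearMap.id (dualRightInv a) (dualComul p) := by
  apply evalLeft_ext
  intro x
  rw [evalLeft_dualComul, evalLeft_map, evalLeft_dualComul, dualLeft_dualRightInv]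

theorem mul_antipodeInv_comul (h : H) : LinearMap.mul' k H (TensorProduct.comm k H H
    (TensorProduct.map (antipodeInv k H) LinearMap.id (comul (R := k) h))) =
      algebraMap k H (counit (R := k) h) := by
  apply (HopfAux.antipode_bijective (k := k) (H := H)).1
  rw [Algebra.algebraMap_eq_smul_one, map_smul, antipode_one, ← Algebra.algebraMap_eq_smul_one,
    ← HopfAux.id_mul_antipode_apply]
  generalize comul (R := k) h = t
  induction t with
  | zero => simp
  | add y z hy hz => simp only [map_add, hy, hz]
  | tmul a b => simp [HopfAlgebra.antipode_mul_antidistrib, antipode_antipodeInv]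

theorem antipodeInv_mul_comul (h : H) : LinearMap.mul' k H (TensorProduct.comm k H H
    (TensorProduct.map LinearMap.id (antipodeInv k H) (comul (R := k) h))) =
      algebraMap k H (counit (R := k) h) := by
  apply (HopfAux.antipode_bijective (k := k) (H := H)).1
  rw [Algebra.algebraMap_eq_smul_one, map_smul, antipode_one, ← Algebra.algebraMap_eq_smul_one,
    ← HopfAux.antipode_mul_id_apply]
  generalize comul (R := k) h = t
  induction t with
  | zero => simp
  | add y z hy hz => simp only [map_add, hy, hz]
  | tmul a b => simp [HopfAlgebra.antipode_mul_antidistrib, antipode_antipodeInv]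

/-- `∑ p₍₁₎ (S⁻¹ h₍₁₎ * ?) ⊗ p₍₂₎ (? * h₍₂₎) = ε h • ∑ p₍₁₎ ⊗ p₍₂₎`. -/
theorem map_dualRightInv_dualLeft (h : H) (p : HDual k H) :
    TensorProduct.homTensorHomMap (RingHom.id k) (HDual k H) (HDual k H) (HDual k H) (HDual k H)
      (TensorProduct.map dualRightInv.toLinearMap dualLeft.toLinearMap (comul (R := k) h))
      (dualComul p) = counit (R := k) h • dualComul p := by
  apply evalLeft_ext
  intro x
  have h1 : ∀ t : H ⊗[k] H, evalLeft x (TensorProduct.homTensorHomMap (RingHom.id k) (HDual k H)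
      (HDual k H) (HDual k H) (HDual k H)
      (TensorProduct.map dualRightInv.toLinearMap dualLeft.toLinearMap t) (dualComul p)) =
      dualLeft (LinearMap.mul' k H (TensorProduct.comm k H H
        (TensorProduct.map (antipodeInv k H) LinearMap.id t)) * x) p := by
    intro t
    induction t with
    | zero => simp
    | add x y hx hy => simp only [map_add, LinearMap.add_apply, add_mul, hx, hy]
    | tmul a b =>
      simp only [TensorProduct.map_tmul, TensorProduct.comm_tmul, LinearMap.mul'_apply,
        LinearMap.id_apply, mul_assoc, map_mul dualLeft b, Module.End.mul_apply]
      rw [← evalLeft_dualComul (antipodeInv k H a * x) p]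
      generalize dualComul p = t
      induction t with
      | zero => simp
      | add x y hx hy => simp only [map_add, hx, hy]
      | tmul p q =>
        simp [evalLeft_tmul, dualRightInv_apply]
  rw [h1, mul_antipodeInv_comul, map_smul, evalLeft_dualComul, Algebra.algebraMap_eq_smul_one,
    smul_mul_assoc, one_mul, map_smul, LinearMap.smul_apply]

end DoubleHopf

noncomputable section DoubleHopf₂

attribute [local instance] HopfAux.zeroHomClass_linearMap HopfAux.zeroHomClass_linearEquiv
  HopfAux.addHomClass_linearMap HopfAux.addHomClass_linearEquiv

universe u v
set_option linter.unusedSectionVars false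
variable {k : Type u} {H : Type v} [Field k] [Ring H] [HopfAlgebra k H] [FiniteDimensional k H]

namespace DrinfeldDouble

variable (k H) in
/-- The identification of the double with `H* ⊗ H`. -/
def tensorEquiv : HDual k H ⊗[k] H ≃ₗ[k] DrinfeldDouble k H :=
  LinearEquiv.refl k (HDual k H ⊗[k] H)

theorem tensorEquiv_tmul (p : HDual k H) (h : H) : tensorEquiv k H (p ⊗ₜ h) = mk p h := rfl

/-- As a coalgebra, the double is `H*cop ⊗ H`. -/
instance : Coalgebra k (DrinfeldDouble k H) :=
  letI := dualCopCoalgebra k H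
  inferInstanceAs (Coalgebra k (HDual k H ⊗[k] H))

variable (k H) in
/-- The inclusion `p ↦ p ⊗ 1`. -/
def ofDual : HDual k H →ₐ[k] DrinfeldDouble k H :=
  AlgHom.ofLinearMap ((TensorProduct.mk k (HDual k H) H).flip 1) rfl (fun p q => by
    change (p * q) ⊗ₜ[k] (1 : H) = leftMul (p ⊗ₜ[k] (1 : H)) (q ⊗ₜ[k] (1 : H))
    rw [leftMul_tmul, leftH_one, mul_one, leftDual_tmul])

theorem ofDual_apply (p : HDual k H) : ofDual k H p = mk p (1 : H) := rfl

variable (k H) in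
/-- The inclusion `h ↦ 1 ⊗ h`. -/
def ofH : H →ₐ[k] DrinfeldDouble k H :=
  AlgHom.ofLinearMap (TensorProduct.mk k (HDual k H) H 1) rfl (fun a b => by
    change (1 : HDual k H) ⊗ₜ[k] (a * b) =
      leftMul ((1 : HDual k H) ⊗ₜ[k] a) ((1 : HDual k H) ⊗ₜ[k] b)
    rw [leftMul_tmul, leftDual_one, one_mul, ← leftH_one_tmul_one, ← leftH_one_tmul_one b,
      leftH_mul, Module.End.mul_apply])

theorem ofH_apply (h : H) : ofH k H h = mk (1 : HDual k H) h := rfl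

theorem ofDual_mul_ofH (p : HDual k H) (h : H) : ofDual k H p * ofH k H h = mk p h := by
  change leftMul (p ⊗ₜ[k] (1 : H)) ((1 : HDual k H) ⊗ₜ[k] h) = p ⊗ₜ[k] h
  rw [leftMul_tmul, leftH_one, mul_one, leftDual_tmul, mul_one]

theorem ofH_mul_ofDual (p : HDual k H) (h : H) :
    ofH k H h * ofDual k H p = tensorEquiv k H (leftH h (p ⊗ₜ[k] (1 : H))) := by
  change leftMul ((1 : HDual k H) ⊗ₜ[k] h) (p ⊗ₜ[k] (1 : H)) = _
  rw [leftMul_tmul, leftDual_one, one_mul]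
  rfl

theorem induction_on {P : DrinfeldDouble k H → Prop} (x : DrinfeldDouble k H)
    (zero : P 0) (mk : ∀ p h, P (ofDual k H p * ofH k H h)) (add : ∀ x y, P x → P y → P (x + y)) : P x := by
  refine TensorProduct.induction_on (motive := P) x zero (fun p h => ?_) add
  have := mk p h
  rwa [ofDual_mul_ofH] at this

theorem counit_mk (p : HDual k H) (h : H) :
    counit (R := k) (mk p h) = counit (R := k) h * p 1 := rfl

theorem comul_mk (p : HDual k H) (h : H) : comul (R := k) (mk p h) =
    TensorProduct.map (ofDual k H).toLinearMap (ofDual k H).toLinearMap (dualComul p) *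
      TensorProduct.map (ofH k H).toLinearMap (ofH k H).toLinearMap (comul (R := k) h) := by
  change TensorProduct.tensorTensorTensorComm k (HDual k H) (HDual k H) H H
    (dualComul p ⊗ₜ comul (R := k) h) = _
  generalize comul (R := k) h = t
  generalize dualComul p = s
  induction s with
  | zero => simp; rfl
  | add x y hx hy => simp only [map_add, TensorProduct.add_tmul, add_mul, hx, hy]; rfl
  | tmul p q =>
    induction t with
    | zero => simp; rfl
    | add x y hx hy => simp only [map_add, TensorProduct.tmul_add, mul_add, hx, hy]; rfl
    | tmul a b =>
      simp only [TensorProduct.map_tmul, Algebra.TensorProduct.tmul_mul_tmul,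
        AlgHom.toLinearMap_apply, ofDual_mul_ofH]
      rfl

/-- Products of the components of a coproduct of `H` and of the dual, straightened. -/
theorem exists_op : ∃ M : HDual k H ⊗[k] HDual k H →ₗ[k] H ⊗[k] (H ⊗[k] (H ⊗[k] H)) →ₗ[k]
    DrinfeldDouble k H ⊗[k] DrinfeldDouble k H, ∀ p q a b c d,
      M (p ⊗ₜ q) (a ⊗ₜ (b ⊗ₜ (c ⊗ₜ d))) =
        mk (dualLeft a p) b ⊗ₜ mk (dualRightInv d q) c := by
  let L₁ : HDual k H →ₗ[k] H ⊗[k] H →ₗ[k] HDual k H ⊗[k] H :=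
    (TensorProduct.mapBilinear (RingHom.id k) H H (HDual k H) H).flip LinearMap.id ∘ₗ
      dualLeft.toLinearMap.flip
  let L₂ : HDual k H →ₗ[k] H ⊗[k] H →ₗ[k] HDual k H ⊗[k] H :=
    LinearMap.lcomp k (HDual k H ⊗[k] H) (TensorProduct.comm k H H).toLinearMap ∘ₗ
    (TensorProduct.mapBilinear (RingHom.id k) H H (HDual k H) H).flip LinearMap.id ∘ₗ
      dualRightInv.toLinearMap.flip
  exact ⟨(LinearMap.lcomp k _ (TensorProduct.assoc k H H (H ⊗[k] H)).symm.toLinearMap ∘ₗ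
    TensorProduct.homTensorHomMap (RingHom.id k) _ _ _ _ ∘ₗ TensorProduct.map L₁ L₂).compr₂
      (TensorProduct.map (tensorEquiv k H).toLinearMap (tensorEquiv k H).toLinearMap),
    fun _ _ _ _ _ _ => rfl⟩

theorem exists_op₂ : ∃ N : HDual k H ⊗[k] HDual k H →ₗ[k]
    (H ⊗[k] (H ⊗[k] H)) ⊗[k] (H ⊗[k] (H ⊗[k] H)) →ₗ[k]
    DrinfeldDouble k H ⊗[k] DrinfeldDouble k H, ∀ p q t t',
      N (p ⊗ₜ q) (t ⊗ₜ t') = tensorEquiv k H (crossOp t (p ⊗ₜ[k] (1 : H))) ⊗ₜ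
        tensorEquiv k H (crossOp t' (q ⊗ₜ[k] (1 : H))) := by
  let L : HDual k H →ₗ[k] H ⊗[k] (H ⊗[k] H) →ₗ[k] HDual k H ⊗[k] H :=
    crossOp.flip ∘ₗ (TensorProduct.mk k (HDual k H) H).flip 1
  exact ⟨(TensorProduct.homTensorHomMap (RingHom.id k) _ _ _ _ ∘ₗ TensorProduct.map L L).compr₂
      (TensorProduct.map (tensorEquiv k H).toLinearMap (tensorEquiv k H).toLinearMap),
    fun _ _ _ _ => rfl⟩

theorem comul_ofH (h : H) : comul (R := k) (ofH k H h) =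
    TensorProduct.map (ofH k H).toLinearMap (ofH k H).toLinearMap (comul (R := k) h) := by
  rw [ofH_apply, comul_mk, dualComul_one]
  have : TensorProduct.map (ofDual k H).toLinearMap (ofDual k H).toLinearMap
      (1 : HDual k H ⊗[k] HDual k H) = 1 := by
    change ofDual k H 1 ⊗ₜ[k] ofDual k H 1 = _
    rw [map_one]; rfl
  rw [this, one_mul]

theorem comul_ofDual (p : HDual k H) : comul (R := k) (ofDual k H p) =
    TensorProduct.map (ofDual k H).toLinearMap (ofDual k H).toLinearMap (dualComul p) := by
  rw [ofDual_apply, comul_mk, Bialgebra.comul_one]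
  have : TensorProduct.map (ofH k H).toLinearMap (ofH k H).toLinearMap
      (1 : H ⊗[k] H) = 1 := by
    change ofH k H 1 ⊗ₜ[k] ofH k H 1 = _
    rw [map_one]; rfl
  rw [this, mul_one]

theorem comul_six (h : H) :
    TensorProduct.map (comul₃ k H) (comul₃ k H) (comul (R := k) h) =
    ((TensorProduct.assoc k H (H ⊗[k] H) (H ⊗[k] (H ⊗[k] H))).symm.toLinearMap ∘ₗ
      TensorProduct.map LinearMap.id
        ((TensorProduct.assoc k H H (H ⊗[k] (H ⊗[k] H))).symm.toLinearMap ∘ₗ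
          TensorProduct.map LinearMap.id (
            (TensorProduct.assoc k H H (H ⊗[k] H)).toLinearMap ∘ₗ
            TensorProduct.map (comul (R := k)) LinearMap.id)))
      (TensorProduct.map LinearMap.id (TensorProduct.map LinearMap.id (comul₃ k H))
        (comul₃ k H h)) := by
  have : TensorProduct.map (comul₃ k H) (comul₃ k H) ∘ₗ comul (R := k) =
    ((TensorProduct.assoc k H (H ⊗[k] H) (H ⊗[k] (H ⊗[k] H))).symm.toLinearMap ∘ₗ
      TensorProduct.map LinearMap.id
        ((TensorProduct.assoc k H H (H ⊗[k] (H ⊗[k] H))).symm.toLinearMap ∘ₗ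
          TensorProduct.map LinearMap.id (
            (TensorProduct.assoc k H H (H ⊗[k] H)).toLinearMap ∘ₗ
            TensorProduct.map (comul (R := k)) LinearMap.id))) ∘ₗ
      TensorProduct.map LinearMap.id (TensorProduct.map LinearMap.id (comul₃ k H)) ∘ₗ
        comul₃ k H := by
    simp only [comul₃, coassoc_simps]
  exact congr($this h)

/-- The coproduct respects the straightening relation. -/
theorem comul_ofH_mul_ofDual (h : H) (p : HDual k H) :
    comul (R := k) (ofH k H h * ofDual k H p) =
      comul (R := k) (ofH k H h) * comul (R := k) (ofDual k H p) := by
  obtain ⟨M, hM⟩ := exists_op (k := k) (H := H)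
  -- left-hand side
  have hl : ∀ t : H ⊗[k] (H ⊗[k] H), comul (R := k)
      (tensorEquiv k H (crossOp t (p ⊗ₜ[k] (1 : H)))) =
      M (dualComul p) (TensorProduct.map LinearMap.id ((TensorProduct.assoc k H H H).toLinearMap ∘ₗ
        TensorProduct.map (comul (R := k)) LinearMap.id) t) := by
    intro t
    induction t with
    | zero => simp
    | add x y hx hy => simp only [map_add, LinearMap.add_apply, hx, hy]
    | tmul a bc =>
      induction bc with
      | zero => simp
      | add x y hx hy =>
        simp only [map_add, LinearMap.add_apply, TensorProduct.tmul_add, hx, hy]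
      | tmul b c =>
        rw [crossOp_tmul, tensorEquiv_tmul, comul_mk, dualComul_dualLeft, dualComul_dualRightInv,
          mul_one]
        simp only [TensorProduct.map_tmul, LinearMap.id_apply, LinearMap.comp_apply]
        generalize dualComul p = s
        generalize comul (R := k) b = t
        induction s with
        | zero => simp
        | add x y hx hy => simp only [map_add, LinearMap.add_apply, add_mul, hx, hy]
        | tmul q r =>
          induction t with
          | zero => simp
          | add x y hx hy =>
            simp only [map_add, TensorProduct.add_tmul, TensorProduct.tmul_add, mul_add, hx, hy]
          | tmul d e =>
            rw [LinearEquiv.coe_coe, TensorProduct.assoc_tmul, hM]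
            simp only [TensorProduct.map_tmul, Algebra.TensorProduct.tmul_mul_tmul,
              AlgHom.toLinearMap_apply, ofDual_mul_ofH, LinearMap.id_apply]
  -- right-hand side
  have hr : comul (R := k) (ofH k H h) * comul (R := k) (ofDual k H p) =
      M (dualComul p) (TensorProduct.map LinearMap.id
        (TensorProduct.map LinearMap.id (comul (R := k))) (comul₃ k H h)) := by
    obtain ⟨N, hN⟩ := exists_op₂ (k := k) (H := H)
    have h1 : ∀ (s : HDual k H ⊗[k] HDual k H) (t : H ⊗[k] H),
        TensorProduct.map (ofH k H).toLinearMap (ofH k H).toLinearMap t *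
          TensorProduct.map (ofDual k H).toLinearMap (ofDual k H).toLinearMap s =
        N s (TensorProduct.map (comul₃ k H) (comul₃ k H) t) := by
      intro s t
      induction s with
      | zero => simp
      | add x y hx hy => simp only [map_add, LinearMap.add_apply, mul_add, hx, hy]
      | tmul q r =>
        induction t with
        | zero => simp
        | add x y hx hy => simp only [map_add, add_mul, hx, hy]
        | tmul d e =>
          simp only [TensorProduct.map_tmul, Algebra.TensorProduct.tmul_mul_tmul,
            AlgHom.toLinearMap_apply, ofH_mul_ofDual, hN]
          rfl
    have h2 : ∀ (s : HDual k H ⊗[k] HDual k H) (a b e f : H) (t : H ⊗[k] H),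
        N s ((TensorProduct.assoc k H (H ⊗[k] H) (H ⊗[k] (H ⊗[k] H))).symm
          (a ⊗ₜ ((TensorProduct.assoc k H H (H ⊗[k] (H ⊗[k] H))).symm
            (b ⊗ₜ (TensorProduct.assoc k H H (H ⊗[k] H) (t ⊗ₜ (e ⊗ₜ f))))))) =
        M (TensorProduct.homTensorHomMap (RingHom.id k) (HDual k H) (HDual k H) (HDual k H)
          (HDual k H) (TensorProduct.map dualRightInv.toLinearMap dualLeft.toLinearMap t) s)
          (a ⊗ₜ (b ⊗ₜ (e ⊗ₜ f))) := by
      intro s a b e f t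
      induction t with
      | zero => simp
      | add x y hx hy =>
        simp only [map_add, LinearMap.add_apply, TensorProduct.add_tmul,
          TensorProduct.tmul_add, hx, hy]
      | tmul c d =>
        induction s with
        | zero => simp
        | add x y hx hy => simp only [map_add, LinearMap.add_apply, hx, hy]
        | tmul q r =>
          simp only [TensorProduct.assoc_tmul, TensorProduct.assoc_symm_tmul, hN, crossOp_tmul,
            TensorProduct.map_tmul, TensorProduct.homTensorHomMap_apply, hM, mul_one,
            AlgHom.toLinearMap_apply, dualLeft_dualRightInv, tensorEquiv_tmul]
    have h3 : ∀ t : H ⊗[k] (H ⊗[k] (H ⊗[k] (H ⊗[k] H))), N (dualComul p)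
        (((TensorProduct.assoc k H (H ⊗[k] H) (H ⊗[k] (H ⊗[k] H))).symm.toLinearMap ∘ₗ
      TensorProduct.map LinearMap.id
        ((TensorProduct.assoc k H H (H ⊗[k] (H ⊗[k] H))).symm.toLinearMap ∘ₗ
          TensorProduct.map LinearMap.id (
            (TensorProduct.assoc k H H (H ⊗[k] H)).toLinearMap ∘ₗ
            TensorProduct.map (comul (R := k)) LinearMap.id))) t) =
        M (dualComul p) (TensorProduct.map LinearMap.id (TensorProduct.map LinearMap.id
          ((TensorProduct.lid k (H ⊗[k] H)).toLinearMap ∘ₗ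
            TensorProduct.map (counit (R := k)) LinearMap.id)) t) := by
      intro t
      rw [← LinearMap.comp_apply (N (dualComul p)), ← LinearMap.comp_apply (M (dualComul p))]
      congr 1
      ext a b x e f
      simp only [LinearMap.comp_apply, TensorProduct.AlgebraTensorModule.curry_apply,
        TensorProduct.curry_apply, LinearMap.coe_restrictScalars, LinearEquiv.coe_coe,
        TensorProduct.map_tmul, LinearMap.id_apply, TensorProduct.lid_tmul]
      rw [h2, map_dualRightInv_dualLeft, map_smul, LinearMap.smul_apply,
        TensorProduct.tmul_smul, TensorProduct.tmul_smul, map_smul]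
    rw [comul_ofH, comul_ofDual, h1, comul_six, h3, ← LinearMap.comp_apply (TensorProduct.map _ _),
      ← TensorProduct.map_comp, ← TensorProduct.map_comp, LinearMap.id_comp]
    have h4 : ((TensorProduct.lid k (H ⊗[k] H)).toLinearMap ∘ₗ
        TensorProduct.map (counit (R := k)) LinearMap.id) ∘ₗ comul₃ k H = comul (R := k) := by
      ext x
      have h5 : ∀ t : H ⊗[k] H, TensorProduct.lid k (H ⊗[k] H)
          (TensorProduct.map (counit (R := k)) LinearMap.id
            (TensorProduct.map LinearMap.id (comul (R := k)) t)) =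
          comul (R := k) (TensorProduct.lid k H
            (TensorProduct.map (counit (R := k) (A := H)) LinearMap.id t)) := by
        intro t
        induction t with
        | zero => simp
        | add x y hx hy => simp only [map_add, hx, hy]
        | tmul a b => simp
      exact (h5 _).trans (congr(comul (R := k)
        (TensorProduct.lid k H $(rTensor_counit_comul (R := k) x))).trans (by simp))
    rw [h4]
  rw [ofH_mul_ofDual, leftH, LinearMap.comp_apply, hl, hr]
  congr 1
  have : TensorProduct.map LinearMap.id ((TensorProduct.assoc k H H H).toLinearMap ∘ₗ
        TensorProduct.map (comul (R := k)) LinearMap.id) ∘ₗ comul₃ k H =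
      TensorProduct.map LinearMap.id
        (TensorProduct.map LinearMap.id (comul (R := k))) ∘ₗ comul₃ k H := by
    simp only [comul₃, coassoc_simps]
  exact congr($this h)

theorem comul_mul (x y : DrinfeldDouble k H) :
    comul (R := k) (x * y) = comul (R := k) x * comul (R := k) y := by
  have hA : ∀ p q : HDual k H, TensorProduct.map (ofDual k H).toLinearMap
      (ofDual k H).toLinearMap (dualComul (p * q)) =
      TensorProduct.map (ofDual k H).toLinearMap (ofDual k H).toLinearMap (dualComul p) *
      TensorProduct.map (ofDual k H).toLinearMap (ofDual k H).toLinearMap (dualComul q) := by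
    intro p q
    rw [dualComul_mul]
    generalize dualComul p = s
    generalize dualComul q = t
    induction s with
    | zero => simp
    | add x y hx hy => simp only [map_add, TensorProduct.add_tmul, add_mul, hx, hy]
    | tmul a b =>
      induction t with
      | zero => simp
      | add x y hx hy => simp only [map_add, TensorProduct.tmul_add, mul_add, hx, hy]
      | tmul c d => simp
  have hB : ∀ a b : H, TensorProduct.map (ofH k H).toLinearMap
      (ofH k H).toLinearMap (comul (R := k) (a * b)) =
      TensorProduct.map (ofH k H).toLinearMap (ofH k H).toLinearMap (comul (R := k) a) *
      TensorProduct.map (ofH k H).toLinearMap (ofH k H).toLinearMap (comul (R := k) b) := by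
    intro a b
    rw [Bialgebra.comul_mul]
    exact map_mul (Algebra.TensorProduct.map (ofH k H) (ofH k H)) _ _
  have hl : ∀ (p : HDual k H) (t : DrinfeldDouble k H),
      comul (R := k) (ofDual k H p * t) = comul (R := k) (ofDual k H p) * comul (R := k) t := by
    intro p t
    induction t using induction_on with
    | zero => simp
    | add x y hx hy => simp only [mul_add, map_add, hx, hy]
    | mk q h =>
      rw [← mul_assoc, ← map_mul, ofDual_mul_ofH, ofDual_mul_ofH, comul_mk, comul_mk, hA,
        comul_ofDual, mul_assoc]
  have hr : ∀ (t : DrinfeldDouble k H) (h : H),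
      comul (R := k) (t * ofH k H h) = comul (R := k) t * comul (R := k) (ofH k H h) := by
    intro t l
    induction t using induction_on with
    | zero => simp
    | add x y hx hy => simp only [add_mul, map_add, hx, hy]
    | mk q h =>
      rw [mul_assoc, ← map_mul, ofDual_mul_ofH, ofDual_mul_ofH, comul_mk, comul_mk, hB,
        comul_ofH, mul_assoc]
  induction x using induction_on with
  | zero => simp
  | add x y hx hy => simp only [add_mul, map_add, hx, hy]
  | mk p h =>
    induction y using induction_on with
    | zero => simp
    | add x y hx hy => simp only [mul_add, map_add, hx, hy]
    | mk q l =>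
      rw [mul_assoc, ← mul_assoc (ofH k H h), hl, hr, comul_ofH_mul_ofDual, hl p, hl q]
      simp only [mul_assoc]

theorem counit_ofH_mul_ofDual (h : H) (p : HDual k H) :
    counit (R := k) (ofH k H h * ofDual k H p) = counit (R := k) h * p 1 := by
  have h1 : ∀ t : H ⊗[k] (H ⊗[k] H),
      counit (R := k) (tensorEquiv k H (crossOp t (p ⊗ₜ[k] (1 : H)))) =
      p (LinearMap.mul' k H (TensorProduct.comm k H H (TensorProduct.map LinearMap.id
        (antipodeInv k H ∘ₗ (TensorProduct.lid k H).toLinearMap ∘ₗ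
          TensorProduct.map (counit (R := k)) LinearMap.id) t))) := by
    intro t
    induction t with
    | zero => simp
    | add x y hx hy => simp only [map_add, LinearMap.add_apply, hx, hy]
    | tmul a bc =>
      induction bc with
      | zero => simp
      | add x y hx hy =>
        simp only [map_add, LinearMap.add_apply, TensorProduct.tmul_add, hx, hy]
      | tmul b c =>
        rw [crossOp_tmul, tensorEquiv_tmul, counit_mk]
        simp [dualLeft_apply, dualRightInv_apply]
  have h2 : (TensorProduct.lid k H).toLinearMap ∘ₗ
      TensorProduct.map (counit (R := k)) LinearMap.id ∘ₗ comul (R := k) (A := H) =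
      LinearMap.id := by
    ext x
    exact congr(TensorProduct.lid k H $(rTensor_counit_comul (R := k) x)).trans (by simp)
  rw [ofH_mul_ofDual, leftH, LinearMap.comp_apply, h1, comul₃, LinearMap.comp_apply,
    ← LinearMap.comp_apply (TensorProduct.map _ _), ← TensorProduct.map_comp,
    LinearMap.comp_assoc, LinearMap.comp_assoc, h2, LinearMap.comp_id, LinearMap.comp_id,
    antipodeInv_mul_comul, Algebra.algebraMap_eq_smul_one, map_smul, smul_eq_mul]

theorem counit_mul (x y : DrinfeldDouble k H) :
    counit (R := k) (x * y) = counit (R := k) x * counit (R := k) y := by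
  have hl : ∀ (p : HDual k H) (t : DrinfeldDouble k H),
      counit (R := k) (ofDual k H p * t) = p 1 * counit (R := k) t := by
    intro p t
    induction t using induction_on with
    | zero => simp
    | add x y hx hy => simp only [mul_add, map_add, hx, hy]
    | mk q h =>
      rw [← mul_assoc, ← map_mul, ofDual_mul_ofH, ofDual_mul_ofH, counit_mk, counit_mk,
        LinearMap.convMul_apply]
      simp [Algebra.TensorProduct.one_def]
      ring
  have hr : ∀ (t : DrinfeldDouble k H) (h : H),
      counit (R := k) (t * ofH k H h) = counit (R := k) t * counit (R := k) h := by
    intro t l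
    induction t using induction_on with
    | zero => simp
    | add x y hx hy => simp only [add_mul, map_add, hx, hy]
    | mk q h =>
      rw [mul_assoc, ← map_mul, ofDual_mul_ofH, ofDual_mul_ofH, counit_mk, counit_mk,
        Bialgebra.counit_mul]
      ring
  induction x using induction_on with
  | zero => simp
  | add x y hx hy => simp only [add_mul, map_add, hx, hy]
  | mk p h =>
    induction y using induction_on with
    | zero => simp
    | add x y hx hy => simp only [mul_add, map_add, hx, hy]
    | mk q l =>
      rw [mul_assoc, ← mul_assoc (ofH k H h), hl, hr, counit_ofH_mul_ofDual,
        ofDual_mul_ofH, ofDual_mul_ofH, counit_mk, counit_mk]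
      ring

instance : Bialgebra k (DrinfeldDouble k H) :=
  Bialgebra.mk' k (DrinfeldDouble k H)
    (by
      change counit (R := k) (mk (1 : HDual k H) (1 : H)) = 1
      simp [counit_mk, LinearMap.convOne_apply])
    (counit_mul _ _)
    (by
      change comul (R := k) (ofH k H 1) = 1
      rw [comul_ofH, Bialgebra.comul_one]
      change ofH k H 1 ⊗ₜ[k] ofH k H 1 = _
      rw [map_one]; rfl)
    (comul_mul _ _)

variable (k H) in
/-- The antipode `p ↦ p ∘ S⁻¹` of `H*cop`. -/
def dualAntipode : HDual k H →ₗ[k] HDual k H :=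
  (WithConv.linearEquiv k (H →ₗ[k] k)).symm.toLinearMap ∘ₗ
    LinearMap.lcomp k k (antipodeInv k H) ∘ₗ (WithConv.linearEquiv k (H →ₗ[k] k)).toLinearMap

theorem dualAntipode_apply (p : HDual k H) (x : H) :
    dualAntipode k H p x = p (antipodeInv k H x) := rfl

/-- The pairing `y ⊗ z ↦ ∑ p y * q z` attached to `∑ p ⊗ q`. -/
def dualPairing (s : HDual k H ⊗[k] HDual k H) : H ⊗[k] H →ₗ[k] k :=
  TensorProduct.lift ((WithConv.linearEquiv k (H →ₗ[k] k)).toLinearMap ∘ₗ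
    dualTensorHom k H (HDual k H) (TensorProduct.congr
      (WithConv.linearEquiv k (H →ₗ[k] k)) (LinearEquiv.refl k (HDual k H)) s))

theorem dualPairing_tmul (s : HDual k H ⊗[k] HDual k H) (y z : H) :
    dualPairing s (y ⊗ₜ z) = evalLeft y s z := by
  rw [evalLeft_eq]; rfl

theorem dualPairing_add (s t : HDual k H ⊗[k] HDual k H) :
    dualPairing (s + t) = dualPairing s + dualPairing t := by
  refine TensorProduct.ext' fun y z => ?_
  rw [LinearMap.add_apply]
  simp only [dualPairing_tmul, map_add]
  rfl

theorem dualPairing_zero : dualPairing (0 : HDual k H ⊗[k] HDual k H) = 0 := by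
  refine TensorProduct.ext' fun y z => ?_
  simp only [dualPairing_tmul, map_zero]
  rfl

theorem dualPairing_dualComul (p : HDual k H) : dualPairing (dualComul p) =
    p.ofConv ∘ₗ LinearMap.mul' k H ∘ₗ (TensorProduct.comm k H H).toLinearMap := by
  refine TensorProduct.ext' fun y z => ?_
  rw [dualPairing_tmul, evalLeft_dualComul]
  rfl

theorem mul_dualAntipode_left (s : HDual k H ⊗[k] HDual k H) (x : H) :
    LinearMap.mul' k (HDual k H) (TensorProduct.map (dualAntipode k H) LinearMap.id s) x =
      dualPairing s (TensorProduct.map (antipodeInv k H) LinearMap.id (comul (R := k) x)) := by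
  induction s with
  | zero => simp [dualPairing_zero]
  | add a b ha hb =>
    rw [map_add, map_add, WithConv.ofConv_add, LinearMap.add_apply, ha, hb, dualPairing_add,
      LinearMap.add_apply]
  | tmul p q =>
    rw [TensorProduct.map_tmul, LinearMap.mul'_apply, LinearMap.convMul_apply]
    generalize comul (R := k) x = t
    induction t with
    | zero => simp
    | add a b ha hb => simp only [map_add, ha, hb]
    | tmul y z => simp [dualPairing_tmul, evalLeft_tmul, dualAntipode_apply]

theorem mul_dualAntipode_right (s : HDual k H ⊗[k] HDual k H) (x : H) :
    LinearMap.mul' k (HDual k H) (TensorProduct.map LinearMap.id (dualAntipode k H) s) x =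
      dualPairing s (TensorProduct.map LinearMap.id (antipodeInv k H) (comul (R := k) x)) := by
  induction s with
  | zero => simp [dualPairing_zero]
  | add a b ha hb =>
    rw [map_add, map_add, WithConv.ofConv_add, LinearMap.add_apply, ha, hb, dualPairing_add,
      LinearMap.add_apply]
  | tmul p q =>
    rw [TensorProduct.map_tmul, LinearMap.mul'_apply, LinearMap.convMul_apply]
    generalize comul (R := k) x = t
    induction t with
    | zero => simp
    | add a b ha hb => simp only [map_add, ha, hb]
    | tmul y z => simp [dualPairing_tmul, evalLeft_tmul, dualAntipode_apply]

theorem dualAntipode_mul_id (p : HDual k H) : LinearMap.mul' k (HDual k H)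
    (TensorProduct.map (dualAntipode k H) LinearMap.id (dualComul p)) = p 1 • 1 := by
  ext x
  rw [mul_dualAntipode_left, dualPairing_dualComul, LinearMap.comp_apply, LinearMap.comp_apply,
    LinearEquiv.coe_coe, mul_antipodeInv_comul, Algebra.algebraMap_eq_smul_one, map_smul]
  exact mul_comm _ _

theorem id_mul_dualAntipode (p : HDual k H) : LinearMap.mul' k (HDual k H)
    (TensorProduct.map LinearMap.id (dualAntipode k H) (dualComul p)) = p 1 • 1 := by
  ext x
  rw [mul_dualAntipode_right, dualPairing_dualComul, LinearMap.comp_apply, LinearMap.comp_apply,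
    LinearEquiv.coe_coe, antipodeInv_mul_comul, Algebra.algebraMap_eq_smul_one, map_smul]
  exact mul_comm _ _

variable (k H) in
/-- The antipode of the double: `p ⊗ h ↦ S h * (p ∘ S⁻¹)`. -/
def antipodeD : DrinfeldDouble k H →ₗ[k] DrinfeldDouble k H :=
  LinearMap.mul' k (DrinfeldDouble k H) ∘ₗ
    TensorProduct.map ((ofH k H).toLinearMap ∘ₗ antipode k)
      ((ofDual k H).toLinearMap ∘ₗ dualAntipode k H) ∘ₗ
    (TensorProduct.comm k (HDual k H) H).toLinearMap ∘ₗ (tensorEquiv k H).symm.toLinearMap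

theorem antipodeD_mk (p : HDual k H) (h : H) :
    antipodeD k H (mk p h) = ofH k H (antipode k h) * ofDual k H (dualAntipode k H p) := rfl

theorem antipodeD_mul_id (x : DrinfeldDouble k H) : LinearMap.mul' k (DrinfeldDouble k H)
    (TensorProduct.map (antipodeD k H) LinearMap.id (comul (R := k) x)) =
      algebraMap k (DrinfeldDouble k H) (counit (R := k) x) := by
  induction x using induction_on with
  | zero => simp
  | add x y hx hy => simp only [map_add, hx, hy]
  | mk p h =>
    rw [ofDual_mul_ofH, comul_mk, counit_mk]
    have h1 : ∀ (s : HDual k H ⊗[k] HDual k H) (t : H ⊗[k] H),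
        LinearMap.mul' k (DrinfeldDouble k H) (TensorProduct.map (antipodeD k H) LinearMap.id
          (TensorProduct.map (ofDual k H).toLinearMap (ofDual k H).toLinearMap s *
            TensorProduct.map (ofH k H).toLinearMap (ofH k H).toLinearMap t)) =
        LinearMap.mul' k (DrinfeldDouble k H) (TensorProduct.map
          (LinearMap.mulRight k (ofDual k H (LinearMap.mul' k (HDual k H)
            (TensorProduct.map (dualAntipode k H) LinearMap.id s))) ∘ₗ
            (ofH k H).toLinearMap ∘ₗ antipode k) (ofH k H).toLinearMap t) := by
      intro s t
      induction t with
      | zero => simp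
      | add x y hx hy => simp only [map_add, mul_add, hx, hy]
      | tmul a b =>
        induction s with
        | zero => simp
        | add x y hx hy => simp only [map_add, add_mul, hx, hy]; simp [mul_add, add_mul]
        | tmul q r =>
          simp only [TensorProduct.map_tmul, Algebra.TensorProduct.tmul_mul_tmul,
            AlgHom.toLinearMap_apply, LinearMap.mul'_apply, LinearMap.id_apply,
            LinearMap.comp_apply, LinearMap.mulRight_apply, map_mul, ofDual_mul_ofH q,
            antipodeD_mk, mul_assoc]
    rw [h1, dualAntipode_mul_id, map_smul, map_one (ofDual k H)]
    have h2 : ∀ t : H ⊗[k] H, LinearMap.mul' k (DrinfeldDouble k H) (TensorProduct.map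
          (LinearMap.mulRight k (p 1 • (1 : DrinfeldDouble k H)) ∘ₗ
            (ofH k H).toLinearMap ∘ₗ antipode k) (ofH k H).toLinearMap t) =
        p 1 • ofH k H (LinearMap.mul' k H (TensorProduct.map (antipode k) LinearMap.id t)) := by
      intro t
      induction t with
      | zero => simp
      | add x y hx hy => simp only [map_add, hx, hy, smul_add]
      | tmul a b => simp
    rw [h2, HopfAux.antipode_mul_id_apply, AlgHom.commutes, mul_comm, map_mul, Algebra.smul_def]

theorem id_mul_antipodeD (x : DrinfeldDouble k H) : LinearMap.mul' k (DrinfeldDouble k H)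
    (TensorProduct.map LinearMap.id (antipodeD k H) (comul (R := k) x)) =
      algebraMap k (DrinfeldDouble k H) (counit (R := k) x) := by
  induction x using induction_on with
  | zero => simp
  | add x y hx hy => simp only [map_add, hx, hy]
  | mk p h =>
    rw [ofDual_mul_ofH, comul_mk, counit_mk]
    have h1 : ∀ (s : HDual k H ⊗[k] HDual k H) (t : H ⊗[k] H),
        LinearMap.mul' k (DrinfeldDouble k H) (TensorProduct.map LinearMap.id (antipodeD k H)
          (TensorProduct.map (ofDual k H).toLinearMap (ofDual k H).toLinearMap s *
            TensorProduct.map (ofH k H).toLinearMap (ofH k H).toLinearMap t)) =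
        LinearMap.mul' k (DrinfeldDouble k H) (TensorProduct.map
          (LinearMap.mulRight k (ofH k H (LinearMap.mul' k H
            (TensorProduct.map LinearMap.id (antipode k) t))) ∘ₗ
            (ofDual k H).toLinearMap) ((ofDual k H).toLinearMap ∘ₗ dualAntipode k H) s) := by
      intro s t
      induction s with
      | zero => simp
      | add x y hx hy => simp only [map_add, add_mul, hx, hy]
      | tmul q r =>
        induction t with
        | zero => simp
        | add x y hx hy => simp only [map_add, mul_add, hx, hy]; simp [mul_add, add_mul]
        | tmul a b =>
          simp only [TensorProduct.map_tmul, Algebra.TensorProduct.tmul_mul_tmul,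
            AlgHom.toLinearMap_apply, LinearMap.mul'_apply, LinearMap.id_apply,
            LinearMap.comp_apply, LinearMap.mulRight_apply, map_mul, ofDual_mul_ofH r,
            antipodeD_mk, mul_assoc]
    rw [h1, HopfAux.id_mul_antipode_apply, AlgHom.commutes, Algebra.algebraMap_eq_smul_one]
    have h2 : ∀ s : HDual k H ⊗[k] HDual k H, LinearMap.mul' k (DrinfeldDouble k H)
        (TensorProduct.map (LinearMap.mulRight k (counit (R := k) h • (1 : DrinfeldDouble k H)) ∘ₗ
            (ofDual k H).toLinearMap) ((ofDual k H).toLinearMap ∘ₗ dualAntipode k H) s) =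
        counit (R := k) h • ofDual k H (LinearMap.mul' k (HDual k H)
          (TensorProduct.map LinearMap.id (dualAntipode k H) s)) := by
      intro s
      induction s with
      | zero => simp
      | add x y hx hy => simp only [map_add, hx, hy, smul_add]
      | tmul a b => simp
    rw [h2, id_mul_dualAntipode, map_smul, map_one (ofDual k H), smul_smul, Algebra.algebraMap_eq_smul_one]

instance : HopfAlgebra k (DrinfeldDouble k H) where
  antipode := antipodeD k H
  mul_antipode_rTensor_comul := LinearMap.ext antipodeD_mul_id
  mul_antipode_lTensor_comul := LinearMap.ext id_mul_antipodeD

end DrinfeldDouble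

end DoubleHopf₂

noncomputable section Statement

universe u v w x

section Drinfeld

variable (k : Type u) (H : Type v) [Field k] [Ring H] [HopfAlgebra k H] [FiniteDimensional k H]

open DrinfeldDouble in
/-- The universal `R`-matrix `∑ hᵢ ⊗ hᵢ*` of the double, for dual bases `hᵢ` of `H` and `hᵢ*` of
its dual. -/
def universalR : DrinfeldDouble k H ⊗[k] DrinfeldDouble k H :=
  ∑ i, ofH k H (Module.finBasis k H i) ⊗ₜ[k]
    ofDual k H (WithConv.toConv ((Module.finBasis k H).coord i))

/-- The Drinfeld element `u = m (S ⊗ I) τ(R) = ∑ S(hᵢ*) hᵢ` of the double. -/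
def drinfeldElement : DrinfeldDouble k H :=
  LinearMap.mul' k (DrinfeldDouble k H)
    (TensorProduct.map (antipode k) LinearMap.id
      (TensorProduct.comm k (DrinfeldDouble k H) (DrinfeldDouble k H) (universalR k H)))

/-- The element `z = u S(u)` of the double. -/
def drinfeldZ : DrinfeldDouble k H :=
  drinfeldElement k H * antipode k (drinfeldElement k H)

end Drinfeld

section Linkage

/-- A module is indecomposable if it is nonzero and is not the direct sum of two nonzero
submodules. -/
def IsIndecomposableModule (A : Type u) (M : Type v) [Ring A] [AddCommGroup M] [Module A M] :
    Prop :=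
  Nontrivial M ∧ ∀ P Q : Submodule A M, IsCompl P Q → P = ⊥ ∨ Q = ⊥

/-- `W` is a constituent of `M`: a simple module isomorphic to a subquotient `Q ⧸ P` of `M`. -/
def IsConstituent (A : Type u) (W : Type v) (M : Type w) [Ring A] [AddCommGroup W] [Module A W]
    [AddCommGroup M] [Module A M] : Prop :=
  IsSimpleModule A W ∧
    ∃ (Q : Submodule A M) (P : Submodule A Q), Nonempty (W ≃ₗ[A] (Q ⧸ P))

/-- The equivalence relation on simple modules generated by: `W₁` and `W₂` are constituents of the
same indecomposable module. -/
def Linked (A : Type u) [Ring A] : ModuleCat.{w} A → ModuleCat.{w} A → Prop :=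
  Relation.EqvGen fun W₁ W₂ => ∃ U : ModuleCat.{w} A,
    IsIndecomposableModule A U ∧ IsConstituent A W₁ U ∧ IsConstituent A W₂ U

/-- The greatest common divisor of the dimensions over `k` of the simple `A`-modules that are
linked to a constituent of `V`. -/
def linkageGcd (k : Type u) (A : Type v) (V : Type w) [Field k] [Ring A] [Algebra k A]
    [AddCommGroup V] [Module A V] : ℕ :=
  Nat.setGcd {n | ∃ W₀ W : ModuleCat.{w} A, IsConstituent A W₀ V ∧ Linked A W₀ W ∧
    IsSimpleModule A W ∧ n = Module.finrank k (RestrictScalars k A W)}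

end Linkage

/-- `μ ∈ K` is an eigenvalue on `V` of `a ∈ A`, after extension of scalars from `k` to `K`. -/
def IsEigenvalueOn {k : Type u} {A : Type v} [Field k] [Ring A] [Algebra k A] (a : A)
    (V : Type w) [AddCommGroup V] [Module k V] [Module A V] [IsScalarTower k A V]
    {K : Type x} [Field K] [Algebra k K] (μ : K) : Prop :=
  Module.End.HasEigenvalue ((Algebra.lsmul k k V a).baseChange K) μ

end Statement

universe u v w x

/-! Write D for the double, n = d² for its dimension, and Q = R₂₁R. The proof turns the identity
Δ(u)Q = u ⊗ u into a statement about determinants.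

Let W be a finite-dimensional representation of D over an extension field L of k, and let D ⊗ D act
on W ⊗ D, with the regular representation on the second factor. The invertible map w ⊗ x ↦ ∑ x₍₁₎w ⊗
x₍₂₎ intertwines 1 ⊗ b with Δ(b), so Δ(b) and 1 ⊗ b have the same determinant
(`det_actTensor_comul`). The same trick applied to (Δ ⊗ 1)R = R₁₃R₂₃ shows that R₁₃ has determinant
1. Since D is free over both H and H*, it follows that R and R₂₁ have determinant 1 on W ⊗ D. Hence
u ⊗ u and 1 ⊗ u have equal determinants there, so det(u ⊗ 1) = det_W(u)ⁿ = 1. Applying S to the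
identity gives the same for S(u), hence det_W(z)ⁿ = 1 (`det_drinfeldZ_pow`).

Because S² is conjugation by u, the element z is central. On a simple module W it acts as a scalar c
in the field L, the centre of End_D(W). The determinant identity over L reads c^(n dim_L W) = 1, so
z^(n dim_k W) is the identity on W. On an indecomposable V some power of p(z) vanishes for an
irreducible polynomial p over k; the same p annihilates z on every simple module linked to a
constituent of V. Hence p divides X^(n dim W) - 1 for all these W, and therefore divides X^(nN) - 1
with N the greatest common divisor of the dimensions. All eigenvalues of z on V are roots of p,
which gives both conjugacy and the bound on the order.

For u, one has u² = zg with g = uS(u)⁻¹ group-like (`exists_isGroupLikeElem`). Determinants of c - g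
on D ⊗ D show that gⁿ - 1 is nilpotent (`isNilpotent_pow_finrank_sub_one`), which is all that
eigenvalues can detect. So u^(2nN) - 1 acts nilpotently on V. -/

noncomputable section

/-! ### Quasitriangular Hopf algebras: Yang–Baxter equation, Drinfeld element, square of the
antipode. -/

namespace QuasiTriangular

attribute [local instance] HopfAux.zeroHomClass_linearMap HopfAux.zeroHomClass_linearEquiv
  HopfAux.addHomClass_linearMap HopfAux.addHomClass_linearEquiv

/-- The image of `∑ aᵢ ⊗ bᵢ` under `p ⊗ q` followed by multiplication: `∑ p aᵢ * q bᵢ`. -/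
def evalPair {k A B E : Type*} [Field k] [Ring A] [Algebra k A] [Ring B] [Algebra k B] [Ring E]
    [Algebra k E] (p : A →ₐ[k] E) (q : B →ₐ[k] E) : A ⊗[k] B →ₗ[k] E :=
  LinearMap.mul' k E ∘ₗ TensorProduct.map p.toLinearMap q.toLinearMap

section evalPair

variable {k A B E : Type*} [Field k] [Ring A] [Algebra k A] [Ring B] [Algebra k B] [Ring E]
    [Algebra k E]

@[simp] theorem evalPair_tmul (p : A →ₐ[k] E) (q : B →ₐ[k] E) (a : A) (b : B) :
    evalPair p q (a ⊗ₜ b) = p a * q b := rfl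

/-- In general `evalPair` is only linear. When the images commute it is multiplicative, so
identities between products of legs of an R-matrix can be transported to any algebra E. -/
theorem evalPair_eq_lift (p : A →ₐ[k] E) (q : B →ₐ[k] E) (h : ∀ a b, Commute (p a) (q b))
    (t : A ⊗[k] B) : evalPair p q t = Algebra.TensorProduct.lift p q h t := by
  induction t with
  | zero => simp
  | add x y hx hy => simp only [map_add, hx, hy]
  | tmul a b => simp

end evalPair

section Conv

variable {k A E : Type*} [Field k] [Ring A] [Bialgebra k A] [Ring E] [Algebra k E]

/-- The convolution product of commuting algebra homomorphisms. -/
def convHom (p q : A →ₐ[k] E) (h : ∀ a b, Commute (p a) (q b)) : A →ₐ[k] E :=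
  (Algebra.TensorProduct.lift p q h).comp (Bialgebra.comulAlgHom k A)

theorem convHom_apply (p q : A →ₐ[k] E) (h : ∀ a b, Commute (p a) (q b)) (a : A) :
    convHom p q h a = evalPair p q (comul (R := k) a) := by
  rw [evalPair_eq_lift p q h]; rfl

theorem commute_evalPair_left {B C : Type*} [Ring B] [Algebra k B] [Ring C] [Algebra k C]
    {p : B →ₐ[k] E} {q : C →ₐ[k] E} {x : E}
    (hp : ∀ a, Commute x (p a)) (hq : ∀ a, Commute x (q a)) (t : B ⊗[k] C) :
    Commute x (evalPair p q t) := by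
  induction t with
  | zero => simp
  | add a b ha hb => rw [map_add]; exact ha.add_right hb
  | tmul a b => exact (hp a).mul_right (hq b)

end Conv

section Legs

variable (k A B C : Type*) [Field k] [Ring A] [Algebra k A] [Ring B] [Algebra k B] [Ring C]
  [Algebra k C]

/-- The leg embedding `a ⊗ b ↦ a ⊗ 1 ⊗ b`. -/
def leg₁₃ : A ⊗[k] C →ₐ[k] A ⊗[k] (B ⊗[k] C) :=
  Algebra.TensorProduct.map (AlgHom.id k A) Algebra.TensorProduct.includeRight

/-- The leg embedding `a ⊗ b ↦ a ⊗ b ⊗ 1`. -/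
def leg₁₂ : A ⊗[k] B →ₐ[k] A ⊗[k] (B ⊗[k] C) :=
  Algebra.TensorProduct.map (AlgHom.id k A) Algebra.TensorProduct.includeLeft

/-- The leg embedding `a ⊗ b ↦ 1 ⊗ a ⊗ b`. -/
def leg₂₃ : B ⊗[k] C →ₐ[k] A ⊗[k] (B ⊗[k] C) :=
  Algebra.TensorProduct.includeRight

end Legs

variable {k A : Type*} [Field k] [Ring A] [HopfAlgebra k A]

section Inverse

variable {C : Type*} [Ring C] [Algebra k C]

/-- Multiplying the first two legs after applying S to the first collapses (Δ ⊗ 1)r to (ε ⊗ 1)r = 1,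
and sends r₁₃r₂₃ to (S ⊗ 1)(r)·r. The algebra C is arbitrary so that canonical elements mixing H and
its dual are covered too. -/
theorem map_antipode_mul_of_comul {r : A ⊗[k] C}
    (hr : TensorProduct.assoc k A A C (TensorProduct.map (comul (R := k)) LinearMap.id r) =
      leg₁₃ k A A C r * leg₂₃ k A A C r)
    (hε : TensorProduct.lid k C (TensorProduct.map (counit (R := k)) LinearMap.id r) = 1) :
    TensorProduct.map (antipode k) LinearMap.id r * r = 1 := by
  let G : A ⊗[k] (A ⊗[k] C) →ₗ[k] A ⊗[k] C := TensorProduct.map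
    (LinearMap.mul' k A ∘ₗ TensorProduct.map (antipode k) LinearMap.id) LinearMap.id ∘ₗ
    (TensorProduct.assoc k A A C).symm.toLinearMap
  have h1 : ∀ x y : A ⊗[k] C, G (leg₁₃ k A A C x * leg₂₃ k A A C y) =
      TensorProduct.map (antipode k) LinearMap.id x * y := by
    intro x y
    induction x with
    | zero => simp
    | add a b ha hb => simp only [map_add, add_mul, ha, hb]
    | tmul a b =>
      induction y with
      | zero => simp
      | add a b ha hb => simp only [map_add, mul_add, ha, hb]
      | tmul c d => simp [G, leg₁₃, leg₂₃]
  have h2 : ∀ t : A ⊗[k] C, G (TensorProduct.assoc k A A C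
      (TensorProduct.map (comul (R := k)) LinearMap.id t)) =
      1 ⊗ₜ TensorProduct.lid k C (TensorProduct.map (counit (R := k)) LinearMap.id t) := by
    intro t
    induction t with
    | zero => simp
    | add x y hx hy => simp only [map_add, hx, hy, TensorProduct.tmul_add]
    | tmul a b =>
      simp [G, HopfAux.antipode_mul_id_apply, Algebra.algebraMap_eq_smul_one,
        TensorProduct.smul_tmul']
  rw [← h1, ← hr, h2, hε]
  rfl

theorem mul_map_antipode_of_comul {r : A ⊗[k] C}
    (hr : TensorProduct.assoc k A A C (TensorProduct.map (comul (R := k)) LinearMap.id r) =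
      leg₁₃ k A A C r * leg₂₃ k A A C r)
    (hε : TensorProduct.lid k C (TensorProduct.map (counit (R := k)) LinearMap.id r) = 1) :
    r * TensorProduct.map (antipode k) LinearMap.id r = 1 := by
  let G : A ⊗[k] (A ⊗[k] C) →ₗ[k] A ⊗[k] C := TensorProduct.map
    (LinearMap.mul' k A ∘ₗ TensorProduct.map LinearMap.id (antipode k)) LinearMap.id ∘ₗ
    (TensorProduct.assoc k A A C).symm.toLinearMap
  have h1 : ∀ x y : A ⊗[k] C, G (leg₁₃ k A A C x * leg₂₃ k A A C y) =
      x * TensorProduct.map (antipode k) LinearMap.id y := by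
    intro x y
    induction x with
    | zero => simp
    | add a b ha hb => simp only [map_add, add_mul, ha, hb]
    | tmul a b =>
      induction y with
      | zero => simp
      | add a b ha hb => simp only [map_add, mul_add, ha, hb]
      | tmul c d => simp [G, leg₁₃, leg₂₃]
  have h2 : ∀ t : A ⊗[k] C, G (TensorProduct.assoc k A A C
      (TensorProduct.map (comul (R := k)) LinearMap.id t)) =
      1 ⊗ₜ TensorProduct.lid k C (TensorProduct.map (counit (R := k)) LinearMap.id t) := by
    intro t
    induction t with
    | zero => simp
    | add x y hx hy => simp only [map_add, hx, hy, TensorProduct.tmul_add]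
    | tmul a b =>
      simp [G, HopfAux.id_mul_antipode_apply, Algebra.algebraMap_eq_smul_one,
        TensorProduct.smul_tmul']
  rw [← h1, ← hr, h2, hε]
  rfl

theorem isUnit_of_comul {r : A ⊗[k] C}
    (hr : TensorProduct.assoc k A A C (TensorProduct.map (comul (R := k)) LinearMap.id r) =
      leg₁₃ k A A C r * leg₂₃ k A A C r)
    (hε : TensorProduct.lid k C (TensorProduct.map (counit (R := k)) LinearMap.id r) = 1) :
    IsUnit r :=
  ⟨⟨r, _, mul_map_antipode_of_comul hr hε, map_antipode_mul_of_comul hr hε⟩, rfl⟩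

end Inverse

/-- `R` is a universal `R`-matrix of the Hopf algebra `A`. -/
structure IsUniversalR (R : A ⊗[k] A) : Prop where
  comul_left : TensorProduct.assoc k A A A (TensorProduct.map (comul (R := k)) LinearMap.id R) =
    leg₁₃ k A A A R * leg₂₃ k A A A R
  comul_right : TensorProduct.map LinearMap.id (comul (R := k)) R =
    leg₁₃ k A A A R * leg₁₂ k A A A R
  mul_comul : ∀ x : A, R * comul (R := k) x = TensorProduct.comm k A A (comul (R := k) x) * R
  counit_left : TensorProduct.lid k A (TensorProduct.map (counit (R := k)) LinearMap.id R) = 1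
  counit_right : TensorProduct.rid k A (TensorProduct.map LinearMap.id (counit (R := k)) R) = 1
  map_antipode : TensorProduct.map (antipode k) (antipode k) R = R

namespace IsUniversalR

variable {R : A ⊗[k] A} (hR : IsUniversalR R)
include hR

section Generic

variable {E : Type*} [Ring E] [Algebra k E] {p q s : A →ₐ[k] E}

/-- This is the image of (Δ ⊗ 1)R = R₁₃R₂₃ under p ⊗ q ⊗ s; the convolution of p and q plays the
role of the coproduct on the first leg. -/
theorem evalPair_convHom_left (hpq : ∀ a b, Commute (p a) (q b)) (hps : ∀ a b, Commute (p a) (s b))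
    (hqs : ∀ a b, Commute (q a) (s b)) :
    evalPair (convHom p q hpq) s R = evalPair p s R * evalPair q s R := by
  let F : A ⊗[k] (A ⊗[k] A) →ₐ[k] E := Algebra.TensorProduct.lift p
    (Algebra.TensorProduct.lift q s hqs) (fun a t => by
      rw [← evalPair_eq_lift]; exact commute_evalPair_left (hpq a) (hps a) t)
  have h1 : ∀ t : A ⊗[k] A, F (TensorProduct.assoc k A A A
      (TensorProduct.map (comul (R := k)) LinearMap.id t)) = evalPair (convHom p q hpq) s t := by
    intro t
    induction t with
    | zero => simp
    | add x y hx hy => simp only [map_add, hx, hy]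
    | tmul a b =>
      rw [evalPair_tmul, convHom_apply, TensorProduct.map_tmul, LinearMap.id_apply]
      generalize comul (R := k) a = t
      induction t with
      | zero => simp
      | add x y hx hy => simp only [TensorProduct.add_tmul, map_add, hx, hy, add_mul]
      | tmul c d => simp [F, mul_assoc]
  have h2 : ∀ t : A ⊗[k] A, F (leg₁₃ k A A A t) = evalPair p s t := by
    intro t
    induction t with
    | zero => simp
    | add x y hx hy => simp only [map_add, hx, hy]
    | tmul a b => simp [F, leg₁₃]
  have h3 : ∀ t : A ⊗[k] A, F (leg₂₃ k A A A t) = evalPair q s t := by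
    intro t
    rw [evalPair_eq_lift _ _ hqs]
    simp [F, leg₂₃]
  rw [← h1, hR.comul_left, map_mul, h2, h3]

theorem evalPair_convHom_right (hpq : ∀ a b, Commute (p a) (q b)) (hps : ∀ a b, Commute (p a) (s b))
    (hqs : ∀ a b, Commute (q a) (s b)) :
    evalPair p (convHom q s hqs) R = evalPair p s R * evalPair p q R := by
  let F : A ⊗[k] (A ⊗[k] A) →ₐ[k] E := Algebra.TensorProduct.lift p
    (Algebra.TensorProduct.lift q s hqs) (fun a t => by
      rw [← evalPair_eq_lift]; exact commute_evalPair_left (hpq a) (hps a) t)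
  have h1 : ∀ t : A ⊗[k] A, F (TensorProduct.map LinearMap.id (comul (R := k)) t) =
      evalPair p (convHom q s hqs) t := by
    intro t
    induction t with
    | zero => simp
    | add x y hx hy => simp only [map_add, hx, hy]
    | tmul a b =>
      rw [evalPair_tmul, convHom_apply, evalPair_eq_lift _ _ hqs]
      simp [F]
  have h2 : ∀ t : A ⊗[k] A, F (leg₁₃ k A A A t) = evalPair p s t := by
    intro t
    induction t with
    | zero => simp
    | add x y hx hy => simp only [map_add, hx, hy]
    | tmul a b => simp [F, leg₁₃]
  have h3 : ∀ t : A ⊗[k] A, F (leg₁₂ k A A A t) = evalPair p q t := by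
    intro t
    induction t with
    | zero => simp
    | add x y hx hy => simp only [map_add, hx, hy]
    | tmul a b => simp [F, leg₁₂]
  rw [← h1, hR.comul_right, map_mul, h2, h3]

omit hR in
theorem evalPair_comm_apply (hpq : ∀ a b, Commute (p a) (q b)) (t : A ⊗[k] A) :
    evalPair p q (TensorProduct.comm k A A t) = evalPair q p t := by
  induction t with
  | zero => simp
  | add x y hx hy => simp only [map_add, hx, hy]
  | tmul a b => simpa using (hpq b a).eq

theorem evalPair_mul_convHom (hpq : ∀ a b, Commute (p a) (q b)) (x : A) :
    evalPair p q R * convHom p q hpq x =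
      convHom q p (fun a b => (hpq b a).symm) x * evalPair p q R := by
  rw [convHom_apply, convHom_apply, ← evalPair_comm_apply hpq]
  simp only [evalPair_eq_lift p q hpq]
  rw [← map_mul, ← map_mul, hR.mul_comul]

/-- The Yang–Baxter equation. -/
theorem yangBaxter (hpq : ∀ a b, Commute (p a) (q b)) (hps : ∀ a b, Commute (p a) (s b))
    (hqs : ∀ a b, Commute (q a) (s b)) :
    evalPair p q R * evalPair p s R * evalPair q s R =
      evalPair q s R * evalPair p s R * evalPair p q R := by
  -- This says R₁₂(Δ ⊗ 1)(t) = (Δᵒᵖ ⊗ 1)(t)R₁₂. Taking t = R and expanding both coproducts gives the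
  -- Yang–Baxter equation.
  have key : ∀ t : A ⊗[k] A, evalPair p q R * evalPair (convHom p q hpq) s t =
      evalPair (convHom q p (fun a b => (hpq b a).symm)) s t * evalPair p q R := by
    intro t
    induction t with
    | zero => simp
    | add x y hx hy => simp only [map_add, hx, hy, mul_add, add_mul]
    | tmul a b =>
      have hc : Commute (s b) (evalPair p q R) :=
        commute_evalPair_left (fun a => (hps a b).symm) (fun a => (hqs a b).symm) R
      rw [evalPair_tmul, evalPair_tmul, ← mul_assoc, hR.evalPair_mul_convHom hpq, mul_assoc,
        mul_assoc, hc.eq]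
  have := key R
  rw [hR.evalPair_convHom_left hpq hps hqs,
    hR.evalPair_convHom_left (fun a b => (hpq b a).symm) hqs hps] at this
  rw [mul_assoc, this]

end Generic

omit hR in
theorem lTensor_antipode_mul (t : A ⊗[k] A) :
    TensorProduct.map LinearMap.id (LinearMap.mul' k A ∘ₗ TensorProduct.map (antipode k)
      LinearMap.id) (TensorProduct.map LinearMap.id (comul (R := k)) t) =
    TensorProduct.rid k A (TensorProduct.map LinearMap.id (counit (R := k)) t) ⊗ₜ 1 := by
  induction t with
  | zero => simp
  | add x y hx hy => simp only [map_add, hx, hy, TensorProduct.add_tmul]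
  | tmul a b =>
    simp [HopfAux.antipode_mul_id_apply, Algebra.algebraMap_eq_smul_one, TensorProduct.smul_tmul']

/-- For `R = ∑ aᵢ ⊗ bᵢ` one has `∑ aᵢ aⱼ ⊗ S(bⱼ) bᵢ = 1`. -/
theorem map_mul_antipode_legs :
    TensorProduct.map LinearMap.id (LinearMap.mul' k A ∘ₗ TensorProduct.map (antipode k)
      LinearMap.id) (leg₁₃ k A A A R * leg₁₂ k A A A R) = 1 := by
  rw [← hR.comul_right, lTensor_antipode_mul, hR.counit_right]
  rfl

theorem isUnit : IsUnit R :=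
  isUnit_of_comul hR.comul_left hR.counit_left

end IsUniversalR

/-- The Drinfeld element `∑ S(bᵢ) aᵢ` of `R = ∑ aᵢ ⊗ bᵢ`. -/
def drinfeldU (R : A ⊗[k] A) : A :=
  LinearMap.mul' k A (TensorProduct.map (antipode k) LinearMap.id (TensorProduct.comm k A A R))

namespace IsUniversalR

variable {R : A ⊗[k] A} (hR : IsUniversalR R)
include hR

/-- The square of the antipode is conjugation by the Drinfeld element. -/
theorem drinfeldU_mul (x : A) :
    drinfeldU R * x = antipode k (antipode k x) * drinfeldU R := by
  set u := drinfeldU R with hu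
  -- The map a ⊗ b ↦ S(b)a, which sends R to u.
  let M : A ⊗[k] A →ₗ[k] A := LinearMap.mul' k A ∘ₗ
    TensorProduct.map (antipode k) LinearMap.id ∘ₗ (TensorProduct.comm k A A).toLinearMap
  have hM : M R = u := rfl
  have hadd : ∀ a b : A, LinearMap.mulLeft k (a + b) =
      LinearMap.mulLeft k a + LinearMap.mulLeft k b := map_add (LinearMap.mul k A)
  have h1 : ∀ r t : A ⊗[k] A, M (r * t) = LinearMap.mul' k A
      (TensorProduct.map (antipode k) (LinearMap.mulLeft k (M r)) (TensorProduct.comm k A A t)) := by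
    intro r t
    induction r with
    | zero => simp
    | add a b ha hb => simp only [map_add, add_mul, ha, hb, hadd, TensorProduct.map_add_right,
        LinearMap.add_apply]
    | tmul a b =>
      induction t with
      | zero => simp
      | add a b ha hb => simp only [map_add, mul_add, ha, hb]
      | tmul c d => simp [M, HopfAlgebra.antipode_mul_antidistrib, mul_assoc]
  have h2 : ∀ (t r : A ⊗[k] A), M (TensorProduct.comm k A A t * r) = LinearMap.mul' k A
      (TensorProduct.map (antipode k) (LinearMap.mulLeft k (LinearMap.mul' k A
        (TensorProduct.map (antipode k) LinearMap.id t))) (TensorProduct.comm k A A r)) := by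
    intro t r
    induction t with
    | zero => simp
    | add a b ha hb => simp only [map_add, add_mul, ha, hb, hadd, TensorProduct.map_add_right,
        LinearMap.add_apply]
    | tmul a b =>
      induction r with
      | zero => simp
      | add a b ha hb => simp only [map_add, mul_add, ha, hb]
      | tmul c d => simp [M, HopfAlgebra.antipode_mul_antidistrib, mul_assoc]
  -- After replacing RΔ(y) by Δᵒᵖ(y)R, the antipode axiom S(y₍₁₎)y₍₂₎ = ε(y) appears in the middle
  -- of S(b)S(y₍₁₎)y₍₂₎a.
  have h3 : ∀ y : A, M (R * comul (R := k) y) = counit (R := k) y • u := by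
    intro y
    rw [hR.mul_comul, h2, HopfAux.antipode_mul_id_apply, Algebra.algebraMap_eq_smul_one]
    have : LinearMap.mulLeft k (counit (R := k) y • (1 : A)) = counit (R := k) y • LinearMap.id := by
      ext; simp
    rw [this, TensorProduct.map_smul_right, LinearMap.smul_apply, map_smul, ← hM]
    rfl
  -- The map a ⊗ b ⊗ c ↦ S(bS(c))ua = S²(c)S(b)ua. On the iterated coproduct of x, contracting the
  -- first two legs gives S²(x)u, and contracting the last two gives ux; coassociativity equates the
  -- two.
  let P : A ⊗[k] (A ⊗[k] A) →ₗ[k] A := LinearMap.mul' k A ∘ₗ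
    (TensorProduct.comm k A A).toLinearMap ∘ₗ TensorProduct.map (LinearMap.mulLeft k u)
      (antipode k ∘ₗ LinearMap.mul' k A ∘ₗ TensorProduct.map LinearMap.id (antipode k))
  have h4 : ∀ t : A ⊗[k] A, P (TensorProduct.assoc k A A A
      (TensorProduct.map (comul (R := k)) LinearMap.id t)) = antipode k (antipode k
        (TensorProduct.lid k A (TensorProduct.map (counit (R := k)) LinearMap.id t))) * u := by
    intro t
    induction t with
    | zero => simp
    | add x y hx hy => simp only [map_add, hx, hy, add_mul]
    | tmul y c =>
      rw [TensorProduct.map_tmul, TensorProduct.map_tmul]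
      have : ∀ s : A ⊗[k] A, P (TensorProduct.assoc k A A A (s ⊗ₜ c)) =
          antipode k (antipode k c) * M (R * s) := by
        intro s
        rw [h1, hM]
        induction s with
        | zero => simp
        | add x y hx hy => simp only [TensorProduct.add_tmul, map_add, hx, hy, mul_add]
        | tmul a b => simp [P, HopfAlgebra.antipode_mul_antidistrib, mul_assoc]
      rw [LinearMap.id_apply, this, h3]
      simp
  have h5 : ∀ t : A ⊗[k] A, P (TensorProduct.map LinearMap.id (comul (R := k)) t) =
      u * TensorProduct.rid k A (TensorProduct.map LinearMap.id (counit (R := k)) t) := by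
    intro t
    induction t with
    | zero => simp
    | add x y hx hy => simp only [map_add, hx, hy, mul_add]
    | tmul a b =>
      simp [P, HopfAux.id_mul_antipode_apply, Algebra.algebraMap_eq_smul_one]
  have e1 := congr(P $(coassoc_apply (R := k) x))
  have e2 := congr(TensorProduct.lid k A $(rTensor_counit_comul (R := k) x))
  have e3 := congr(TensorProduct.rid k A $(lTensor_counit_comul (R := k) x))
  simp only [LinearMap.lTensor_def, LinearMap.rTensor_def] at e1 e2 e3
  rw [h4, h5, e2, e3] at e1
  simpa using e1.symm

/-- From uw = S²(w)u, applying S gives S(w)S(u) = S(u)S³(w). Combining the two relations yields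
S³(w)·uS(u) = u·S(w)S(u) = uS(u)·S³(w). Surjectivity of S makes every element of the form S³(w). -/
theorem drinfeldU_mul_antipode_mem_center (hS : Function.Surjective (antipode k (A := A))) :
    drinfeldU R * antipode k (drinfeldU R) ∈ Subalgebra.center k A := by
  rw [Subalgebra.mem_center_iff]
  intro b
  obtain ⟨c, rfl⟩ := hS b
  obtain ⟨y, rfl⟩ := hS c
  obtain ⟨w, rfl⟩ := hS y
  have h1 := congr(antipode k $(hR.drinfeldU_mul w))
  rw [HopfAlgebra.antipode_mul_antidistrib, HopfAlgebra.antipode_mul_antidistrib] at h1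
  rw [← mul_assoc, ← hR.drinfeldU_mul, mul_assoc, mul_assoc, h1]

end IsUniversalR

/-! ### The coproduct of the Drinfeld element and its group-like quotient. -/

section Actions

theorem tensorComm_mul (x y : A ⊗[k] A) : TensorProduct.comm k A A (x * y) =
    TensorProduct.comm k A A x * TensorProduct.comm k A A y :=
  map_mul (Algebra.TensorProduct.comm k A A) x y

variable (k A) in
/-- Right multiplication of `A ⊗ A` by the image of an algebra homomorphism `A → A ⊗ A`. -/
def rightAct (f : A →ₐ[k] A ⊗[k] A) : A →ₐ[k] (Module.End k (A ⊗[k] A))ᵐᵒᵖ :=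
  AlgHom.ofLinearMap ((MulOpposite.opLinearEquiv k).toLinearMap ∘ₗ
    (LinearMap.mul k (A ⊗[k] A)).flip ∘ₗ f.toLinearMap)
    (by refine MulOpposite.unop_injective (LinearMap.ext fun m => ?_); simp)
    (fun x y => by refine MulOpposite.unop_injective (LinearMap.ext fun m => ?_); simp [mul_assoc])

variable (k A) in
/-- Left multiplication of `A ⊗ A` by the image of the antipode under an algebra homomorphism
`A → A ⊗ A`. -/
def leftAct (f : A →ₐ[k] A ⊗[k] A) : A →ₐ[k] (Module.End k (A ⊗[k] A))ᵐᵒᵖ :=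
  AlgHom.ofLinearMap ((MulOpposite.opLinearEquiv k).toLinearMap ∘ₗ
    LinearMap.mul k (A ⊗[k] A) ∘ₗ f.toLinearMap ∘ₗ antipode k)
    (by refine MulOpposite.unop_injective (LinearMap.ext fun m => ?_); simp)
    (fun x y => by
      refine MulOpposite.unop_injective (LinearMap.ext fun m => ?_)
      simp [HopfAlgebra.antipode_mul_antidistrib, mul_assoc])

theorem rightAct_apply (f : A →ₐ[k] A ⊗[k] A) (x : A) (m : A ⊗[k] A) :
    (rightAct k A f x).unop m = m * f x := rfl

theorem leftAct_apply (f : A →ₐ[k] A ⊗[k] A) (x : A) (m : A ⊗[k] A) :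
    (leftAct k A f x).unop m = f (antipode k x) * m := rfl

theorem commute_rightAct_leftAct (f g : A →ₐ[k] A ⊗[k] A) (a b : A) :
    Commute (rightAct k A f a) (leftAct k A g b) := by
  refine MulOpposite.unop_injective (LinearMap.ext fun m => ?_)
  simp [rightAct_apply, leftAct_apply, mul_assoc]

theorem commute_rightAct {f g : A →ₐ[k] A ⊗[k] A} (h : ∀ a b, Commute (f a) (g b)) (a b : A) :
    Commute (rightAct k A f a) (rightAct k A g b) := by
  refine MulOpposite.unop_injective (LinearMap.ext fun m => ?_)
  simp [rightAct_apply, mul_assoc, (h a b).eq]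

theorem commute_leftAct {f g : A →ₐ[k] A ⊗[k] A} (h : ∀ a b, Commute (f a) (g b)) (a b : A) :
    Commute (leftAct k A f a) (leftAct k A g b) := by
  refine MulOpposite.unop_injective (LinearMap.ext fun m => ?_)
  simp [leftAct_apply, ← mul_assoc, (h (antipode k a) (antipode k b)).eq]

end Actions

namespace IsUniversalR

variable {R : A ⊗[k] A} (hR : IsUniversalR R)
include hR

/-- R carries Δ(x) to Δᵒᵖ(x), and R₂₁ carries it back. -/
theorem comm_mul_self_commute (x : A) :
    Commute (TensorProduct.comm k A A R * R) (comul (R := k) x) := by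
  have h : TensorProduct.comm k A A R * TensorProduct.comm k A A (comul (R := k) x) =
      comul (R := k) x * TensorProduct.comm k A A R := by
    rw [← tensorComm_mul, hR.mul_comul, tensorComm_mul, TensorProduct.comm_comm]
  change _ * _ = _ * _
  rw [mul_assoc, hR.mul_comul, ← mul_assoc, h, mul_assoc]

/-- The coproduct of the Drinfeld element: `Δ(u) R₂₁ R = u ⊗ u`. -/
theorem comul_drinfeldU_mul : comul (R := k) (drinfeldU R) * (TensorProduct.comm k A A R * R) =
    drinfeldU R ⊗ₜ drinfeldU R := by
  set u := drinfeldU R with hu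
  let i₁ : A →ₐ[k] A ⊗[k] A := Algebra.TensorProduct.includeLeft
  let i₂ : A →ₐ[k] A ⊗[k] A := Algebra.TensorProduct.includeRight
  have hi : ∀ a b, Commute (i₁ a) (i₂ b) := fun a b => by
    simp [i₁, i₂, Commute, SemiconjBy]
  -- Right multiplications reverse composition, and so do left multiplications by S of an element.
  -- All four are therefore algebra homomorphisms into the opposite of End(A ⊗ A), where the generic
  -- Yang–Baxter equation applies. In that algebra the leftmost factor of a product acts first.
  let r₁ := rightAct k A i₁
  let r₂ := rightAct k A i₂
  let l₁ := leftAct k A i₁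
  let l₂ := leftAct k A i₂
  have hr : ∀ a b, Commute (r₁ a) (r₂ b) := commute_rightAct hi
  have hl : ∀ a b, Commute (l₂ a) (l₁ b) := commute_leftAct fun a b => (hi b a).symm
  have h11 : ∀ a b, Commute (r₁ a) (l₁ b) := commute_rightAct_leftAct i₁ i₁
  have h12 : ∀ a b, Commute (r₁ a) (l₂ b) := commute_rightAct_leftAct i₁ i₂
  have h21 : ∀ a b, Commute (r₂ a) (l₁ b) := commute_rightAct_leftAct i₂ i₁
  have h22 : ∀ a b, Commute (r₂ a) (l₂ b) := commute_rightAct_leftAct i₂ i₂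
  have er : ∀ s m : A ⊗[k] A, (evalPair r₁ r₂ s).unop m = m * s := by
    intro s m
    induction s with
    | zero => simp
    | add x y hx hy => simp only [map_add, MulOpposite.unop_add, LinearMap.add_apply, hx, hy, mul_add]
    | tmul a b => simp [r₁, r₂, rightAct_apply, i₁, i₂, mul_assoc]
  have el : ∀ s m : A ⊗[k] A, (evalPair l₂ l₁ s).unop m =
      TensorProduct.map (antipode k) (antipode k) (TensorProduct.comm k A A s) * m := by
    intro s m
    induction s with
    | zero => simp
    | add x y hx hy => simp only [map_add, MulOpposite.unop_add, LinearMap.add_apply, hx, hy, add_mul]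
    | tmul a b => simp [l₁, l₂, leftAct_apply, i₁, i₂, ← mul_assoc]
  -- With Q = R₂₁R, each Δ(S(b))Δ(a)Q becomes Δ(S(b))QΔ(a), since Q commutes with coproducts. Thus
  -- multiplication by Δ(u) is an R-matrix acting on Q from both sides; the order l₂, l₁ reflects
  -- that S reverses the coproduct.
  have e1 : ∀ t : A ⊗[k] A, comul (R := k) (LinearMap.mul' k A (TensorProduct.map (antipode k)
      LinearMap.id (TensorProduct.comm k A A t))) * (TensorProduct.comm k A A R * R) =
      (evalPair (convHom r₁ r₂ hr) (convHom l₂ l₁ hl) t).unop (TensorProduct.comm k A A R * R) := by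
    intro t
    induction t with
    | zero => simp
    | add x y hx hy =>
      simp only [map_add, MulOpposite.unop_add, LinearMap.add_apply, ← hx, ← hy, add_mul]
    | tmul a b =>
      rw [evalPair_tmul, MulOpposite.unop_mul, Module.End.mul_apply, convHom_apply, convHom_apply,
        er, el, TensorProduct.comm_tmul, TensorProduct.map_tmul, LinearMap.mul'_apply,
        LinearMap.id_apply, Bialgebra.comul_mul, ← HopfAux.comul_antipode, mul_assoc,
        hR.comm_mul_self_commute a]
  have hlr : ∀ a b, Commute (convHom r₁ r₂ hr a) (l₁ b) := fun a b => by
    rw [convHom_apply]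
    exact (commute_evalPair_left (fun a => (h11 a b).symm) (fun a => (h21 a b).symm) _).symm
  have hlr' : ∀ a b, Commute (convHom r₁ r₂ hr a) (l₂ b) := fun a b => by
    rw [convHom_apply]
    exact (commute_evalPair_left (fun a => (h12 a b).symm) (fun a => (h22 a b).symm) _).symm
  -- Expanding the two convolutions gives four R-matrices. Two uses of Yang–Baxter move the factor
  -- on (r₁, r₂) from the front to the back.
  have e2 : evalPair r₁ r₂ R * evalPair (convHom r₁ r₂ hr) (convHom l₂ l₁ hl) R =
      evalPair r₂ l₁ R * (evalPair r₁ l₁ R * (evalPair r₂ l₂ R *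
        (evalPair r₁ l₂ R * evalPair r₁ r₂ R))) := by
    have y1 := hR.yangBaxter hr h11 h21
    have y2 := hR.yangBaxter hr h12 h22
    rw [hR.evalPair_convHom_right hlr' hlr hl, hR.evalPair_convHom_left hr h11 h21,
      hR.evalPair_convHom_left hr h12 h22]
    calc _ = (evalPair r₁ r₂ R * evalPair r₁ l₁ R * evalPair r₂ l₁ R) *
        (evalPair r₁ l₂ R * evalPair r₂ l₂ R) := by simp only [mul_assoc]
      _ = evalPair r₂ l₁ R * evalPair r₁ l₁ R *
        (evalPair r₁ r₂ R * evalPair r₁ l₂ R * evalPair r₂ l₂ R) := by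
          rw [y1]; simp only [mul_assoc]
      _ = _ := by rw [y2]; simp only [mul_assoc]
  let G : A ⊗[k] (A ⊗[k] A) →ₗ[k] A ⊗[k] A := TensorProduct.map LinearMap.id
    (LinearMap.mul' k A ∘ₗ TensorProduct.map (antipode k) LinearMap.id)
  have hG : G (leg₁₃ k A A A R * leg₁₂ k A A A R) = 1 := hR.map_mul_antipode_legs
  -- The five factors of `e2` are now applied in turn, starting at R₂₁: the first gives 1 by `hG`,
  -- the second u ⊗ 1, the third u ⊗ u.
  have s1 : ∀ x y : A ⊗[k] A, (evalPair r₂ l₁ y).unop (TensorProduct.comm k A A x) =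
      TensorProduct.comm k A A (G (leg₁₃ k A A A x * leg₁₂ k A A A y)) := by
    intro x y
    induction x with
    | zero => simp
    | add a b ha hb => simp only [map_add, add_mul, ha, hb]
    | tmul a b =>
      induction y with
      | zero => simp
      | add a b ha hb =>
        simp only [map_add, mul_add, MulOpposite.unop_add, LinearMap.add_apply, ha, hb]
      | tmul c d => simp [G, leg₁₃, leg₁₂, r₂, l₁, i₁, i₂, leftAct_apply, rightAct_apply]
  have s2 : ∀ x : A ⊗[k] A, (evalPair r₁ l₁ x).unop 1 = LinearMap.mul' k A
      (TensorProduct.map (antipode k) LinearMap.id (TensorProduct.comm k A A x)) ⊗ₜ 1 := by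
    intro x
    induction x with
    | zero => simp
    | add a b ha hb =>
      simp only [map_add, MulOpposite.unop_add, LinearMap.add_apply, ha, hb, TensorProduct.add_tmul]
    | tmul a b => simp [r₁, l₁, i₁, leftAct_apply, rightAct_apply]
  have s3 : ∀ x : A ⊗[k] A, (evalPair r₂ l₂ x).unop (u ⊗ₜ 1) = u ⊗ₜ LinearMap.mul' k A
      (TensorProduct.map (antipode k) LinearMap.id (TensorProduct.comm k A A x)) := by
    intro x
    induction x with
    | zero => simp
    | add a b ha hb =>
      simp only [map_add, MulOpposite.unop_add, LinearMap.add_apply, ha, hb, TensorProduct.tmul_add]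
    | tmul a b => simp [r₂, l₂, i₂, leftAct_apply, rightAct_apply]
  -- The last two factors turn u ⊗ u into ∑ uac ⊗ S(b)ud. Moving u to the right by ud = S²(d)u
  -- leaves 1 ⊗ S applied to ∑ ac ⊗ S(d)b, which is 1 for x = y = R. So u ⊗ u is unchanged.
  have s4 : ∀ x y : A ⊗[k] A, (evalPair r₁ l₂ x * evalPair r₁ r₂ y).unop (u ⊗ₜ u) =
      (u ⊗ₜ 1) * TensorProduct.map LinearMap.id (antipode k)
        (G (leg₁₃ k A A A x * leg₁₂ k A A A y)) * (1 ⊗ₜ u) := by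
    intro x y
    induction x with
    | zero => simp
    | add a b ha hb =>
      simp only [map_add, add_mul, mul_add, MulOpposite.unop_add, LinearMap.add_apply, ha, hb]
    | tmul a b =>
      induction y with
      | zero => simp
      | add a b ha hb =>
        simp only [map_add, mul_add, add_mul, MulOpposite.unop_add, LinearMap.add_apply, ha, hb]
      | tmul c d =>
        simp [G, leg₁₃, leg₁₂, r₁, r₂, l₂, i₁, i₂, leftAct_apply, rightAct_apply,
          HopfAlgebra.antipode_mul_antidistrib, mul_assoc, hR.drinfeldU_mul d, u]
  rw [show TensorProduct.comm k A A R * R = (evalPair r₁ r₂ R).unop (TensorProduct.comm k A A R)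
    from (er _ _).symm, hu, drinfeldU, er, e1]
  rw [show TensorProduct.comm k A A R * R = (evalPair r₁ r₂ R).unop (TensorProduct.comm k A A R)
    from (er _ _).symm, ← Module.End.mul_apply, ← MulOpposite.unop_mul, e2, MulOpposite.unop_mul,
    Module.End.mul_apply, s1, hG, MulOpposite.unop_mul, Module.End.mul_apply]
  have h1 : TensorProduct.comm k A A (1 : A ⊗[k] A) = 1 := rfl
  rw [h1, s2, MulOpposite.unop_mul, Module.End.mul_apply]
  change ((evalPair r₁ l₂ R * evalPair r₁ r₂ R).unop) ((evalPair r₂ l₂ R).unop (u ⊗ₜ[k] 1)) = u ⊗ₜ[k] u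
  rw [s3]
  change ((evalPair r₁ l₂ R * evalPair r₁ r₂ R).unop) (u ⊗ₜ[k] u) = _
  rw [s4, hG, Algebra.TensorProduct.one_def]
  simp

/-- The flip followed by S ⊗ S reverses products, fixes R₂₁R and sends Δ(u) to Δ(S(u)); it is
applied to Δ(u)R₂₁R = u ⊗ u. -/
theorem comm_mul_self_mul_comul_antipode_drinfeldU :
    TensorProduct.comm k A A R * R * comul (R := k) (antipode k (drinfeldU R)) =
      antipode k (drinfeldU R) ⊗ₜ antipode k (drinfeldU R) := by
  have hS : ∀ x y : A ⊗[k] A, TensorProduct.map (antipode k) (antipode k) (x * y) =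
      TensorProduct.map (antipode k) (antipode k) y *
        TensorProduct.map (antipode k) (antipode k) x := by
    intro x y
    induction x with
    | zero => simp
    | add a b ha hb => simp only [map_add, add_mul, mul_add, ha, hb]
    | tmul a b =>
      induction y with
      | zero => simp
      | add a b ha hb => simp only [map_add, add_mul, mul_add, ha, hb]
      | tmul c d => simp [HopfAlgebra.antipode_mul_antidistrib]
  have h1 := congr(TensorProduct.map (antipode k (A := A)) (antipode k)
    (TensorProduct.comm k A A $(hR.comul_drinfeldU_mul)))
  have h2 : TensorProduct.map (antipode k (A := A)) (antipode k) (TensorProduct.comm k A A R) =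
      TensorProduct.comm k A A R := by
    rw [TensorProduct.map_comm, hR.map_antipode]
  rwa [tensorComm_mul, hS, ← HopfAux.comul_antipode, tensorComm_mul, TensorProduct.comm_comm, hS,
    hR.map_antipode, h2] at h1

theorem counit_drinfeldU : counit (R := k) (drinfeldU R) = 1 := by
  have h : ∀ t : A ⊗[k] A, counit (R := k) (drinfeldU t) = counit (R := k)
      (TensorProduct.lid k A (TensorProduct.map (counit (R := k)) LinearMap.id t)) := by
    intro t
    induction t with
    | zero => simp [drinfeldU]
    | add a b ha hb =>
      rw [drinfeldU] at *
      simp only [map_add, ha, hb]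
    | tmul a b => simp [drinfeldU, mul_comm]
  rw [h, hR.counit_left]
  simp

theorem isUnit_comm_mul_self : IsUnit (TensorProduct.comm k A A R * R) :=
  (hR.isUnit.map (Algebra.TensorProduct.comm k A A)).mul hR.isUnit

/-- Contracting Δ(u) = Q⁻¹(u ⊗ u) with m(S ⊗ 1) gives ε(u) = 1 on the left and something of the form
xu on the right. In finite dimension this left inverse is two-sided. -/
theorem isUnit_drinfeldU [FiniteDimensional k A] : IsUnit (drinfeldU R) := by
  have : IsArtinianRing A := IsArtinianRing.of_finite k A
  obtain ⟨Q, hQ⟩ := hR.isUnit_comm_mul_self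
  have h1 : comul (R := k) (drinfeldU R) = (↑Q⁻¹ : A ⊗[k] A) * (drinfeldU R ⊗ₜ drinfeldU R) := by
    rw [← hR.comul_drinfeldU_mul, ← (hR.comm_mul_self_commute _).eq, ← hQ, Units.inv_mul_cancel_left]
  have h2 : ∀ t : A ⊗[k] A, ∃ x, LinearMap.mul' k A (TensorProduct.map (antipode k) LinearMap.id
      (t * (drinfeldU R ⊗ₜ drinfeldU R))) = x * drinfeldU R := by
    intro t
    induction t with
    | zero => exact ⟨0, by simp⟩
    | add a b ha hb =>
      obtain ⟨x, hx⟩ := ha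
      obtain ⟨y, hy⟩ := hb
      exact ⟨x + y, by simp only [map_add, add_mul, hx, hy]⟩
    | tmul a b =>
      exact ⟨antipode k (drinfeldU R) * antipode k a * b,
        by simp [HopfAlgebra.antipode_mul_antidistrib, mul_assoc]⟩
  obtain ⟨x, hx⟩ := h2 ↑Q⁻¹
  rw [← h1, HopfAux.antipode_mul_id_apply, hR.counit_drinfeldU, map_one] at hx
  exact IsUnit.of_mul_eq_one _ (mul_eq_one_symm hx.symm)

/-- The square of the Drinfeld element is `u S(u)` times a group-like element. -/
theorem exists_isGroupLikeElem [FiniteDimensional k A]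
    (hS : Function.Surjective (antipode k (A := A))) :
    ∃ g : A, IsGroupLikeElem k g ∧
      drinfeldU R * drinfeldU R = drinfeldU R * antipode k (drinfeldU R) * g := by
  obtain ⟨u, hu⟩ := hR.isUnit_drinfeldU
  have hz := hR.drinfeldU_mul_antipode_mem_center hS
  have h1 := hR.comul_drinfeldU_mul
  have h2 := hR.comm_mul_self_mul_comul_antipode_drinfeldU
  have hQ := hR.comm_mul_self_commute (antipode k (drinfeldU R))
  have hε : counit (R := k) (drinfeldU R) = 1 := hR.counit_drinfeldU
  rw [← hu] at *
  set w : A := antipode k (u : A) with hw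
  set v : A := antipode k ((u⁻¹ : Aˣ) : A) with hv
  have hwv : w * v = 1 := by
    rw [hw, hv, ← HopfAlgebra.antipode_mul_antidistrib, Units.inv_mul, antipode_one]
  have hvw : v * w = 1 := by
    rw [hw, hv, ← HopfAlgebra.antipode_mul_antidistrib, Units.mul_inv, antipode_one]
  have hc : (u : A) * w = w * u := by
    have := Subalgebra.mem_center_iff.mp hz (u : A)
    rw [mul_assoc] at this
    exact u.isUnit.mul_left_cancel this
  -- The group-like element is uS(u)⁻¹. Since Δ(u) = (u ⊗ u)Q⁻¹ and Δ(S(u)⁻¹) = Q(S(u)⁻¹ ⊗ S(u)⁻¹),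
  -- the factors Q cancel in the product.
  refine ⟨u * v, ⟨?_, ?_⟩, ?_⟩
  · rw [Bialgebra.counit_mul, hε, one_mul, hv, counit_antipode]
    have := congr(counit (R := k) $(u.mul_inv))
    rwa [Bialgebra.counit_mul, hε, one_mul, Bialgebra.counit_one] at this
  · have h3 : comul (R := k) v = TensorProduct.comm k A A R * R * (v ⊗ₜ v) := by
      refine left_inv_eq_right_inv (a := comul (R := k) w) ?_ ?_
      · rw [← Bialgebra.comul_mul, hvw, Bialgebra.comul_one]
      · rw [← mul_assoc, ← hQ.eq, h2, Algebra.TensorProduct.tmul_mul_tmul, hwv]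
        rfl
    rw [Bialgebra.comul_mul, h3, ← mul_assoc, h1, Algebra.TensorProduct.tmul_mul_tmul]
  · have : (u : A) * v = v * u := by
      calc (u : A) * v = v * w * u * v := by rw [hvw, one_mul]
        _ = v * (u * w) * v := by rw [hc]; simp only [mul_assoc]
        _ = v * u := by rw [mul_assoc, mul_assoc, hwv, mul_one]
    rw [mul_assoc, this, ← mul_assoc w, hwv, one_mul]

end IsUniversalR

end QuasiTriangular
end

/-! ### The dual Hopf algebra with opposite coproduct, and its canonical element. -/

noncomputable section

set_option linter.unusedSectionVars false
variable (k : Type u) (H : Type v) [Field k] [Ring H] [HopfAlgebra k H] [FiniteDimensional k H]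

/-- The dual Hopf algebra `H*cop`. -/
def DualCop (k : Type u) (H : Type v) [Field k] [Ring H] [HopfAlgebra k H] : Type (max u v) :=
  HDual k H

namespace DualCop
attribute [local instance] HopfAux.zeroHomClass_linearMap HopfAux.zeroHomClass_linearEquiv
  HopfAux.addHomClass_linearMap HopfAux.addHomClass_linearEquiv

variable {k H}

instance : Ring (DualCop k H) := inferInstanceAs (Ring (HDual k H))

instance : Algebra k (DualCop k H) := inferInstanceAs (Algebra k (HDual k H))

variable (k H) in
/-- The identification of the dual Hopf algebra with the dual space. -/
def toDual : DualCop k H ≃ₗ[k] (H →ₗ[k] k) := WithConv.linearEquiv k (H →ₗ[k] k)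

instance : FiniteDimensional k (DualCop k H) := Module.Finite.equiv (toDual k H).symm

instance : Coalgebra k (DualCop k H) := dualCopCoalgebra k H

/-- Evaluation of the left tensor factor as a linear map in the evaluation point. -/
def evalLin {N : Type*} [AddCommGroup N] [Module k N] :
    DualCop k H ⊗[k] N ≃ₗ[k] (H →ₗ[k] N) :=
  (TensorProduct.congr (toDual k H) (LinearEquiv.refl k N)).trans (dualTensorHomEquiv k H N)

@[simp] theorem evalLin_tmul {N : Type*} [AddCommGroup N] [Module k N] (p : DualCop k H) (n : N)
   (x : H) :
    evalLin (p ⊗ₜ[k] n) x = toDual k H p x • n := by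
  simp [evalLin]

@[ext] theorem ext {p q : DualCop k H} (h : ∀ x, toDual k H p x = toDual k H q x) : p = q :=
  (toDual k H).injective (LinearMap.ext h)

theorem toDual_one (x : H) : toDual k H 1 x = counit (R := k) x := rfl

theorem toDual_mul (p q : DualCop k H) (x : H) : toDual k H (p * q) x =
   LinearMap.mul' k k (TensorProduct.map (toDual k H p) (toDual k H q) (comul (R := k) x)) := rfl

theorem counit_apply (p : DualCop k H) : counit (R := k) p = toDual k H p 1 := rfl

theorem toDual_evalLin_comul (p : DualCop k H) (x y : H) :
    toDual k H (evalLin (comul (R := k) p) x) y = toDual k H p (y * x) := by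
  have := congr(toDual k H $(evalLeft_dualComul x p) y)
  rw [evalLeft_eq] at this
  exact this

theorem evalLin_map {N N' : Type*} [AddCommGroup N] [Module k N] [AddCommGroup N'] [Module k N']
    (f : N →ₗ[k] N') (t : DualCop k H ⊗[k] N) :
    evalLin (TensorProduct.map LinearMap.id f t) = f ∘ₗ evalLin t := by
  induction t with
  | zero => simp
  | add x y hx hy => simp only [map_add, hx, hy, LinearMap.comp_add]
  | tmul p n => ext; simp

/-- Under H* ⊗ N ≅ Hom(H, N) the product becomes convolution. Tensor identities for the canonical
element, which corresponds to the identity map, thereby become identities between linear maps. -/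
theorem evalLin_mul {N : Type*} [Ring N] [Algebra k N] (s t : DualCop k H ⊗[k] N) (x : H) :
    evalLin (s * t) x = LinearMap.mul' k N
      (TensorProduct.map (evalLin s) (evalLin t) (comul (R := k) x)) := by
  induction s with
  | zero => simp
  | add y z hy hz => simp only [add_mul, map_add, hy, hz,
      TensorProduct.map_add_left, LinearMap.add_apply]
  | tmul p m =>
    induction t with
    | zero => simp
    | add y z hy hz => simp only [mul_add, map_add, hy, hz,
        TensorProduct.map_add_right, LinearMap.add_apply]
    | tmul q n =>
      rw [Algebra.TensorProduct.tmul_mul_tmul, evalLin_tmul, toDual_mul]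
      generalize comul (R := k) x = r
      induction r with
      | zero => simp
      | add y z hy hz => simp only [map_add, add_smul, hy, hz]
      | tmul y z => simp [smul_smul, mul_comm]

instance : Bialgebra k (DualCop k H) :=
  Bialgebra.mk' k (DualCop k H)
    (by rw [counit_apply, toDual_one, Bialgebra.counit_one])
    (by intro p q; simp [counit_apply, toDual_mul, Algebra.TensorProduct.one_def])
    (by
      apply evalLin.injective
      ext x y
      rw [toDual_evalLin_comul, Algebra.TensorProduct.one_def, evalLin_tmul, map_smul,
        LinearMap.smul_apply, toDual_one, toDual_one, toDual_one, Bialgebra.counit_mul, mul_comm]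
      rfl)
    (by
      intro p q
      apply evalLin.injective
      ext x y
      rw [toDual_evalLin_comul, evalLin_mul, toDual_mul, Bialgebra.comul_mul]
      generalize comul (R := k) x = r
      induction r with
      | zero => simp
      | add a b ha hb => simp only [map_add, mul_add, LinearMap.add_apply, ha, hb]
      | tmul a b =>
        rw [TensorProduct.map_tmul, LinearMap.mul'_apply, toDual_mul]
        generalize comul (R := k) y = s
        induction s with
        | zero => simp
        | add a b ha hb => simp only [map_add, add_mul, ha, hb]
        | tmul c d => simp [toDual_evalLin_comul])

variable (k H) in
/-- The antipode `p ↦ p ∘ S⁻¹` of the dual Hopf algebra. -/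
def antipodeDual : DualCop k H →ₗ[k] DualCop k H :=
  (toDual k H).symm.toLinearMap ∘ₗ LinearMap.lcomp k k (antipodeInv k H) ∘ₗ (toDual k H).toLinearMap

theorem toDual_antipodeDual (p : DualCop k H) (x : H) :
   toDual k H (antipodeDual k H p) x = toDual k H p (antipodeInv k H x) := by
  simp [antipodeDual]

instance : HopfAlgebra k (DualCop k H) where
  antipode := antipodeDual k H
  mul_antipode_rTensor_comul := LinearMap.ext DrinfeldDouble.dualAntipode_mul_id
  mul_antipode_lTensor_comul := LinearMap.ext DrinfeldDouble.id_mul_dualAntipode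

theorem toDual_antipode (p : DualCop k H) (x : H) :
   toDual k H (antipode k p) x = toDual k H p (antipodeInv k H x) := toDual_antipodeDual p x

open QuasiTriangular

variable (k H) in
/-- The canonical element `∑ hᵢ* ⊗ hᵢ` of `H* ⊗ H`. -/
def canonicalElement : DualCop k H ⊗[k] H := evalLin.symm LinearMap.id

@[simp] theorem evalLin_canonicalElement : evalLin (canonicalElement k H) = LinearMap.id :=
  evalLin.apply_symm_apply _

/-- As maps on H, both sides are Δ: the right one is the convolution of x ↦ x ⊗ 1 with x ↦ 1 ⊗ x. -/
theorem map_comul_canonicalElement :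
    TensorProduct.map LinearMap.id (comul (R := k)) (canonicalElement k H) =
      leg₁₂ k (DualCop k H) H H (canonicalElement k H) *
        leg₁₃ k (DualCop k H) H H (canonicalElement k H) := by
  apply evalLin.injective
  refine LinearMap.ext fun x => ?_
  have h1 : leg₁₂ k (DualCop k H) H H (canonicalElement k H) = TensorProduct.map LinearMap.id
      (TensorProduct.mk k H H |>.flip 1) (canonicalElement k H) := rfl
  have h2 : leg₁₃ k (DualCop k H) H H (canonicalElement k H) = TensorProduct.map LinearMap.id
      (TensorProduct.mk k H H 1) (canonicalElement k H) := rfl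
  rw [evalLin_map, evalLin_canonicalElement, evalLin_mul, h1, h2, evalLin_map,
    evalLin_map, evalLin_canonicalElement]
  simp only [LinearMap.comp_apply, LinearMap.id_apply]
  generalize comul (R := k) x = r
  induction r with
  | zero => simp
  | add y z hy hz => simp only [map_add, ← hy, ← hz]
  | tmul y z => simp

/-- Evaluated at x and then y, both sides give yx. The order of the legs 23 and 13 is forced by the
opposite coproduct on the dual. -/
theorem map_dualComul_canonicalElement :
    TensorProduct.assoc k (DualCop k H) (DualCop k H) H
      (TensorProduct.map (comul (R := k)) LinearMap.id (canonicalElement k H)) =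
      leg₂₃ k (DualCop k H) (DualCop k H) H (canonicalElement k H) *
        leg₁₃ k (DualCop k H) (DualCop k H) H (canonicalElement k H) := by
  apply evalLin.injective
  refine LinearMap.ext fun x => ?_
  apply evalLin.injective
  refine LinearMap.ext fun y => ?_
  have h1 : ∀ t : DualCop k H ⊗[k] H, evalLin (evalLin
      (TensorProduct.assoc k (DualCop k H) (DualCop k H) H
        (TensorProduct.map (comul (R := k)) LinearMap.id t)) x) y = evalLin t (y * x) := by
    intro t
    induction t with
    | zero => simp
    | add a b ha hb => simp only [map_add, LinearMap.add_apply, ha, hb]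
    | tmul p h =>
      have : ∀ s : DualCop k H ⊗[k] DualCop k H, evalLin
          (TensorProduct.assoc k (DualCop k H) (DualCop k H) H (s ⊗ₜ h)) x = evalLin s x ⊗ₜ h := by
        intro s
        induction s with
        | zero => simp
        | add a b ha hb =>
          simp only [map_add, LinearMap.add_apply, TensorProduct.add_tmul, ha, hb]
        | tmul p q => simp [TensorProduct.smul_tmul']
      rw [TensorProduct.map_tmul, LinearMap.id_apply, this, evalLin_tmul, evalLin_tmul,
        toDual_evalLin_comul]
  have h2 : ∀ s t : DualCop k H ⊗[k] H, evalLin (evalLin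
      (leg₂₃ k (DualCop k H) (DualCop k H) H s * leg₁₃ k (DualCop k H) (DualCop k H) H t) x) y =
      evalLin s y * evalLin t x := by
    intro s t
    induction s with
    | zero => simp
    | add a b ha hb => simp only [map_add, LinearMap.add_apply, add_mul, ha, hb]
    | tmul p h =>
      induction t with
      | zero => simp
      | add a b ha hb => simp only [map_add, LinearMap.add_apply, mul_add, ha, hb]
      | tmul q l => simp [leg₂₃, leg₁₃, smul_smul, mul_comm]
  rw [h1, h2]
  simp

/-- The antipode of the dual is composition with S⁻¹, so the left side is the map S ∘ id ∘ S⁻¹. -/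
theorem map_antipode_canonicalElement :
    TensorProduct.map (antipode k) (antipode k) (canonicalElement k H) = canonicalElement k H := by
  apply evalLin.injective
  refine LinearMap.ext fun x => ?_
  have h : ∀ t : DualCop k H ⊗[k] H, evalLin (TensorProduct.map (antipode k) (antipode k) t) x =
      antipode k (evalLin t (antipodeInv k H x)) := by
    intro t
    induction t with
    | zero => simp
    | add a b ha hb => simp only [map_add, LinearMap.add_apply, ha, hb]
    | tmul p h => simp [toDual_antipode]
  rw [h]
  simp [antipode_antipodeInv]

theorem lid_counit_canonicalElement : TensorProduct.lid k H
    (TensorProduct.map (counit (R := k)) LinearMap.id (canonicalElement k H)) = 1 := by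
  have h : ∀ t : DualCop k H ⊗[k] H, TensorProduct.lid k H
      (TensorProduct.map (counit (R := k)) LinearMap.id t) = evalLin t 1 := by
    intro t
    induction t with
    | zero => simp
    | add a b ha hb => simp only [map_add, LinearMap.add_apply, ha, hb]
    | tmul p h => simp [counit_apply]
  rw [h]
  simp

theorem rid_counit_canonicalElement : TensorProduct.rid k (DualCop k H)
    (TensorProduct.map LinearMap.id (counit (R := k)) (canonicalElement k H)) = 1 := by
  ext x
  have h : ∀ t : DualCop k H ⊗[k] H, toDual k H (TensorProduct.rid k (DualCop k H)
      (TensorProduct.map LinearMap.id (counit (R := k)) t)) x = counit (R := k) (evalLin t x) := by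
    intro t
    induction t with
    | zero => simp
    | add a b ha hb => simp only [map_add, LinearMap.add_apply, ha, hb]
    | tmul p h => simp [mul_comm]
  rw [h, toDual_one]
  simp

end DualCop

/-! ### The R-matrix of the double: coproduct, counit and antipode axioms. -/

namespace DrinfeldDouble

attribute [local instance] HopfAux.zeroHomClass_linearMap HopfAux.zeroHomClass_linearEquiv
  HopfAux.addHomClass_linearMap HopfAux.addHomClass_linearEquiv

open QuasiTriangular DualCop
variable {k H}

variable (k H) in
/-- The inclusion of the dual Hopf algebra in the double. -/
def ofDualCop : DualCop k H →ₐ[k] DrinfeldDouble k H := ofDual k H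

variable (k H) in
/-- The identification of the double with `H* ⊗ H`. -/
def dualTensorEquiv : DualCop k H ⊗[k] H ≃ₗ[k] DrinfeldDouble k H := tensorEquiv k H

theorem dualTensorEquiv_tmul (p : DualCop k H) (h : H) :
    dualTensorEquiv k H (p ⊗ₜ h) = ofDualCop k H p * ofH k H h := (ofDual_mul_ofH p h).symm

theorem comul_ofDualCop (p : DualCop k H) : comul (R := k) (ofDualCop k H p) =
    TensorProduct.map (ofDualCop k H).toLinearMap (ofDualCop k H).toLinearMap
      (comul (R := k) p) := comul_ofDual p

theorem counit_ofDual (p : HDual k H) : counit (R := k) (ofDual k H p) = p 1 := by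
  rw [ofDual_apply, counit_mk, Bialgebra.counit_one, one_mul]

theorem counit_ofDualCop (p : DualCop k H) :
    counit (R := k) (ofDualCop k H p) = counit (R := k) p := counit_ofDual p

theorem counit_ofH (h : H) : counit (R := k) (ofH k H h) = counit (R := k) h := by
  rw [ofH_apply, counit_mk, LinearMap.convOne_apply, Bialgebra.counit_one, map_one, mul_one]

theorem antipode_ofH (h : H) : antipode k (ofH k H h) = ofH k H (antipode k h) := by
  change antipodeD k H (mk 1 h) = _
  rw [antipodeD_mk]
  have : dualAntipode k H 1 = 1 := antipode_one (R := k) (A := DualCop k H)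
  rw [this, map_one, mul_one]

theorem antipode_ofDual (p : HDual k H) :
    antipode k (ofDual k H p) = ofDual k H (dualAntipode k H p) := by
  change antipodeD k H (mk p 1) = _
  rw [antipodeD_mk, antipode_one, map_one, one_mul]

theorem antipode_ofDualCop (p : DualCop k H) :
    antipode k (ofDualCop k H p) = ofDualCop k H (antipode k p) := antipode_ofDual p

variable (k H) in
/-- The flipped `R`-matrix `∑ hᵢ* ⊗ hᵢ` of the double. -/
def flipR : DrinfeldDouble k H ⊗[k] DrinfeldDouble k H :=
  Algebra.TensorProduct.map (ofDualCop k H) (ofH k H) (canonicalElement k H)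

theorem canonicalElement_eq_sum : canonicalElement k H =
    ∑ i, (toDual k H).symm ((Module.finBasis k H).coord i) ⊗ₜ[k] Module.finBasis k H i := by
  apply evalLin.injective
  rw [evalLin_canonicalElement]
  refine LinearMap.ext fun x => ?_
  simp only [map_sum, LinearMap.sum_apply, evalLin_tmul, LinearEquiv.apply_symm_apply]
  exact ((Module.finBasis k H).sum_repr x).symm

theorem comm_universalR : TensorProduct.comm k _ _ (universalR k H) = flipR k H := by
  rw [universalR, flipR, canonicalElement_eq_sum]
  simp only [map_sum, TensorProduct.comm_tmul, Algebra.TensorProduct.map_tmul]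
  rfl

theorem universalR_eq : universalR k H = TensorProduct.comm k _ _ (flipR k H) := by
  rw [← comm_universalR, TensorProduct.comm_comm]

theorem comul_left_universalR : TensorProduct.assoc k _ _ _
    (TensorProduct.map (comul (R := k)) LinearMap.id (universalR k H)) =
    leg₁₃ k (DrinfeldDouble k H) (DrinfeldDouble k H) (DrinfeldDouble k H) (universalR k H) *
      leg₂₃ k (DrinfeldDouble k H) (DrinfeldDouble k H) (DrinfeldDouble k H) (universalR k H) := by
  let D := DrinfeldDouble k H
  -- The algebra map p ⊗ a ⊗ b ↦ a ⊗ b ⊗ p carries legs 12 and 13 of the canonical element to legs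
  -- 13 and 23 of R.
  let Ψ : DualCop k H ⊗[k] (H ⊗[k] H) →ₐ[k] D ⊗[k] (D ⊗[k] D) :=
    (Algebra.TensorProduct.assoc k k k D D D).toAlgHom.comp
      ((Algebra.TensorProduct.comm k D (D ⊗[k] D)).toAlgHom.comp
        (Algebra.TensorProduct.map (ofDualCop k H)
          (Algebra.TensorProduct.map (ofH k H) (ofH k H))))
  have h1 : ∀ t : DualCop k H ⊗[k] H, TensorProduct.assoc k _ _ _
      (TensorProduct.map (comul (R := k)) LinearMap.id (TensorProduct.comm k _ _
        (Algebra.TensorProduct.map (ofDualCop k H) (ofH k H) t))) =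
      Ψ (TensorProduct.map LinearMap.id (comul (R := k)) t) := by
    intro t
    induction t with
    | zero => simp
    | add a b ha hb => simp only [map_add, ha, hb]
    | tmul p h =>
      simp only [Algebra.TensorProduct.map_tmul, TensorProduct.comm_tmul, TensorProduct.map_tmul,
        comul_ofH, LinearMap.id_apply]
      generalize comul (R := k) h = s
      induction s with
      | zero => simp
      | add a b ha hb => simp only [map_add, TensorProduct.add_tmul, TensorProduct.tmul_add, ha, hb]
      | tmul a b => simp [Ψ, D]
  have h2 : ∀ t : DualCop k H ⊗[k] H, leg₁₃ k D D D (TensorProduct.comm k _ _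
        (Algebra.TensorProduct.map (ofDualCop k H) (ofH k H) t)) = Ψ (leg₁₂ k _ _ _ t) := by
    intro t
    induction t with
    | zero => simp
    | add a b ha hb => simp only [map_add, ha, hb]
    | tmul p h => simp [Ψ, leg₁₂, leg₁₃, D]
  have h3 : ∀ t : DualCop k H ⊗[k] H, leg₂₃ k D D D (TensorProduct.comm k _ _
        (Algebra.TensorProduct.map (ofDualCop k H) (ofH k H) t)) = Ψ (leg₁₃ k _ _ _ t) := by
    intro t
    induction t with
    | zero => simp
    | add a b ha hb => simp only [map_add, ha, hb]
    | tmul p h => simp [Ψ, leg₂₃, leg₁₃, D]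
  rw [universalR_eq, flipR, h1, map_comul_canonicalElement, map_mul, ← h2, ← h3]

theorem comul_right_universalR :
    TensorProduct.map LinearMap.id (comul (R := k)) (universalR k H) =
    leg₁₃ k (DrinfeldDouble k H) (DrinfeldDouble k H) (DrinfeldDouble k H) (universalR k H) *
      leg₁₂ k (DrinfeldDouble k H) (DrinfeldDouble k H) (DrinfeldDouble k H) (universalR k H) := by
  let D := DrinfeldDouble k H
  -- The algebra map p ⊗ q ⊗ h ↦ h ⊗ p ⊗ q carries legs 23 and 13 of the canonical element to legs
  -- 13 and 12 of R.
  let Ψ : DualCop k H ⊗[k] (DualCop k H ⊗[k] H) →ₐ[k] D ⊗[k] (D ⊗[k] D) :=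
    (Algebra.TensorProduct.comm k (D ⊗[k] D) D).toAlgHom.comp
      ((Algebra.TensorProduct.assoc k k k D D D).symm.toAlgHom.comp
        (Algebra.TensorProduct.map (ofDualCop k H)
          (Algebra.TensorProduct.map (ofDualCop k H) (ofH k H))))
  have h1 : ∀ t : DualCop k H ⊗[k] H,
      (TensorProduct.map LinearMap.id (comul (R := k)) (TensorProduct.comm k _ _
        (Algebra.TensorProduct.map (ofDualCop k H) (ofH k H) t))) =
      Ψ (TensorProduct.assoc k _ _ _ (TensorProduct.map (comul (R := k)) LinearMap.id t)) := by
    intro t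
    induction t with
    | zero => simp
    | add a b ha hb => simp only [map_add, ha, hb]
    | tmul p h =>
      simp only [Algebra.TensorProduct.map_tmul, TensorProduct.comm_tmul, TensorProduct.map_tmul,
        comul_ofDualCop, LinearMap.id_apply]
      generalize comul (R := k) p = s
      induction s with
      | zero => simp
      | add a b ha hb => simp only [map_add, TensorProduct.add_tmul, TensorProduct.tmul_add, ha, hb]
      | tmul a b => simp [Ψ, D]
  have h2 : ∀ t : DualCop k H ⊗[k] H, leg₁₃ k D D D (TensorProduct.comm k _ _
        (Algebra.TensorProduct.map (ofDualCop k H) (ofH k H) t)) = Ψ (leg₂₃ k _ _ _ t) := by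
    intro t
    induction t with
    | zero => simp
    | add a b ha hb => simp only [map_add, ha, hb]
    | tmul p h => simp [Ψ, leg₂₃, leg₁₃, D]
  have h3 : ∀ t : DualCop k H ⊗[k] H, leg₁₂ k D D D (TensorProduct.comm k _ _
        (Algebra.TensorProduct.map (ofDualCop k H) (ofH k H) t)) = Ψ (leg₁₃ k _ _ _ t) := by
    intro t
    induction t with
    | zero => simp
    | add a b ha hb => simp only [map_add, ha, hb]
    | tmul p h => simp [Ψ, leg₁₂, leg₁₃, D]
  rw [universalR_eq, flipR, h1, map_dualComul_canonicalElement, map_mul, ← h2, ← h3]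

theorem map_antipode_universalR :
    TensorProduct.map (antipode k) (antipode k) (universalR k H) = universalR k H := by
  have h : ∀ t : DualCop k H ⊗[k] H, TensorProduct.map (antipode k) (antipode k)
      (Algebra.TensorProduct.map (ofDualCop k H) (ofH k H) t) =
      Algebra.TensorProduct.map (ofDualCop k H) (ofH k H)
        (TensorProduct.map (antipode k) (antipode k) t) := by
    intro t
    induction t with
    | zero => simp
    | add a b ha hb => simp only [map_add, ha, hb]
    | tmul p h => simp [antipode_ofH, antipode_ofDualCop]
  rw [universalR_eq, TensorProduct.map_comm, flipR, h, map_antipode_canonicalElement]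

theorem counit_left_universalR : TensorProduct.lid k _
    (TensorProduct.map (counit (R := k)) LinearMap.id (universalR k H)) = 1 := by
  have h : ∀ t : DualCop k H ⊗[k] H, TensorProduct.lid k _
      (TensorProduct.map (counit (R := k)) LinearMap.id (TensorProduct.comm k _ _
        (Algebra.TensorProduct.map (ofDualCop k H) (ofH k H) t))) =
      ofDualCop k H (TensorProduct.rid k _
        (TensorProduct.map LinearMap.id (counit (R := k)) t)) := by
    intro t
    induction t with
    | zero => simp
    | add a b ha hb => simp only [map_add, ha, hb]
    | tmul p h => simp [counit_ofH]
  rw [universalR_eq, flipR, h, rid_counit_canonicalElement, map_one]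

theorem counit_right_universalR : TensorProduct.rid k _
    (TensorProduct.map LinearMap.id (counit (R := k)) (universalR k H)) = 1 := by
  have h : ∀ t : DualCop k H ⊗[k] H, TensorProduct.rid k _
      (TensorProduct.map LinearMap.id (counit (R := k)) (TensorProduct.comm k _ _
        (Algebra.TensorProduct.map (ofDualCop k H) (ofH k H) t))) =
      ofH k H (TensorProduct.lid k _
        (TensorProduct.map (counit (R := k)) LinearMap.id t)) := by
    intro t
    induction t with
    | zero => simp
    | add a b ha hb => simp only [map_add, ha, hb]
    | tmul p h => simp [counit_ofDualCop]
  rw [universalR_eq, flipR, h, lid_counit_canonicalElement, map_one]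

end DrinfeldDouble
end

/-! ### Quasi-cocommutativity of the double and centrality of z. -/

noncomputable section

namespace DrinfeldDouble

set_option linter.unusedSectionVars false

attribute [local instance] HopfAux.zeroHomClass_linearMap HopfAux.zeroHomClass_linearEquiv
  HopfAux.addHomClass_linearMap HopfAux.addHomClass_linearEquiv

open QuasiTriangular DualCop
variable {k : Type u} {H : Type v} [Field k] [Ring H] [HopfAlgebra k H] [FiniteDimensional k H]

variable (k H) in
/-- The map `(a ⊗ b ⊗ c) ⊗ d ↦ (a ⊗ b) ⊗ d S⁻¹(c)`. -/
def contractInv : (H ⊗[k] (H ⊗[k] H)) ⊗[k] H →ₗ[k] (H ⊗[k] H) ⊗[k] H :=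
  TensorProduct.map LinearMap.id (LinearMap.mul' k H ∘ₗ (TensorProduct.comm k H H).toLinearMap ∘ₗ
    TensorProduct.map (antipodeInv k H) LinearMap.id) ∘ₗ
  (TensorProduct.assoc k (H ⊗[k] H) H H).toLinearMap ∘ₗ
  TensorProduct.map (TensorProduct.assoc k H H H).symm.toLinearMap LinearMap.id

theorem contractInv_tmul (a b c d : H) : contractInv k H ((a ⊗ₜ (b ⊗ₜ c)) ⊗ₜ d) =
    (a ⊗ₜ b) ⊗ₜ (d * antipodeInv k H c) := rfl

/-- In Sweedler notation, h₍₁₎ ⊗ h₍₂₎ ⊗ h₍₄₎S⁻¹(h₍₃₎) = h₍₁₎ ⊗ h₍₂₎ ⊗ 1. This cancels the S⁻¹ that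
the straightening relation of the double introduces. -/
theorem contractInv_comul (h : H) :
    contractInv k H (TensorProduct.map (comul₃ k H) LinearMap.id (comul (R := k) h)) =
      comul (R := k) h ⊗ₜ 1 := by
  have h1 : ∀ t : H ⊗[k] H, (TensorProduct.assoc k (H ⊗[k] H) H H)
      (TensorProduct.map (TensorProduct.assoc k H H H).symm.toLinearMap LinearMap.id
        (TensorProduct.map (comul₃ k H) LinearMap.id t)) =
      TensorProduct.map (comul (R := k)) LinearMap.id (TensorProduct.assoc k H H H
        (TensorProduct.map (comul (R := k)) LinearMap.id t)) := by
    intro t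
    induction t with
    | zero => simp
    | add a b ha hb => simp only [map_add, ha, hb]
    | tmul a d =>
      have := coassoc_symm_apply (R := k) a
      simp only [LinearMap.lTensor_def, LinearMap.rTensor_def] at this
      simp only [TensorProduct.map_tmul, LinearMap.id_apply, comul₃, LinearMap.comp_apply,
        LinearEquiv.coe_coe, this]
      generalize comul (R := k) a = s
      induction s with
      | zero => simp
      | add a b ha hb => simp only [map_add, TensorProduct.add_tmul, ha, hb]
      | tmul a b =>
        simp only [TensorProduct.map_tmul, LinearMap.id_apply, TensorProduct.assoc_tmul]
  have h2 : ∀ t : H ⊗[k] H, TensorProduct.map LinearMap.id (LinearMap.mul' k H ∘ₗ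
      (TensorProduct.comm k H H).toLinearMap ∘ₗ TensorProduct.map (antipodeInv k H) LinearMap.id)
      (TensorProduct.map (comul (R := k)) LinearMap.id
        (TensorProduct.map LinearMap.id (comul (R := k)) t)) =
      comul (R := k) (TensorProduct.rid k H
        (TensorProduct.map LinearMap.id (counit (R := k)) t)) ⊗ₜ[k] (1 : H) := by
    intro t
    induction t with
    | zero => simp
    | add a b ha hb => simp only [map_add, TensorProduct.add_tmul, ha, hb]
    | tmul a b =>
      simp only [TensorProduct.map_tmul, LinearMap.id_apply, LinearMap.comp_apply,
        LinearEquiv.coe_coe, mul_antipodeInv_comul, Algebra.algebraMap_eq_smul_one,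
        TensorProduct.rid_tmul, map_smul, TensorProduct.tmul_smul, TensorProduct.smul_tmul']
  have e1 := coassoc_apply (R := k) h
  have e2 := congr(TensorProduct.rid k H $(lTensor_counit_comul (R := k) h))
  simp only [LinearMap.lTensor_def, LinearMap.rTensor_def, TensorProduct.rid_tmul, one_smul] at e1 e2
  rw [contractInv, LinearMap.comp_apply, LinearMap.comp_apply, LinearEquiv.coe_coe, h1, e1, h2, e2]

/-- The map `a ⊗ (b ⊗ c) ↦ b ⊗ S⁻¹(c) x a`. -/
def sandwich (x : H) : H ⊗[k] (H ⊗[k] H) →ₗ[k] H ⊗[k] H :=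
  TensorProduct.map LinearMap.id (LinearMap.mul' k H ∘ₗ
    TensorProduct.map (antipodeInv k H) (LinearMap.mulLeft k x) ∘ₗ
    (TensorProduct.comm k H H).toLinearMap) ∘ₗ (TensorProduct.leftComm k H H H).toLinearMap

@[simp] theorem sandwich_tmul (x a b c : H) :
    sandwich (k := k) x (a ⊗ₜ (b ⊗ₜ c)) = b ⊗ₜ (antipodeInv k H c * (x * a)) := rfl

/-- The map `(a ⊗ b) ⊗ e ↦ b ⊗ e x a`. -/
def sandwichMul (x : H) : (H ⊗[k] H) ⊗[k] H →ₗ[k] H ⊗[k] H :=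
  TensorProduct.map LinearMap.id (LinearMap.mul' k H ∘ₗ
    TensorProduct.map LinearMap.id (LinearMap.mulLeft k x) ∘ₗ
    (TensorProduct.comm k H H).toLinearMap) ∘ₗ (TensorProduct.leftComm k H H H).toLinearMap ∘ₗ
    (TensorProduct.assoc k H H H).toLinearMap

@[simp] theorem sandwichMul_tmul (x a b e : H) :
    sandwichMul (k := k) x ((a ⊗ₜ b) ⊗ₜ e) = b ⊗ₜ (e * (x * a)) := rfl

theorem map_mulLeft_sandwich (x d : H) (t : H ⊗[k] (H ⊗[k] H)) :
    TensorProduct.map LinearMap.id (LinearMap.mulLeft k d) (sandwich x t) =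
      sandwichMul x (contractInv k H (t ⊗ₜ d)) := by
  induction t with
  | zero => simp
  | add a b ha hb => simp only [map_add, TensorProduct.add_tmul, ha, hb]
  | tmul a bc =>
    induction bc with
    | zero => simp
    | add a b ha hb => simp only [map_add, TensorProduct.tmul_add, TensorProduct.add_tmul, ha, hb]
    | tmul b c => simp [contractInv_tmul, mul_assoc]

theorem evalLeft_crossOp (t : H ⊗[k] (H ⊗[k] H)) (q : HDual k H) (x : H) :
    evalLeft x (crossOp t (q ⊗ₜ[k] (1 : H))) =
      TensorProduct.rid k H (TensorProduct.map LinearMap.id q.ofConv (sandwich x t)) := by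
  induction t with
  | zero => simp
  | add a b ha hb => simp only [map_add, LinearMap.add_apply, ha, hb]
  | tmul a bc =>
    induction bc with
    | zero => simp
    | add a b ha hb =>
      simp only [map_add, TensorProduct.tmul_add, LinearMap.add_apply, ha, hb]
    | tmul b c =>
      rw [crossOp_tmul, evalLeft_tmul, dualLeft_apply, dualRightInv_apply]
      simp

/-- The straightening relation read as a function on H: evaluating the dual factor of aq at x gives
∑ q(S⁻¹(a₍₃₎)xa₍₁₎)a₍₂₎. -/
theorem evalLeft_ofH_mul_ofDual (a : H) (q : HDual k H) (x : H) :
    evalLeft x ((tensorEquiv k H).symm (ofH k H a * ofDual k H q)) =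
      TensorProduct.rid k H (TensorProduct.map LinearMap.id q.ofConv
        (sandwich x (comul₃ k H a))) := by
  rw [ofH_mul_ofDual, LinearEquiv.symm_apply_apply, leftH, LinearMap.comp_apply, evalLeft_crossOp]

theorem evalLin_ofH_mul_ofDualCop (a : H) (q : DualCop k H) (x : H) :
    evalLin ((dualTensorEquiv k H).symm (ofH k H a * ofDualCop k H q)) x =
      TensorProduct.rid k H (TensorProduct.map LinearMap.id (toDual k H q)
        (sandwich x (comul₃ k H a))) := by
  have := evalLeft_ofH_mul_ofDual a q x
  rw [evalLeft_eq] at this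
  exact this

variable (k H) in
/-- Evaluation of the dual factor of the first component. -/
def evalFst (x : H) : DrinfeldDouble k H ⊗[k] DrinfeldDouble k H →ₗ[k] H ⊗[k] DrinfeldDouble k H :=
  LinearMap.applyₗ x ∘ₗ evalLin.toLinearMap ∘ₗ (TensorProduct.assoc k _ _ _).toLinearMap ∘ₗ
    TensorProduct.map (dualTensorEquiv k H).symm.toLinearMap LinearMap.id

theorem evalFst_tmul (x : H) (y d : DrinfeldDouble k H) :
    evalFst k H x (y ⊗ₜ d) = evalLin ((dualTensorEquiv k H).symm y) x ⊗ₜ d := by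
  simp only [evalFst, LinearMap.comp_apply, TensorProduct.map_tmul, LinearEquiv.coe_coe,
    LinearMap.id_apply, LinearMap.applyₗ_apply_apply]
  generalize (dualTensorEquiv k H).symm y = t
  induction t with
  | zero => simp
  | add a b ha hb => simp only [map_add, TensorProduct.add_tmul, LinearMap.add_apply, ha, hb]
  | tmul p h => simp [TensorProduct.smul_tmul']

theorem evalFst_ext {s t : DrinfeldDouble k H ⊗[k] DrinfeldDouble k H}
    (h : ∀ x, evalFst k H x s = evalFst k H x t) : s = t := by
  apply (TensorProduct.congr (dualTensorEquiv k H).symm (LinearEquiv.refl k _)).injective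
  apply (TensorProduct.assoc k _ _ _).injective
  apply evalLin.injective
  exact LinearMap.ext h

/-- Evaluate the dual factor of the first component at x. On the left the dual already stands before
H, giving h₍₂₎ ⊗ xh₍₁₎. On the right straightening gives h₍₂₎ ⊗ h₍₄₎S⁻¹(h₍₃₎)xh₍₁₎, which agrees by
`contractInv_comul`. -/
theorem flipR_mul_comm_comul_ofH (h : H) :
    flipR k H * TensorProduct.comm k _ _ (comul (R := k) (ofH k H h)) =
      comul (R := k) (ofH k H h) * flipR k H := by
  rw [comul_ofH]
  apply evalFst_ext
  intro x
  have h1 : ∀ (t : DualCop k H ⊗[k] H) (a d : H), evalFst k H x ((ofH k H a ⊗ₜ ofH k H d) *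
        Algebra.TensorProduct.map (ofDualCop k H) (ofH k H) t) =
      TensorProduct.map LinearMap.id ((ofH k H).toLinearMap ∘ₗ LinearMap.mulLeft k d ∘ₗ evalLin t)
        (sandwich x (comul₃ k H a)) := by
    intro t a d
    induction t with
    | zero => simp
    | add a b ha hb =>
      simp only [map_add, mul_add, LinearMap.comp_add, TensorProduct.map_add_right,
        LinearMap.add_apply, ha, hb]
    | tmul q l =>
      rw [Algebra.TensorProduct.map_tmul, Algebra.TensorProduct.tmul_mul_tmul, evalFst_tmul,
        evalLin_ofH_mul_ofDualCop]
      generalize sandwich x (comul₃ k H a) = r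
      induction r with
      | zero => simp
      | add a b ha hb => simp only [map_add, TensorProduct.add_tmul, ha, hb]
      | tmul b c => simp [TensorProduct.smul_tmul]
  have h2 : ∀ s : H ⊗[k] H, evalFst k H x (TensorProduct.map (ofH k H).toLinearMap
      (ofH k H).toLinearMap s * flipR k H) = TensorProduct.map LinearMap.id (ofH k H).toLinearMap
        (sandwichMul x (contractInv k H (TensorProduct.map (comul₃ k H) LinearMap.id s))) := by
    intro s
    induction s with
    | zero => simp
    | add a b ha hb => simp only [map_add, add_mul, ha, hb]
    | tmul a d =>
      rw [TensorProduct.map_tmul, TensorProduct.map_tmul, LinearMap.id_apply,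
        ← map_mulLeft_sandwich]
      refine (h1 _ a d).trans ?_
      rw [evalLin_canonicalElement, LinearMap.comp_id]
      generalize sandwich x (comul₃ k H a) = r
      induction r with
      | zero => simp
      | add a b ha hb => simp only [map_add, ha, hb]
      | tmul b c => simp
  have h3 : ∀ (t : DualCop k H ⊗[k] H) (a b : H), evalFst k H x
      (Algebra.TensorProduct.map (ofDualCop k H) (ofH k H) t * (ofH k H b ⊗ₜ ofH k H a)) =
      b ⊗ₜ ofH k H (evalLin t x * a) := by
    intro t a b
    induction t with
    | zero => simp
    | add a b ha hb =>
      simp only [map_add, add_mul, LinearMap.add_apply, TensorProduct.tmul_add, ha, hb]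
    | tmul q l =>
      rw [Algebra.TensorProduct.map_tmul, Algebra.TensorProduct.tmul_mul_tmul, evalFst_tmul,
        ← dualTensorEquiv_tmul, LinearEquiv.symm_apply_apply]
      simp [TensorProduct.smul_tmul]
  have h4 : ∀ s : H ⊗[k] H, evalFst k H x (flipR k H * TensorProduct.comm k _ _
      (TensorProduct.map (ofH k H).toLinearMap (ofH k H).toLinearMap s)) =
      TensorProduct.map LinearMap.id (ofH k H).toLinearMap (sandwichMul x (s ⊗ₜ 1)) := by
    intro s
    induction s with
    | zero => simp
    | add a b ha hb => simp only [map_add, mul_add, TensorProduct.add_tmul, ha, hb]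
    | tmul a b =>
      refine (h3 _ a b).trans ?_
      simp
  rw [h2, h4, contractInv_comul]

theorem toDual_evalLin_comm (s : DualCop k H ⊗[k] DualCop k H) (x y : H) :
    toDual k H (evalLin (TensorProduct.comm k _ _ s) x) y = toDual k H (evalLin s y) x := by
  induction s with
  | zero => simp
  | add a b ha hb => simp only [map_add, LinearMap.add_apply, ha, hb]
  | tmul p q => simp [mul_comm]

/-- The argument is dual to the one for elements of H. Evaluating the first tensor factor at y puts
y₍₁₎ in front of a functional on the left side, where it has to be straightened, and y₍₂₎ behind one
on the right side. After evaluating the remaining dual factor at x, both sides agree by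
`contractInv_comul` applied to y. -/
theorem flipR_mul_comm_comul_ofDualCop (p : DualCop k H) :
    flipR k H * TensorProduct.comm k _ _ (comul (R := k) (ofDualCop k H p)) =
      comul (R := k) (ofDualCop k H p) * flipR k H := by
  rw [comul_ofDualCop]
  let Θ : DualCop k H ⊗[k] DrinfeldDouble k H →ₐ[k] DrinfeldDouble k H ⊗[k] DrinfeldDouble k H :=
    Algebra.TensorProduct.map (ofDualCop k H) (AlgHom.id k _)
  have h1 : flipR k H = Θ (TensorProduct.map LinearMap.id (ofH k H).toLinearMap
      (canonicalElement k H)) := by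
    rw [flipR]
    generalize canonicalElement k H = t
    induction t with
    | zero => simp
    | add a b ha hb => simp only [map_add, ha, hb]
    | tmul p h => simp [Θ]
  have h2 : ∀ s : DualCop k H ⊗[k] DualCop k H,
      TensorProduct.map (ofDualCop k H).toLinearMap (ofDualCop k H).toLinearMap s =
        Θ (TensorProduct.map LinearMap.id (ofDualCop k H).toLinearMap s) := by
    intro s
    induction s with
    | zero => simp
    | add a b ha hb => simp only [map_add, ha, hb]
    | tmul p h => simp [Θ]
  rw [← TensorProduct.map_comm, h2, h2, h1, ← map_mul, ← map_mul]
  congr 1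
  apply evalLin.injective
  refine LinearMap.ext fun y => ?_
  rw [evalLin_mul, evalLin_mul, evalLin_map, evalLin_map, evalLin_map, evalLin_canonicalElement,
    LinearMap.comp_id]
  apply (dualTensorEquiv k H).symm.injective
  apply evalLin.injective
  refine LinearMap.ext fun x => ?_
  have h3 : ∀ s : H ⊗[k] H, evalLin ((dualTensorEquiv k H).symm (LinearMap.mul' k _
      (TensorProduct.map (ofH k H).toLinearMap ((ofDualCop k H).toLinearMap ∘ₗ
        evalLin (TensorProduct.comm k _ _ (comul (R := k) p))) s))) x =
      TensorProduct.rid k H (TensorProduct.map LinearMap.id (toDual k H p)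
        (sandwichMul x (contractInv k H (TensorProduct.map (comul₃ k H) LinearMap.id s)))) := by
    intro s
    induction s with
    | zero => simp
    | add a b ha hb => simp only [map_add, LinearMap.add_apply, ha, hb]
    | tmul a d =>
      rw [TensorProduct.map_tmul, TensorProduct.map_tmul, LinearMap.id_apply,
        ← map_mulLeft_sandwich, LinearMap.mul'_apply, LinearMap.comp_apply]
      refine (evalLin_ofH_mul_ofDualCop _ _ _).trans ?_
      generalize sandwich x (comul₃ k H a) = r
      induction r with
      | zero => simp
      | add a b ha hb => simp only [map_add, ha, hb]
      | tmul b c => simp [toDual_evalLin_comm, toDual_evalLin_comul]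
  have h4 : ∀ s : H ⊗[k] H, evalLin ((dualTensorEquiv k H).symm (LinearMap.mul' k _
      (TensorProduct.map ((ofDualCop k H).toLinearMap ∘ₗ
        evalLin (comul (R := k) p)) (ofH k H).toLinearMap s))) x =
      TensorProduct.rid k H (TensorProduct.map LinearMap.id (toDual k H p)
        (sandwichMul x (s ⊗ₜ 1))) := by
    intro s
    induction s with
    | zero => simp
    | add a b ha hb => simp only [map_add, TensorProduct.add_tmul, LinearMap.add_apply, ha, hb]
    | tmul a d =>
      rw [TensorProduct.map_tmul, LinearMap.mul'_apply, LinearMap.comp_apply,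
        AlgHom.toLinearMap_apply, AlgHom.toLinearMap_apply, ← dualTensorEquiv_tmul,
        LinearEquiv.symm_apply_apply]
      simp [toDual_evalLin_comul]
  rw [h3, h4, contractInv_comul]

/-- The elements satisfying the relation are closed under products, and D is spanned by products of
an element of H* with one of H; so the two generating cases suffice. The flipped form is proved
first and then transposed. -/
theorem universalR_mul_comul (x : DrinfeldDouble k H) :
    universalR k H * comul (R := k) x =
      TensorProduct.comm k _ _ (comul (R := k) x) * universalR k H := by
  have key : flipR k H * TensorProduct.comm k _ _ (comul (R := k) x) =
      comul (R := k) x * flipR k H := by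
    induction x using induction_on with
    | zero => simp
    | add x y hx hy => simp only [map_add, mul_add, add_mul, hx, hy]
    | mk p h =>
      have hp : flipR k H * TensorProduct.comm k _ _ (comul (R := k) (ofDual k H p)) =
        comul (R := k) (ofDual k H p) * flipR k H := flipR_mul_comm_comul_ofDualCop p
      rw [Bialgebra.comul_mul, tensorComm_mul, ← mul_assoc, hp, mul_assoc,
        flipR_mul_comm_comul_ofH, mul_assoc]
  have := congr(TensorProduct.comm k _ _ $key)
  rwa [tensorComm_mul, tensorComm_mul, ← universalR_eq, TensorProduct.comm_comm] at this

variable (k H) in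
theorem isUniversalR : IsUniversalR (universalR k H) where
  comul_left := comul_left_universalR
  comul_right := comul_right_universalR
  mul_comul := universalR_mul_comul
  counit_left := counit_left_universalR
  counit_right := counit_right_universalR
  map_antipode := map_antipode_universalR

theorem drinfeldZ_mem_center : drinfeldZ k H ∈ Subalgebra.center k (DrinfeldDouble k H) :=
  (isUniversalR k H).drinfeldU_mul_antipode_mem_center HopfAux.antipode_bijective.2

end DrinfeldDouble
end

/-! ### Determinants of diagonal actions on tensor products. -/

noncomputable section

namespace QuasiTriangular

attribute [local instance] HopfAux.zeroHomClass_linearMap HopfAux.zeroHomClass_linearEquiv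
  HopfAux.addHomClass_linearMap HopfAux.addHomClass_linearEquiv

section ActTensor

variable {k L W B C X X' : Type*} [Field k] [Field L] [Algebra k L] [AddCommGroup W] [Module k W]
  [Module L W] [IsScalarTower k L W] [Ring B] [Algebra k B] [Ring C] [Algebra k C]
  [AddCommGroup X] [Module k X] [AddCommGroup X'] [Module k X']

/-- The action of `B ⊗ C` on the tensor product of representations of `B` and `C`, the first of
which is linear over an extension field. -/
def actTensor (ρ : B →ₐ[k] Module.End L W) (σ : C →ₐ[k] Module.End k X) :
    B ⊗[k] C →ₐ[k] Module.End L (W ⊗[k] X) :=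
  Module.endTensorEndAlgHom.comp (Algebra.TensorProduct.map ρ σ)

@[simp] theorem actTensor_tmul_tmul (ρ : B →ₐ[k] Module.End L W) (σ : C →ₐ[k] Module.End k X)
    (b : B) (c : C) (w : W) (x : X) :
    actTensor ρ σ (b ⊗ₜ c) (w ⊗ₜ x) = ρ b w ⊗ₜ σ c x := rfl

theorem det_actTensor_tmul_one [FiniteDimensional L W] [FiniteDimensional k X]
    (ρ : B →ₐ[k] Module.End L W) (σ : C →ₐ[k] Module.End k X) (b : B) :
    LinearMap.det (actTensor ρ σ (b ⊗ₜ 1)) = LinearMap.det (ρ b) ^ Module.finrank k X := by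
  classical
  let v := Module.finBasis L W
  let c := Module.finBasis k X
  rw [← LinearMap.det_toMatrix (v.tensorProduct c), ← LinearMap.det_toMatrix v]
  have : LinearMap.toMatrix (v.tensorProduct c) (v.tensorProduct c) (actTensor ρ σ (b ⊗ₜ 1)) =
      Matrix.kroneckerMap (fun x y => x * y) (LinearMap.toMatrix v v (ρ b))
        (1 : Matrix (Fin (Module.finrank k X)) (Fin (Module.finrank k X)) L) := by
    ext ⟨i, i'⟩ ⟨j, j'⟩
    rw [LinearMap.toMatrix_apply, Module.Basis.tensorProduct_apply, actTensor_tmul_tmul, map_one,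
      Module.End.one_apply, Module.Basis.tensorProduct_repr_tmul_apply,
      Matrix.kroneckerMap_apply, LinearMap.toMatrix_apply, Module.Basis.repr_self,
      Finsupp.single_apply, Matrix.one_apply]
    by_cases h : i' = j'
    · simp [h]
    · simp [h, Ne.symm h]
  rw [this, Matrix.det_kronecker]
  simp

theorem det_actTensor_congr (ρ : B →ₐ[k] Module.End L W) (σ : C →ₐ[k] Module.End k X)
    (σ' : C →ₐ[k] Module.End k X') (e : X ≃ₗ[k] X') (h : ∀ c x, e (σ c x) = σ' c (e x))
    (t : B ⊗[k] C) :
    LinearMap.det (actTensor ρ σ t) = LinearMap.det (actTensor ρ σ' t) := by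
  let E : W ⊗[k] X ≃ₗ[L] W ⊗[k] X' :=
    TensorProduct.AlgebraTensorModule.congr (LinearEquiv.refl L W) e
  have h1 : ∀ y, E (actTensor ρ σ t y) = actTensor ρ σ' t (E y) := by
    intro y
    induction t with
    | zero => simp
    | add a b ha hb => simp only [map_add, LinearMap.add_apply, ha, hb]
    | tmul b c =>
      induction y with
      | zero => simp
      | add a b ha hb => simp only [map_add, ha, hb]
      | tmul w x => simp [E, h]
  rw [← LinearMap.det_conj (actTensor ρ σ t) E]
  congr 1
  refine LinearMap.ext fun y => ?_
  simp [h1]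

end ActTensor

section Twist

variable {k L W B C X : Type*} [Field k] [Field L] [Algebra k L] [AddCommGroup W] [Module k W]
  [Module L W] [IsScalarTower k L W] [Ring B] [HopfAlgebra k B]
  [Ring C] [Algebra k C] [AddCommGroup X] [Module k X]

/-- The orbit map `b ↦ ρ(b) w`. -/
def orbitMap (ρ : B →ₐ[k] Module.End L W) (w : W) : B →ₗ[k] W where
  toFun b := ρ b w
  map_add' a b := by simp
  map_smul' c b := by simp

@[simp] theorem orbitMap_apply (ρ : B →ₐ[k] Module.End L W) (w : W) (b : B) :
    orbitMap ρ w b = ρ b w := rfl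

/-- The map `w ⊗ x ↦ ∑ ρ(x₍₋₁₎) w ⊗ x₍₀₎` attached to `δ x = ∑ x₍₋₁₎ ⊗ x₍₀₎`. -/
def twist (ρ : B →ₐ[k] Module.End L W) (δ : X →ₗ[k] B ⊗[k] X) : Module.End L (W ⊗[k] X) :=
  TensorProduct.AlgebraTensorModule.lift
    { toFun := fun w => TensorProduct.map (orbitMap ρ w) LinearMap.id ∘ₗ δ
      map_add' := fun w w' => by
        have : orbitMap ρ (w + w') = orbitMap ρ w + orbitMap ρ w' := by ext; simp
        rw [this, TensorProduct.map_add_left, LinearMap.add_comp]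
      map_smul' := fun c w => by
        have h : ∀ t : B ⊗[k] X, TensorProduct.map (orbitMap ρ (c • w)) LinearMap.id t =
            c • TensorProduct.map (orbitMap ρ w) LinearMap.id t := by
          intro t
          induction t with
          | zero => simp
          | add a b ha hb => simp only [map_add, smul_add, ha, hb]
          | tmul b x => simp [TensorProduct.smul_tmul']
        ext x
        exact h (δ x) }

theorem twist_tmul (ρ : B →ₐ[k] Module.End L W) (δ : X →ₗ[k] B ⊗[k] X) (w : W) (x : X) :
    twist ρ δ (w ⊗ₜ x) = TensorProduct.map (orbitMap ρ w) LinearMap.id (δ x) := rfl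

/-- If the coaction δ is compatible with the action of C through Γ, then the twist intertwines 1 ⊗ c
with Γ(c). Once the twist is known to be invertible, the two have equal determinants. Below, Γ is Δ
or Δ ⊗ 1. -/
theorem actTensor_twist (ρ : B →ₐ[k] Module.End L W) (δ : X →ₗ[k] B ⊗[k] X)
    (σ : C →ₐ[k] Module.End k X) (Γ : C →ₗ[k] B ⊗[k] C)
    (h : ∀ c x, δ (σ c x) = actTensor (Algebra.lmul k B) σ (Γ c) (δ x)) (c : C) :
    actTensor ρ σ (Γ c) ∘ₗ twist ρ δ = twist ρ δ ∘ₗ actTensor ρ σ (1 ⊗ₜ c) := by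
  have h1 : ∀ (g : B ⊗[k] C) (y : B ⊗[k] X) (w : W),
      actTensor ρ σ g (TensorProduct.map (orbitMap ρ w) LinearMap.id y) =
        TensorProduct.map (orbitMap ρ w) LinearMap.id (actTensor (Algebra.lmul k B) σ g y) := by
    intro g y w
    induction g with
    | zero => simp
    | add a b ha hb => simp only [map_add, LinearMap.add_apply, ha, hb]
    | tmul b c =>
      induction y with
      | zero => simp
      | add a b ha hb => simp only [map_add, ha, hb]
      | tmul b' x => simp
  refine LinearMap.ext fun y => ?_
  induction y with
  | zero => simp
  | add a b ha hb => simp only [map_add, ha, hb]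
  | tmul w x =>
    simp only [LinearMap.comp_apply, actTensor_tmul_tmul, map_one, Module.End.one_apply]
    rw [twist_tmul, twist_tmul, h1, h]

/-- A left inverse is w ⊗ x ↦ ∑ S⁻¹(x₍₋₁₎)w ⊗ x₍₀₎, by coassociativity of δ and S⁻¹(b₍₂₎)b₍₁₎ =
ε(b). -/
theorem det_twist_ne_zero [FiniteDimensional k B] [FiniteDimensional L W] [FiniteDimensional k X]
    (ρ : B →ₐ[k] Module.End L W) (δ : X →ₗ[k] B ⊗[k] X)
    (hδ : ∀ x, TensorProduct.assoc k B B X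
      (TensorProduct.map (comul (R := k)) LinearMap.id (δ x)) =
        TensorProduct.map LinearMap.id δ (δ x))
    (hε : ∀ x, TensorProduct.lid k X (TensorProduct.map (counit (R := k)) LinearMap.id (δ x)) = x) :
    LinearMap.det (twist ρ δ) ≠ 0 := by
  let δ' : X →ₗ[k] B ⊗[k] X := TensorProduct.map (antipodeInv k B) LinearMap.id ∘ₗ δ
  let F : W → B ⊗[k] (B ⊗[k] X) →ₗ[k] W ⊗[k] X := fun w =>
    TensorProduct.map (orbitMap ρ w ∘ₗ LinearMap.mul' k B ∘ₗ (TensorProduct.comm k B B).toLinearMap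
      ∘ₗ TensorProduct.map LinearMap.id (antipodeInv k B)) LinearMap.id ∘ₗ
      (TensorProduct.assoc k B B X).symm.toLinearMap
  have h1 : ∀ (w : W) (t : B ⊗[k] X), twist ρ δ' (TensorProduct.map (orbitMap ρ w) LinearMap.id t) =
      F w (TensorProduct.map LinearMap.id δ t) := by
    intro w t
    induction t with
    | zero => simp
    | add a b ha hb => simp only [map_add, ha, hb]
    | tmul b x =>
      simp only [TensorProduct.map_tmul, LinearMap.id_apply, twist_tmul, orbitMap_apply, δ',
        LinearMap.comp_apply]
      generalize δ x = s
      induction s with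
      | zero => simp
      | add a b ha hb => simp only [map_add, TensorProduct.tmul_add, ha, hb]
      | tmul c y => simp [F]
  have h2 : ∀ (w : W) (t : B ⊗[k] X), F w (TensorProduct.assoc k B B X
      (TensorProduct.map (comul (R := k)) LinearMap.id t)) =
      w ⊗ₜ TensorProduct.lid k X (TensorProduct.map (counit (R := k)) LinearMap.id t) := by
    intro w t
    induction t with
    | zero => simp
    | add a b ha hb => simp only [map_add, TensorProduct.tmul_add, ha, hb]
    | tmul b x =>
      simp only [F, LinearMap.comp_apply, TensorProduct.map_tmul, LinearMap.id_apply,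
        LinearEquiv.coe_coe, LinearEquiv.symm_apply_apply, antipodeInv_mul_comul]
      simp [TensorProduct.smul_tmul]
  have h3 : twist ρ δ' ∘ₗ twist ρ δ = LinearMap.id := by
    refine LinearMap.ext fun y => ?_
    induction y with
    | zero => simp
    | add a b ha hb => simp only [map_add, ha, hb]
    | tmul w x => rw [LinearMap.comp_apply, twist_tmul, h1, ← hδ, h2, hε, LinearMap.id_apply]
  have h4 := congr(LinearMap.det $h3)
  rw [LinearMap.det_comp, LinearMap.det_id] at h4
  exact right_ne_zero_of_mul_eq_one h4

/-- The determinants of a diagonal action and of the action on the second factor agree. -/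
theorem det_actTensor_comul [FiniteDimensional k B] [FiniteDimensional L W]
    (ρ : B →ₐ[k] Module.End L W) (b : B) :
    LinearMap.det (actTensor ρ (Algebra.lmul k B) (comul (R := k) b)) =
      LinearMap.det (actTensor ρ (Algebra.lmul k B) (1 ⊗ₜ b)) := by
  have h1 := det_twist_ne_zero ρ (comul (R := k) (A := B))
    (fun x => coassoc_apply x) (fun x => by
      have := congr(TensorProduct.lid k B $(rTensor_counit_comul (R := k) x))
      simpa [LinearMap.rTensor_def] using this)
  have h2 := actTensor_twist ρ (comul (R := k) (A := B)) (Algebra.lmul k B) (comul (R := k))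
    (fun c x => by
      change comul (R := k) (c * x) = _
      rw [Bialgebra.comul_mul]
      generalize comul (R := k) c = s
      generalize comul (R := k) x = t
      induction s with
      | zero => simp
      | add a b ha hb => simp only [map_add, LinearMap.add_apply, add_mul, ha, hb]
      | tmul a b =>
        induction t with
        | zero => simp
        | add a b ha hb => simp only [map_add, mul_add, ha, hb]
        | tmul c d => simp) b
  have h3 := congr(LinearMap.det $h2)
  rw [LinearMap.det_comp, LinearMap.det_comp, mul_comm] at h3
  exact mul_left_cancel₀ h1 h3

/-- If `(Δ ⊗ 1) r = r₁₃ r₂₃` or `(Δ ⊗ 1) r = r₂₃ r₁₃`, then `r₁₃` has determinant `1`. -/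
theorem det_actTensor_leg₁₃ [FiniteDimensional k B] [FiniteDimensional L W] [FiniteDimensional k X]
    (ρ : B →ₐ[k] Module.End L W) (σ : C →ₐ[k] Module.End k X) {r : B ⊗[k] C} (hr : IsUnit r)
    (h : TensorProduct.assoc k B B C (TensorProduct.map (comul (R := k)) LinearMap.id r) =
        leg₁₃ k B B C r * leg₂₃ k B B C r ∨
      TensorProduct.assoc k B B C (TensorProduct.map (comul (R := k)) LinearMap.id r) =
        leg₂₃ k B B C r * leg₁₃ k B B C r) :
    LinearMap.det (actTensor ρ (actTensor (Algebra.lmul k B) σ) (leg₁₃ k B B C r)) = 1 := by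
  -- With the coaction Δ ⊗ 1 on B ⊗ X, the twist intertwines r₂₃ = 1 ⊗ r with (Δ ⊗ 1)r. Their
  -- determinants on W ⊗ B ⊗ X agree, and cancelling the nonzero determinant of r₂₃ leaves that of
  -- r₁₃. The order of the two factors is irrelevant for determinants.
  let δ : B ⊗[k] X →ₗ[k] B ⊗[k] (B ⊗[k] X) := (TensorProduct.assoc k B B X).toLinearMap ∘ₗ
    TensorProduct.map (comul (R := k)) LinearMap.id
  let Γ : B ⊗[k] C →ₗ[k] B ⊗[k] (B ⊗[k] C) := (TensorProduct.assoc k B B C).toLinearMap ∘ₗ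
    TensorProduct.map (comul (R := k)) LinearMap.id
  have h1 : LinearMap.det (twist ρ δ) ≠ 0 := by
    apply det_twist_ne_zero
    · intro y
      induction y with
      | zero => simp
      | add a b ha hb => simp only [map_add, ha, hb]
      | tmul b x =>
        have e1 := coassoc_apply (R := k) b
        simp only [LinearMap.lTensor_def, LinearMap.rTensor_def] at e1
        have e2 : ∀ s : B ⊗[k] B, TensorProduct.assoc k B B (B ⊗[k] X)
            (TensorProduct.map (comul (R := k)) LinearMap.id (TensorProduct.assoc k B B X (s ⊗ₜ x))) =
            TensorProduct.map LinearMap.id (TensorProduct.assoc k B B X).toLinearMap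
              (TensorProduct.assoc k B (B ⊗[k] B) X ((TensorProduct.assoc k B B B
              (TensorProduct.map (comul (R := k)) LinearMap.id s)) ⊗ₜ x)) := by
          intro s
          induction s with
          | zero => simp
          | add a b ha hb => simp only [map_add, TensorProduct.add_tmul, ha, hb]
          | tmul c d =>
            simp only [TensorProduct.assoc_tmul, TensorProduct.map_tmul, LinearMap.id_apply]
            generalize comul (R := k) c = t
            induction t with
            | zero => simp
            | add a b ha hb => simp only [map_add, TensorProduct.add_tmul, ha, hb]
            | tmul _ _ => simp
        have e3 : ∀ s : B ⊗[k] B, TensorProduct.map LinearMap.id δ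
            (TensorProduct.assoc k B B X (s ⊗ₜ x)) =
            TensorProduct.map LinearMap.id (TensorProduct.assoc k B B X).toLinearMap
              (TensorProduct.assoc k B (B ⊗[k] B) X
              ((TensorProduct.map LinearMap.id (comul (R := k)) s) ⊗ₜ x)) := by
          intro s
          induction s with
          | zero => simp
          | add a b ha hb => simp only [map_add, TensorProduct.add_tmul, ha, hb]
          | tmul c d => simp [δ]
        change TensorProduct.assoc k B B (B ⊗[k] X)
            (TensorProduct.map (comul (R := k)) LinearMap.id
              (TensorProduct.assoc k B B X (comul (R := k) b ⊗ₜ x))) =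
            TensorProduct.map LinearMap.id δ (TensorProduct.assoc k B B X (comul (R := k) b ⊗ₜ x))
        rw [e2, e3, e1]
    · intro y
      induction y with
      | zero => simp
      | add a b ha hb => simp only [map_add, ha, hb]
      | tmul b x =>
        have e1 := congr(TensorProduct.lid k B $(rTensor_counit_comul (R := k) b))
        simp only [LinearMap.rTensor_def, TensorProduct.lid_tmul, one_smul] at e1
        have e2 : ∀ s : B ⊗[k] B, TensorProduct.lid k (B ⊗[k] X)
            (TensorProduct.map (counit (R := k)) LinearMap.id
              (TensorProduct.assoc k B B X (s ⊗ₜ x))) =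
            TensorProduct.lid k B (TensorProduct.map (counit (R := k)) LinearMap.id s) ⊗ₜ x := by
          intro s
          induction s with
          | zero => simp
          | add a b ha hb => simp only [map_add, TensorProduct.add_tmul, ha, hb]
          | tmul c d => simp [TensorProduct.smul_tmul']
        exact (e2 _).trans (by rw [e1])
  have h2 := actTensor_twist ρ δ (actTensor (Algebra.lmul k B) σ) Γ (fun c x => by
    induction c with
    | zero => simp
    | add a b ha hb => simp only [map_add, LinearMap.add_apply, ha, hb]
    | tmul b c =>
      induction x with
      | zero => simp
      | add a b ha hb => simp only [map_add, ha, hb]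
      | tmul b' x =>
        change TensorProduct.assoc k B B X (comul (R := k) (b * b') ⊗ₜ σ c x) =
          actTensor (Algebra.lmul k B) (actTensor (Algebra.lmul k B) σ)
            (TensorProduct.assoc k B B C (comul (R := k) b ⊗ₜ c))
            (TensorProduct.assoc k B B X (comul (R := k) b' ⊗ₜ x))
        rw [Bialgebra.comul_mul]
        generalize comul (R := k) b = s
        generalize comul (R := k) b' = t
        induction s with
        | zero => simp
        | add a b ha hb =>
          simp only [map_add, TensorProduct.add_tmul, LinearMap.add_apply, add_mul, ha, hb]
        | tmul a b =>
          induction t with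
          | zero => simp
          | add a b ha hb => simp only [map_add, TensorProduct.add_tmul, mul_add, ha, hb]
          | tmul c d => simp) r
  have h3 := congr(LinearMap.det $h2)
  rw [LinearMap.det_comp, LinearMap.det_comp, mul_comm] at h3
  have h4 := mul_left_cancel₀ h1 h3
  have h5 : (1 : B) ⊗ₜ[k] r = leg₂₃ k B B C r := rfl
  have h6 : LinearMap.det (actTensor ρ (actTensor (Algebra.lmul k B) σ) (leg₂₃ k B B C r)) ≠ 0 :=
    (((hr.map (leg₂₃ k B B C)).map (actTensor ρ (actTensor (Algebra.lmul k B) σ))).map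
      LinearMap.det).ne_zero
  have h7 : Γ r = TensorProduct.assoc k B B C (TensorProduct.map (comul (R := k)) LinearMap.id r) :=
    rfl
  rw [h5, h7] at h4
  rcases h with h | h
  · rw [h, map_mul, map_mul] at h4
    exact mul_right_cancel₀ h6 (h4.trans (one_mul _).symm)
  · rw [h, map_mul, map_mul] at h4
    exact mul_left_cancel₀ h6 (h4.trans (mul_one _).symm)

end Twist

end QuasiTriangular
end

/-! ### Determinants of R, of u and of z on representations of the double. -/

noncomputable section

namespace QuasiTriangular

attribute [local instance] HopfAux.zeroHomClass_linearMap HopfAux.zeroHomClass_linearEquiv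
  HopfAux.addHomClass_linearMap HopfAux.addHomClass_linearEquiv

theorem actTensor_map {k L W B C B' C' X : Type*} [Field k] [Field L] [Algebra k L] [AddCommGroup W]
    [Module k W] [Module L W] [IsScalarTower k L W] [Ring B] [Algebra k B] [Ring C] [Algebra k C]
    [Ring B'] [Algebra k B'] [Ring C'] [Algebra k C'] [AddCommGroup X] [Module k X]
    (ρ : B' →ₐ[k] Module.End L W) (σ : C' →ₐ[k] Module.End k X) (i : B →ₐ[k] B') (j : C →ₐ[k] C')
    (r : B ⊗[k] C) :
    actTensor ρ σ (Algebra.TensorProduct.map i j r) = actTensor (ρ.comp i) (σ.comp j) r := by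
  induction r with
  | zero => simp
  | add a b ha hb => simp only [map_add, ha, hb]
  | tmul b c => rfl

/-- If `D` is, as a left `C`-module, isomorphic to `B ⊗ C`, and `(Δ ⊗ 1) r` is `r₁₃ r₂₃` or
`r₂₃ r₁₃`, then the image of `r` in `D ⊗ D` has determinant `1`. -/
theorem det_actTensor_map {k L W B C D : Type*} [Field k] [Field L] [Algebra k L] [AddCommGroup W]
    [Module k W] [Module L W] [IsScalarTower k L W] [Ring B] [HopfAlgebra k B] [Ring C]
    [Algebra k C] [Ring D] [Algebra k D] [FiniteDimensional k B] [FiniteDimensional k C]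
    [FiniteDimensional L W] (ρ : D →ₐ[k] Module.End L W) (i : B →ₐ[k] D) (j : C →ₐ[k] D)
    (e : D ≃ₗ[k] B ⊗[k] C)
    (he : ∀ c x, e (j c * x) = actTensor (Algebra.lmul k B) (Algebra.lmul k C) (1 ⊗ₜ c) (e x))
    {r : B ⊗[k] C} (hr : IsUnit r)
    (h : TensorProduct.assoc k B B C (TensorProduct.map (comul (R := k)) LinearMap.id r) =
        leg₁₃ k B B C r * leg₂₃ k B B C r ∨
      TensorProduct.assoc k B B C (TensorProduct.map (comul (R := k)) LinearMap.id r) =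
        leg₂₃ k B B C r * leg₁₃ k B B C r) :
    LinearMap.det (actTensor ρ (Algebra.lmul k D) (Algebra.TensorProduct.map i j r)) = 1 := by
  -- After identifying D with B ⊗ C, the second leg of r acts on the factor C only. So r acts on W ⊗
  -- D exactly as r₁₃ acts on W ⊗ B ⊗ C.
  let σ' : C →ₐ[k] Module.End k (B ⊗[k] C) :=
    (actTensor (Algebra.lmul k B) (Algebra.lmul k C)).comp Algebra.TensorProduct.includeRight
  rw [actTensor_map, det_actTensor_congr (ρ.comp i) ((Algebra.lmul k D).comp j) σ' e he,
    ← det_actTensor_leg₁₃ (ρ.comp i) (Algebra.lmul k C) hr h]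
  congr 1
  clear h hr
  induction r with
  | zero => simp only [map_zero]
  | add a b ha hb => simp only [map_add, ha, hb]
  | tmul b c => rfl

end QuasiTriangular

namespace DrinfeldDouble

set_option linter.unusedSectionVars false

attribute [local instance] HopfAux.zeroHomClass_linearMap HopfAux.zeroHomClass_linearEquiv
  HopfAux.addHomClass_linearMap HopfAux.addHomClass_linearEquiv

open QuasiTriangular DualCop
variable {k : Type u} {H : Type v} [Field k] [Ring H] [HopfAlgebra k H] [FiniteDimensional k H]

variable (k H) in
instance : FiniteDimensional k (DrinfeldDouble k H) := Module.Finite.equiv (dualTensorEquiv k H)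

variable (k H) in
theorem finrank_dualCop : Module.finrank k (DualCop k H) = Module.finrank k H :=
  (toDual k H).finrank_eq.trans (Subspace.dual_finrank_eq (K := k) (V := H))

variable (k H) in
theorem finrank_eq : Module.finrank k (DrinfeldDouble k H) = Module.finrank k H ^ 2 := by
  rw [← (dualTensorEquiv k H).finrank_eq, Module.finrank_tensorProduct, finrank_dualCop, sq]

theorem universalR_eq_map : universalR k H = Algebra.TensorProduct.map (ofH k H) (ofDualCop k H)
    (TensorProduct.comm k _ _ (canonicalElement k H)) := by
  rw [universalR_eq, flipR]
  generalize canonicalElement k H = t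
  induction t with
  | zero => simp
  | add a b ha hb => simp only [map_add, ha, hb]
  | tmul b c => simp

theorem comul_comm_canonicalElement :
    TensorProduct.assoc k H H (DualCop k H) (TensorProduct.map (comul (R := k)) LinearMap.id
      (TensorProduct.comm k _ _ (canonicalElement k H))) =
      leg₁₃ k H H (DualCop k H) (TensorProduct.comm k _ _ (canonicalElement k H)) *
        leg₂₃ k H H (DualCop k H) (TensorProduct.comm k _ _ (canonicalElement k H)) := by
  let φ : DualCop k H ⊗[k] (H ⊗[k] H) →ₐ[k] H ⊗[k] (H ⊗[k] DualCop k H) :=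
    (Algebra.TensorProduct.assoc k k k H H (DualCop k H)).toAlgHom.comp
      (Algebra.TensorProduct.comm k (DualCop k H) (H ⊗[k] H)).toAlgHom
  have h := congr(φ $(map_comul_canonicalElement (k := k) (H := H)))
  rw [map_mul] at h
  have h1 : ∀ t, φ (leg₁₂ k (DualCop k H) H H t) =
      leg₁₃ k H H (DualCop k H) (TensorProduct.comm k _ _ t) := by
    intro t
    induction t with
    | zero => simp
    | add a b ha hb => simp only [map_add, ha, hb]
    | tmul b c => rfl
  have h2 : ∀ t, φ (leg₁₃ k (DualCop k H) H H t) =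
      leg₂₃ k H H (DualCop k H) (TensorProduct.comm k _ _ t) := by
    intro t
    induction t with
    | zero => simp
    | add a b ha hb => simp only [map_add, ha, hb]
    | tmul b c => rfl
  have h3 : ∀ t, φ (TensorProduct.map LinearMap.id (comul (R := k)) t) =
      TensorProduct.assoc k H H (DualCop k H) (TensorProduct.map (comul (R := k)) LinearMap.id
      (TensorProduct.comm k _ _ t)) := by
    intro t
    induction t with
    | zero => simp
    | add a b ha hb => simp only [map_add, ha, hb]
    | tmul b c => rfl
  rwa [h1, h2, h3] at h

theorem isUnit_comm_canonicalElement :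
    IsUnit (TensorProduct.comm k _ _ (canonicalElement k H) : H ⊗[k] DualCop k H) := by
  refine isUnit_of_comul comul_comm_canonicalElement ?_
  rw [← rid_counit_canonicalElement (k := k) (H := H)]
  generalize canonicalElement k H = t
  induction t with
  | zero => simp
  | add a b ha hb => simp only [map_add, ha, hb]
  | tmul b c => simp

theorem isUnit_canonicalElement : IsUnit (canonicalElement k H) := by
  have h := (isUnit_comm_canonicalElement (k := k) (H := H)).map
    (Algebra.TensorProduct.comm k H (DualCop k H))
  rwa [show Algebra.TensorProduct.comm k H (DualCop k H)
    (TensorProduct.comm k _ _ (canonicalElement k H)) = canonicalElement k H from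
      (TensorProduct.comm k _ _).symm_apply_apply _] at h

variable (k H) in
/-- The identification of the double with `H* ⊗ H` by `p ⊗ h ↦ h p`. -/
def dualTensorEquivRev : DualCop k H ⊗[k] H ≃ₗ[k] DrinfeldDouble k H :=
  LinearEquiv.ofBijective (LinearMap.mul' k _ ∘ₗ (TensorProduct.comm k _ _).toLinearMap ∘ₗ
    TensorProduct.map (ofDualCop k H).toLinearMap (ofH k H).toLinearMap) (by
    -- Since S(ph) = S(h)S(p) and S is surjective on D, the products hp span D because the products
    -- ph do. Injectivity follows by counting dimensions.
    have hs : Function.Surjective (LinearMap.mul' k _ ∘ₗ (TensorProduct.comm k _ _).toLinearMap ∘ₗ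
        TensorProduct.map (ofDualCop k H).toLinearMap (ofH k H).toLinearMap) := by
      intro x
      obtain ⟨y, rfl⟩ := (HopfAux.antipode_bijective (k := k) (H := DrinfeldDouble k H)).2 x
      obtain ⟨t, rfl⟩ := (dualTensorEquiv k H).surjective y
      refine ⟨TensorProduct.map (antipode k) (antipode k) t, ?_⟩
      induction t with
      | zero => simp
      | add a b ha hb => simp only [map_add, ha, hb]
      | tmul p h =>
        rw [dualTensorEquiv_tmul, HopfAlgebra.antipode_mul_antidistrib, antipode_ofH,
          antipode_ofDualCop]
        simp
    exact ⟨(LinearMap.injective_iff_surjective_of_finrank_eq_finrank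
      (dualTensorEquiv k H).finrank_eq).2 hs, hs⟩)

theorem dualTensorEquivRev_tmul (p : DualCop k H) (h : H) :
    dualTensorEquivRev k H (p ⊗ₜ h) = ofH k H h * ofDualCop k H p := rfl

section Det

variable {L W : Type*} [Field L] [Algebra k L] [AddCommGroup W] [Module k W]
  [Module L W] [IsScalarTower k L W] [FiniteDimensional L W]
  (ρ : DrinfeldDouble k H →ₐ[k] Module.End L W)

/-- The second leg of R lies in H*, so D is used as a free left H*-module, through p ⊗ h ↦ ph. -/
theorem det_actTensor_universalR :
    LinearMap.det (actTensor ρ (Algebra.lmul k (DrinfeldDouble k H)) (universalR k H)) = 1 := by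
  rw [universalR_eq_map]
  refine det_actTensor_map ρ _ _ ((dualTensorEquiv k H).symm ≪≫ₗ TensorProduct.comm k _ _) ?_
    isUnit_comm_canonicalElement (.inl comul_comm_canonicalElement)
  intro c x
  obtain ⟨t, rfl⟩ := (dualTensorEquiv k H).surjective x
  induction t with
  | zero => simp
  | add a b ha hb => simp only [map_add, mul_add, ha, hb]
  | tmul p h =>
    have : ofDualCop k H c * dualTensorEquiv k H (p ⊗ₜ h) = dualTensorEquiv k H ((c * p) ⊗ₜ h) := by
      rw [dualTensorEquiv_tmul, dualTensorEquiv_tmul, map_mul, mul_assoc]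
    rw [this]
    simp

/-- The second leg now lies in H, so D is used as a free left H-module, which requires the reversed
factorization p ⊗ h ↦ hp. -/
theorem det_actTensor_flipR :
    LinearMap.det (actTensor ρ (Algebra.lmul k (DrinfeldDouble k H)) (flipR k H)) = 1 := by
  rw [flipR]
  refine det_actTensor_map ρ _ _ (dualTensorEquivRev k H).symm ?_
    isUnit_canonicalElement (.inr map_dualComul_canonicalElement)
  intro c x
  obtain ⟨t, rfl⟩ := (dualTensorEquivRev k H).surjective x
  induction t with
  | zero => simp
  | add a b ha hb => simp only [map_add, mul_add, ha, hb]
  | tmul p h =>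
    have : ofH k H c * dualTensorEquivRev k H (p ⊗ₜ h) =
        dualTensorEquivRev k H (p ⊗ₜ (c * h)) := by
      rw [dualTensorEquivRev_tmul, dualTensorEquivRev_tmul, map_mul, mul_assoc]
    rw [this]
    simp

/-- On W ⊗ D the elements R and R₂₁ have determinant 1, and Δ(a) has the determinant of 1 ⊗ a. So a
⊗ a and 1 ⊗ a have the same determinant, and that of a ⊗ 1, namely det_W(a) raised to the power dim
D = d², equals 1. The two alternatives are those satisfied by u and by S(u). -/
theorem det_pow_eq_one {a : DrinfeldDouble k H} (ha : IsUnit a)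
    (h : comul (R := k) a * (flipR k H * universalR k H) = a ⊗ₜ a ∨
      flipR k H * universalR k H * comul (R := k) a = a ⊗ₜ a) :
    LinearMap.det (ρ a) ^ Module.finrank k H ^ 2 = 1 := by
  let T := actTensor ρ (Algebra.lmul k (DrinfeldDouble k H))
  have h0 : LinearMap.det (T (1 ⊗ₜ a)) ≠ 0 :=
    (((ha.map (Algebra.TensorProduct.includeRight :
      DrinfeldDouble k H →ₐ[k] DrinfeldDouble k H ⊗[k] DrinfeldDouble k H)).map T).map
        LinearMap.det).ne_zero
  have h1 : LinearMap.det (T (comul (R := k) a)) = LinearMap.det (T (1 ⊗ₜ a)) :=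
    det_actTensor_comul ρ a
  have h2 : LinearMap.det (T (a ⊗ₜ 1)) = _ := det_actTensor_tmul_one ρ _ a
  have h3 : a ⊗ₜ[k] a = a ⊗ₜ 1 * 1 ⊗ₜ a := by simp
  have h4 : LinearMap.det (T (a ⊗ₜ a)) = LinearMap.det (T (1 ⊗ₜ a)) := by
    rcases h with h | h
    · rw [← h, map_mul, map_mul, map_mul, map_mul, h1, det_actTensor_flipR,
        det_actTensor_universalR, mul_one, mul_one]
    · rw [← h, map_mul, map_mul, map_mul, map_mul, h1, det_actTensor_flipR,
        det_actTensor_universalR, one_mul, one_mul]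
  rw [h3, map_mul, map_mul, h2, finrank_eq] at h4
  exact mul_right_cancel₀ h0 (h4.trans (one_mul _).symm)

theorem isUnit_drinfeldElement : IsUnit (drinfeldElement k H) :=
  (isUniversalR k H).isUnit_drinfeldU

theorem isUnit_antipode {A : Type*} [Ring A] [HopfAlgebra k A] {a : A} (ha : IsUnit a) :
    IsUnit (antipode k a) := by
  obtain ⟨u, rfl⟩ := ha
  exact ⟨⟨antipode k (u : A), antipode k ((u⁻¹ : Aˣ) : A),
    by rw [← HopfAlgebra.antipode_mul_antidistrib, Units.inv_mul, antipode_one],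
    by rw [← HopfAlgebra.antipode_mul_antidistrib, Units.mul_inv, antipode_one]⟩, rfl⟩

/-- The element `z` has determinant a `d²`-th root of unity on every representation. -/
theorem det_drinfeldZ_pow : LinearMap.det (ρ (drinfeldZ k H)) ^ Module.finrank k H ^ 2 = 1 := by
  have h1 := (isUniversalR k H).comul_drinfeldU_mul
  have h2 := (isUniversalR k H).comm_mul_self_mul_comul_antipode_drinfeldU
  rw [comm_universalR] at h1 h2
  have hu : IsUnit (drinfeldElement k H) := isUnit_drinfeldElement
  have e1 := det_pow_eq_one ρ hu (.inl h1)
  have e2 := det_pow_eq_one ρ (isUnit_antipode hu) (.inr h2)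
  rw [drinfeldZ, map_mul, map_mul, mul_pow, e1, e2, one_mul]

end Det

end DrinfeldDouble
end

/-! ### Orders of group-like elements up to nilpotents. -/

noncomputable section

namespace QuasiTriangular

open Polynomial in
/-- A finite family of nonzero scalars whose products are, up to order, `n` copies of the family
of length `n` consists of `n`-th roots of unity. -/
theorem pow_card_eq_one_of_prod_eq {k ι : Type*} [Field k] [Infinite k] [Fintype ι] (γ : ι → k)
    (hγ : ∀ i, γ i ≠ 0)
    (h : ∀ c : k, ∏ p : ι × ι, (c - γ p.1 * γ p.2) = ∏ p : ι × ι, (c - γ p.2)) (i : ι) :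
    γ i ^ Fintype.card ι = 1 := by
  classical
  have h1 : ((Finset.univ : Finset (ι × ι)).val.map fun p => γ p.1 * γ p.2) =
      (Finset.univ : Finset (ι × ι)).val.map fun p => γ p.2 := by
    have e : (∏ p : ι × ι, (X - C (γ p.1 * γ p.2))) = ∏ p : ι × ι, (X - C (γ p.2)) := by
      refine Polynomial.funext fun c => ?_
      simpa [eval_prod] using h c
    have e' := congr(Polynomial.roots $e)
    have hr : ∀ f : ι × ι → k, (∏ p, (X - C (f p))).roots = Finset.univ.val.map f := by
      intro f
      rw [← roots_multiset_prod_X_sub_C (Finset.univ.val.map f), Multiset.map_map]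
      rfl
    rwa [hr, hr] at e'
  -- Multiplicity of c in the family. The proof shows that the family, as a multiset, is invariant
  -- under multiplication by each of its members.
  let m : k → ℕ := fun c => (Finset.univ.filter fun j => γ j = c).card
  have hmpos : ∀ c, 0 < m c ↔ ∃ j, γ j = c := by
    intro c
    simp [m, Finset.card_pos, Finset.filter_nonempty_iff]
  -- The average of the multiplicities of the quotients c/γᵢ is the multiplicity of c. At a value of
  -- maximal multiplicity every quotient must therefore again be maximal.
  have h2 : ∀ c, ∑ i, m (c / γ i) = Fintype.card ι * m c := by
    intro c
    have e := congr(Multiset.count c $h1)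
    rw [Multiset.count_map, Multiset.count_map] at e
    change (Finset.univ.filter fun p : ι × ι => c = γ p.1 * γ p.2).card =
      (Finset.univ.filter fun p : ι × ι => c = γ p.2).card at e
    rw [Finset.card_filter, Finset.card_filter, Fintype.sum_prod_type, Fintype.sum_prod_type] at e
    have e1 : ∀ i, m (c / γ i) = ∑ j, if c = γ i * γ j then 1 else 0 := by
      intro i
      simp only [m, Finset.card_filter]
      refine Finset.sum_congr rfl fun j _ => ?_
      simp only [eq_div_iff (hγ i), mul_comm (γ j), eq_comm (a := c)]
    have e2 : m c = ∑ j, if c = γ j then 1 else 0 := by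
      simp only [m, Finset.card_filter, eq_comm (a := c)]
    simp only [e1, e2]
    refine e.trans ?_
    change ∑ _i : ι, (∑ j, if c = γ j then 1 else 0) = _
    rw [Finset.sum_const, Finset.card_univ, smul_eq_mul]
  obtain ⟨j₀, -, hj₀⟩ := Finset.exists_max_image Finset.univ (fun j => m (γ j)) ⟨i, Finset.mem_univ i⟩
  have hmax : ∀ c, m c ≤ m (γ j₀) := by
    intro c
    by_cases hc : 0 < m c
    · obtain ⟨j, rfl⟩ := (hmpos c).1 hc
      exact hj₀ j (Finset.mem_univ j)
    · omega
  have h3 : ∀ c, m c = m (γ j₀) → ∀ i, m (c / γ i) = m (γ j₀) := by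
    intro c hc i
    have := (Finset.sum_eq_sum_iff_of_le (s := Finset.univ) (f := fun i => m (c / γ i))
      (g := fun _ => m (γ j₀)) fun i _ => hmax _).1 (by rw [h2, hc]; simp)
    exact this i (Finset.mem_univ i)
  have hpos : 0 < m (γ j₀) := (hmpos _).2 ⟨j₀, rfl⟩
  -- The quotient γ_{j₀}/γᵢ has maximal, hence positive, multiplicity, so it is some γⱼ. Then γᵢ =
  -- γ_{j₀}/γⱼ is maximal as well.
  have h4 : ∀ i, m (γ i) = m (γ j₀) := by
    intro i
    have e := h3 _ rfl i
    obtain ⟨j, hj⟩ := (hmpos _).1 (e ▸ hpos)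
    have e' := h3 _ rfl j
    rw [hj] at e'
    rwa [div_div_cancel₀ (hγ _)] at e'
  -- Values in the family all have the same multiplicity, so only the support matters. It contains 1
  -- and inverses by `h3`, hence c/γᵢ in the support forces c to be in it.
  have h5 : ∀ c, m (c / γ i) = m c := by
    intro c
    by_cases hc : 0 < m c
    · obtain ⟨j, rfl⟩ := (hmpos c).1 hc
      rw [h3 _ (h4 j), h4 j]
    · by_cases hc' : 0 < m (c / γ i)
      · obtain ⟨j, hj⟩ := (hmpos _).1 hc'
        have h6 : 0 < m (1 / γ i) := by
          have e := h3 _ (h4 i) i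
          rw [div_self (hγ i)] at e
          obtain ⟨j₁, hj₁⟩ := (hmpos 1).1 (e ▸ hpos)
          rw [← hj₁, h3 _ (h4 j₁)]
          exact hpos
        obtain ⟨l, hl⟩ := (hmpos _).1 h6
        have h7 := h3 _ (h4 j) l
        rw [hj, hl, div_div_eq_mul_div, div_one, div_mul_cancel₀ _ (hγ i)] at h7
        omega
      · omega
  have h8 : (Finset.univ.val.map fun j => γ i * γ j) = Finset.univ.val.map γ := by
    ext c
    have e1 : Multiset.count c (Finset.univ.val.map γ) = m c := by
      rw [Multiset.count_map]
      change (Finset.univ.filter fun j => c = γ j).card = _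
      simp only [m, eq_comm (a := c)]
    have e2 : Multiset.count c (Finset.univ.val.map fun j => γ i * γ j) = m (c / γ i) := by
      rw [Multiset.count_map]
      change (Finset.univ.filter fun j => c = γ i * γ j).card = _
      simp only [m, eq_div_iff (hγ i), mul_comm (γ i), eq_comm (a := c)]
    rw [e1, e2, h5]
  -- Comparing the products of the two equal multisets gives γᵢ to the power of the cardinality
  -- times a nonzero number on one side, and that number on the other.
  have h9 : ∏ j, (γ i * γ j) = ∏ j, γ j := congr(Multiset.prod $h8)
  rw [Finset.prod_mul_distrib, Finset.prod_const, Finset.card_univ] at h9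
  exact mul_right_cancel₀ (Finset.prod_ne_zero_iff.2 fun j _ => hγ j) (h9.trans (one_mul _).symm)

section GroupLike

variable {k A : Type*} [Field k] [Ring A] [HopfAlgebra k A] [FiniteDimensional k A]

/-- Group-like elements are linearly independent, so in finite dimension they form a finite group.
-/
theorem exists_pow_eq_one_of_isGroupLikeElem {g : A} (hg : IsGroupLikeElem k g) :
    ∃ m, 0 < m ∧ g ^ m = 1 := by
  have : Finite (GroupLike k A) := (linearIndep_groupLikeVal (R := k) (A := A)).finite
  obtain ⟨m, hm, h⟩ := isOfFinOrder_iff_pow_eq_one.1 (isOfFinOrder_of_finite (⟨g, hg⟩ : GroupLike k A))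
  exact ⟨m, hm, congr(GroupLike.val $h)⟩

/-- Let γᵢ be the eigenvalues, with multiplicity, of left multiplication by g. On A ⊗ A the element
Δ(c - g) = c - g ⊗ g has the determinant of 1 ⊗ (c - g). As c varies this equates the products γᵢγⱼ
with dim A copies of the family, so `pow_card_eq_one_of_prod_eq` applies. -/
theorem pow_finrank_eq_one_of_isSemisimple [IsAlgClosed k] {g : A} (hg : IsGroupLikeElem k g)
    (hs : (Algebra.lmul k A g).IsSemisimple) : g ^ Module.finrank k A = 1 := by
  classical
  let f := Algebra.lmul k A g
  let eigenDecomp := DirectSum.isInternal_submodule_of_iSupIndep_of_iSup_eq_top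
    f.eigenspaces_iSupIndep hs.iSup_eigenspace_eq_top
  let I := (ν : k) × Fin (Module.finrank k (f.eigenspace ν))
  let v : Module.Basis I k A := eigenDecomp.collectedBasis fun μ => Module.finBasis k (f.eigenspace μ)
  have : Fintype I := FiniteDimensional.fintypeBasisIndex v
  let γ : I → k := Sigma.fst
  have hv (i : I) : g * v i = γ i • v i :=
    Module.End.mem_eigenspace_iff.mp (eigenDecomp.collectedBasis_mem _ i)
  have hγ : ∀ i, γ i ≠ 0 := by
    intro i h
    have := hv i
    rw [h, zero_smul] at this
    exact v.ne_zero i (hg.isUnit.mul_right_eq_zero.1 this)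
  have hdet : ∀ (F : Module.End k (A ⊗[k] A)) (d : I × I → k),
      (∀ p, F (v p.1 ⊗ₜ v p.2) = d p • (v p.1 ⊗ₜ v p.2)) → LinearMap.det F = ∏ p, d p := by
    intro F d hF
    rw [← LinearMap.det_toMatrix (v.tensorProduct v), ← Matrix.det_diagonal]
    congr 1
    ext p q
    rw [LinearMap.toMatrix_apply, Module.Basis.tensorProduct_apply', hF,
      ← Module.Basis.tensorProduct_apply', map_smul, Module.Basis.repr_self, Finsupp.smul_single,
      Finsupp.single_apply, Matrix.diagonal_apply]
    by_cases h : p = q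
    · simp [h]
    · simp [h, Ne.symm h]
  have h1 : ∀ c : k, ∏ p : I × I, (c - γ p.1 * γ p.2) = ∏ p : I × I, (c - γ p.2) := by
    intro c
    have e := det_actTensor_comul (Algebra.lmul k A) (c • 1 - g)
    rw [hdet _ (fun p => c - γ p.1 * γ p.2), hdet _ (fun p => c - γ p.2)] at e
    · exact e
    · intro p
      have : Algebra.lmul k A (c • 1 - g) (v p.2) = (c - γ p.2) • v p.2 := by
        change (c • 1 - g) * v p.2 = _
        rw [sub_mul, smul_mul_assoc, one_mul, hv, ← sub_smul]
      rw [actTensor_tmul_tmul, map_one, Module.End.one_apply, this, TensorProduct.tmul_smul]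
    · intro p
      rw [map_sub, map_smul, Bialgebra.comul_one, hg.comul_eq_tmul_self, map_sub, map_smul, map_one,
        LinearMap.sub_apply, LinearMap.smul_apply, Module.End.one_apply, actTensor_tmul_tmul]
      have : ∀ i, Algebra.lmul k A g (v i) = γ i • v i := hv
      rw [this, this, TensorProduct.tmul_smul, ← TensorProduct.smul_tmul', smul_smul, sub_smul,
        mul_comm (γ p.1)]
  have h2 := pow_card_eq_one_of_prod_eq γ hγ h1
  rw [← Module.finrank_eq_card_basis v] at h2
  have h3 : ∀ (n : ℕ) i, g ^ n * v i = γ i ^ n • v i := by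
    intro n i
    induction n with
    | zero => simp
    | succ n ih => rw [pow_succ, mul_assoc, hv, mul_smul_comm, ih, smul_smul, pow_succ']
  have h4 : LinearMap.mulLeft k (g ^ Module.finrank k A) = LinearMap.id :=
    v.ext fun i => by simp [h3, h2]
  simpa using congr($h4 1)

/-- A suitable power of g with exponent pᵉ, p the characteristic exponent, is semisimple, so the
semisimple case gives (gⁿ)^(pᵉ) = 1. As Frobenius is additive on commuting elements, gⁿ - 1 is
nilpotent. -/
theorem isNilpotent_pow_finrank_sub_one_of_isAlgClosed [IsAlgClosed k] {g : A}
    (hg : IsGroupLikeElem k g) : IsNilpotent (g ^ Module.finrank k A - 1) := by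
  obtain ⟨m, hm, hgm⟩ := exists_pow_eq_one_of_isGroupLikeElem hg
  obtain ⟨p, hp⟩ := ExpChar.exists k
  have hε : Function.Injective (algebraMap k A) := by
    intro x y hxy
    simpa using congr(counit (R := k) $hxy)
  have : ExpChar A p := expChar_of_injective_algebraMap hε p
  obtain ⟨e, m', hm', rfl⟩ : ∃ e m' : ℕ, (m' : k) ≠ 0 ∧ m = p ^ e * m' := by
    cases hp with
    -- In characteristic zero the characteristic exponent is 1, and g itself is semisimple.
    | zero => exact ⟨0, m, Nat.cast_ne_zero.2 hm.ne', by simp⟩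
    | prime hp =>
      obtain ⟨e, m', h1, h2⟩ := Nat.exists_eq_pow_mul_and_not_dvd hm.ne' p hp.ne_one
      exact ⟨e, m', fun h => h1 ((CharP.cast_eq_zero_iff k p m').1 h), h2⟩
  -- The operator is a root of X^m' - 1, which is separable because m' is nonzero in k.
  have hs : (Algebra.lmul k A (g ^ p ^ e)).IsSemisimple := by
    refine Module.End.isSemisimple_of_squarefree_aeval_eq_zero (p := Polynomial.X ^ m' - 1)
      ?_ ?_
    · simpa using (Polynomial.separable_X_pow_sub_C (1 : k) hm' one_ne_zero).squarefree
    · rw [map_sub, map_pow, Polynomial.aeval_X, map_one, ← map_pow, ← pow_mul, hgm, map_one, sub_self]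
  refine ⟨p ^ e, ?_⟩
  rw [sub_pow_expChar_pow_of_commute _ _ (Commute.one_right _), one_pow, ← pow_mul, mul_comm, pow_mul,
    pow_finrank_eq_one_of_isSemisimple hg.pow hs, sub_self]

/-- A group-like element of a Hopf algebra of dimension `n` satisfies `g ^ n = 1` up to a nilpotent
element. -/
theorem isNilpotent_pow_finrank_sub_one {g : A} (hg : IsGroupLikeElem k g) :
    IsNilpotent (g ^ Module.finrank k A - 1) := by
  let K := AlgebraicClosure k
  have hg' : IsGroupLikeElem K ((1 : K) ⊗ₜ[k] g) :=
    ⟨by simp [TensorProduct.counit_tmul, hg.counit_eq_one],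
      by simp [TensorProduct.comul_tmul, hg.comul_eq_tmul_self]⟩
  obtain ⟨N, hN⟩ := isNilpotent_pow_finrank_sub_one_of_isAlgClosed hg'
  refine ⟨N, ?_⟩
  let i : A →ₐ[k] K ⊗[k] A := Algebra.TensorProduct.includeRight
  have hi : Function.Injective i := Algebra.TensorProduct.includeRight_injective
    (algebraMap k K).injective
  apply hi
  rw [Module.finrank_baseChange] at hN
  rw [map_zero, ← hN, map_pow, map_sub, map_pow, map_one]
  rfl

end GroupLike

end QuasiTriangular
end

/-! ### Central elements on simple modules. -/

noncomputable section

namespace CentralElement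

section Simple

variable {k : Type u} {A : Type v} [Field k] [Ring A] [Algebra k A] {z : A}

/-- Multiplication by a central element, as a module endomorphism. -/
def toEnd (hz : z ∈ Subalgebra.center k A) (W : Type w) [AddCommGroup W] [Module A W] :
    Module.End A W where
  toFun w := z • w
  map_add' := smul_add z
  map_smul' a w := by
    simp only [RingHom.id_apply, smul_smul, Subalgebra.mem_center_iff.mp hz a]

theorem toEnd_pow_apply (hz : z ∈ Subalgebra.center k A) {W : Type w} [AddCommGroup W]
    [Module A W] (n : ℕ) (x : W) : (toEnd hz W ^ n) x = z ^ n • x := by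
  induction n with
  | zero => simp
  | succ n ih => rw [pow_succ', Module.End.mul_apply, ih, pow_succ', mul_smul]; rfl

/-- By Schur's lemma the endomorphism ring of a simple module is a division ring, so it has no
nonzero nilpotents. -/
theorem smul_eq_zero_of_pow_smul_eq_zero (hz : z ∈ Subalgebra.center k A) {W : Type w}
    [AddCommGroup W] [Module A W] [IsSimpleModule A W] {n : ℕ} (h : ∀ x : W, z ^ n • x = 0) (x : W) :
    z • x = 0 := by
  classical
  have h1 : toEnd hz W ^ n = 0 := LinearMap.ext fun x => by rw [toEnd_pow_apply, h]; rfl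
  have h2 : toEnd hz W = 0 := eq_zero_of_pow_eq_zero h1
  exact congr($h2 x)

/-- On a simple module, a central element acts by a scalar of an extension field. -/
theorem exists_field_smul_eq (hz : z ∈ Subalgebra.center k A) (W : Type w) [AddCommGroup W]
    [Module k W] [Module A W] [IsScalarTower k A W] [IsSimpleModule A W] :
    ∃ (L : Type w) (_ : Field L) (_ : Algebra k L) (_ : Module L W) (_ : IsScalarTower k L W)
      (_ : SMulCommClass A L W) (c : L), ∀ x : W, z • x = c • x := by
  classical
  let E := Module.End A W
  -- The centre of the division ring End_A(W) is a field. It contains the action of k and that of z,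
  -- and W is an L-linear representation of A.
  let L := Subring.center E
  let i : k →+* L :=
    { toFun := fun c => ⟨toEnd (Subalgebra.algebraMap_mem (Subalgebra.center k A) c) W,
        Subring.mem_center_iff.2 fun f => LinearMap.ext fun x => map_smul f _ _⟩
      map_one' := Subtype.ext (LinearMap.ext fun x => by simp [toEnd])
      map_zero' := Subtype.ext (LinearMap.ext fun x => by simp [toEnd])
      map_add' := fun a b => Subtype.ext (LinearMap.ext fun x => by
        simp [toEnd, add_smul]
        rfl)
      map_mul' := fun a b => Subtype.ext (LinearMap.ext fun x => by
        simp [toEnd, mul_smul]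
        rfl) }
  let _ : Algebra k L := i.toAlgebra
  have hi : ∀ (a : k) (x : W), i a • x = a • x := fun a x => algebraMap_smul A a x
  refine ⟨L, inferInstance, inferInstance, inferInstance, ⟨fun a c x => ?_⟩, ⟨fun a c x => ?_⟩,
    ⟨toEnd hz W, Subring.mem_center_iff.2 fun f => LinearMap.ext fun x => map_smul f _ _⟩,
    fun x => rfl⟩
  · rw [Algebra.smul_def, mul_smul]
    exact hi a _
  · exact (map_smul (c : E) a x).symm

/-- If z acts as the scalar c of L, its L-determinant is c^(dim_L W), so c^(n dim_L W) = 1. The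
exponent n dim_k W is the multiple of this by [L : k]. Working over L is what makes the argument
valid when k is not algebraically closed. -/
theorem pow_smul_eq_self_of_det [FiniteDimensional k A] (hz : z ∈ Subalgebra.center k A) {n : ℕ}
    (hdet : ∀ (L W : Type w) [Field L] [Algebra k L] [AddCommGroup W] [Module k W] [Module L W]
      [IsScalarTower k L W] [FiniteDimensional L W] (ρ : A →ₐ[k] Module.End L W),
      LinearMap.det (ρ z) ^ n = 1)
    (W : Type w) [AddCommGroup W] [Module k W] [Module A W] [IsScalarTower k A W]
    [IsSimpleModule A W] (x : W) : z ^ (n * Module.finrank k W) • x = x := by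
  have hW : FiniteDimensional k W := Module.Finite.trans A W
  obtain ⟨L, _, _, _, _, _, c, hc⟩ := exists_field_smul_eq hz W
  have : FiniteDimensional L W := Module.Finite.of_restrictScalars_finite k L W
  have : Nontrivial W := IsSimpleModule.nontrivial A W
  have : FiniteDimensional k L := FiniteDimensional.left k L W
  have h1 := hdet L W (Algebra.lsmul k L W)
  have h2 : Algebra.lsmul k L W z = c • LinearMap.id := LinearMap.ext hc
  rw [h2, LinearMap.det_smul, LinearMap.det_id, mul_one] at h1
  have h3 : c ^ (n * Module.finrank k W) = 1 := by
    rw [← Module.finrank_mul_finrank k L W,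
      show n * (Module.finrank k L * Module.finrank L W) =
        Module.finrank L W * n * Module.finrank k L by ring, pow_mul, pow_mul, h1, one_pow]
  have h4 : ∀ m : ℕ, z ^ m • x = c ^ m • x := by
    intro m
    induction m with
    | zero => simp
    | succ m ih => rw [pow_succ', mul_smul, ih, hc, smul_smul, pow_succ']
  rw [h4, h3, one_smul]

/-- An element annihilating all the simple modules A/I lies in the Jacobson radical, which is
nilpotent for an Artinian ring. -/
theorem isNilpotent_of_smul_simple_eq_zero [FiniteDimensional k A] {x : A}
    (h : ∀ (W : Type v) [AddCommGroup W] [Module k W] [Module A W] [IsScalarTower k A W]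
      [IsSimpleModule A W] (y : W), x • y = 0) : IsNilpotent x := by
  have : IsArtinianRing A := IsArtinianRing.of_finite k A
  have hx : x ∈ Ring.jacobson A := by
    rw [Ring.jacobson_eq_sInf_isMaximal, Submodule.mem_sInf]
    intro I hI
    have : IsSimpleModule A (A ⧸ I) := isSimpleModule_iff_isCoatom.2 (Ideal.isMaximal_def.1 hI)
    have h1 := h (A ⧸ I) (Submodule.Quotient.mk 1)
    rw [← Submodule.Quotient.mk_smul, smul_eq_mul, mul_one] at h1
    exact (Submodule.Quotient.mk_eq_zero I).1 h1
  obtain ⟨m, hm⟩ := IsSemiprimaryRing.isNilpotent (R := A)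
  refine ⟨m, ?_⟩
  have := Ideal.pow_mem_pow hx m
  rwa [hm] at this

/-- A crude uniform exponent: every simple module is a quotient of A, so its dimension is at most
dim A and divides its factorial. It proves that eigenvalues have finite order on all modules,
without knowing that the greatest common divisor in the sharp bound is positive. -/
theorem isNilpotent_pow_factorial_sub_one [FiniteDimensional k A] (hz : z ∈ Subalgebra.center k A)
    {n : ℕ}
    (hdet : ∀ (L W : Type v) [Field L] [Algebra k L] [AddCommGroup W] [Module k W] [Module L W]
      [IsScalarTower k L W] [FiniteDimensional L W] (ρ : A →ₐ[k] Module.End L W),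
      LinearMap.det (ρ z) ^ n = 1) :
    IsNilpotent (z ^ (n * (Module.finrank k A).factorial) - 1) := by
  refine isNilpotent_of_smul_simple_eq_zero (k := k) fun W _ _ _ _ _ y => ?_
  have hW : FiniteDimensional k W := Module.Finite.trans A W
  have : Nontrivial W := IsSimpleModule.nontrivial A W
  obtain ⟨w, hw⟩ := exists_ne (0 : W)
  have hle : Module.finrank k W ≤ Module.finrank k A :=
    LinearMap.finrank_le_finrank_of_surjective
      (f := (LinearMap.toSpanSingleton A W w).restrictScalars k)
      (IsSimpleModule.toSpanSingleton_surjective A hw)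
  obtain ⟨c, hc⟩ := Nat.dvd_factorial Module.finrank_pos hle
  have h1 : ∀ m, z ^ (n * Module.finrank k W * m) • y = y := by
    intro m
    induction m with
    | zero => simp
    | succ m ih => rw [mul_add, pow_add, mul_smul, mul_one, pow_smul_eq_self_of_det hz hdet W y, ih]
  rw [sub_smul, one_smul, hc, ← mul_assoc, h1, sub_self]

end Simple

end CentralElement
end

/-! ### Indecomposable modules and linkage. -/

noncomputable section

namespace CentralElement

open Polynomial

section Indecomposable

variable {k : Type u} {A : Type v} [Field k] [Ring A] [Algebra k A] {z : A}

theorem aeval_mem_center (hz : z ∈ Subalgebra.center k A) (f : k[X]) :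
    aeval z f ∈ Subalgebra.center k A := by
  have : Algebra.adjoin k {z} ≤ Subalgebra.center k A := Algebra.adjoin_le (Set.singleton_subset_iff.2 hz)
  exact this (aeval_mem_adjoin_singleton k z)

/-- On an indecomposable module a central element satisfies a power of an irreducible
polynomial. -/
theorem exists_irreducible_pow_smul_eq_zero [FiniteDimensional k A]
    (hz : z ∈ Subalgebra.center k A) (V : Type w) [AddCommGroup V] [Module A V]
    (hV : IsIndecomposableModule A V) :
    ∃ (p : k[X]) (m : ℕ), Irreducible p ∧ ∀ y : V, aeval z p ^ m • y = 0 := by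
  -- The annihilating polynomial is the minimal polynomial of z in the finite-dimensional algebra A,
  -- so V itself may be infinite-dimensional. The induction splits it into coprime factors until one
  -- prime power annihilates V.
  have hint : IsIntegral k z := Algebra.IsIntegral.isIntegral z
  have key : ∀ f : k[X], f ≠ 0 → (∀ y : V, aeval z f • y = 0) →
      ∃ (p : k[X]) (m : ℕ), Irreducible p ∧ ∀ y : V, aeval z p ^ m • y = 0 := by
    intro f
    induction f using UniqueFactorizationMonoid.induction_on_coprime with
    | h0 => intro h; exact absurd rfl h
    | @h1 f hu =>
      intro _ hf
      obtain ⟨y, hy⟩ := @exists_ne V hV.1 0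
      obtain ⟨u, rfl⟩ := hu
      refine absurd ?_ hy
      have h1 : aeval z (↑u⁻¹ : k[X]) • aeval z (u : k[X]) • y = y := by
        rw [smul_smul, ← map_mul, Units.inv_mul, map_one, one_smul]
      rw [← h1, hf, smul_zero]
    | hpr i hp =>
      intro _ hf
      exact ⟨_, i, hp.irreducible, fun y => by rw [← map_pow]; exact hf y⟩
    | @hcp a b hxy ha hb =>
      intro h0 hf
      obtain ⟨r, s, hrs⟩ := hxy.isCoprime
      have hrs' : ∀ y : V, aeval z r • aeval z a • y + aeval z s • aeval z b • y = y := by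
        intro y
        rw [smul_smul, smul_smul, ← add_smul, ← map_mul, ← map_mul, ← map_add, hrs, map_one, one_smul]
      -- For coprime a and b with a(z)b(z) = 0 on V, the kernels of a(z) and b(z) are complementary;
      -- they are submodules because z is central. By indecomposability one kernel is zero, so the
      -- other factor alone annihilates V.
      have hcomp : IsCompl (LinearMap.ker (toEnd (aeval_mem_center hz a) V))
          (LinearMap.ker (toEnd (aeval_mem_center hz b) V)) := by
        constructor
        · rw [Submodule.disjoint_def]
          intro y hya hyb
          have h1 : aeval z a • y = 0 := hya
          have h2 : aeval z b • y = 0 := hyb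
          rw [← hrs' y, h1, h2, smul_zero, smul_zero, add_zero]
        · rw [codisjoint_iff, Submodule.eq_top_iff']
          intro y
          rw [Submodule.mem_sup]
          refine ⟨aeval z s • aeval z b • y, ?_, aeval z r • aeval z a • y, ?_, ?_⟩
          · change aeval z a • aeval z s • aeval z b • y = 0
            rw [smul_smul, smul_smul, ← map_mul, ← map_mul, show a * s * b = s * (a * b) by ring,
              map_mul, mul_smul, hf, smul_zero]
          · change aeval z b • aeval z r • aeval z a • y = 0
            rw [smul_smul, smul_smul, ← map_mul, ← map_mul, show b * r * a = r * (a * b) by ring,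
              map_mul, mul_smul, hf, smul_zero]
          · rw [add_comm, hrs']
      rcases hV.2 _ _ hcomp with h | h
      · have h1 := eq_top_of_bot_isCompl (h ▸ hcomp)
        refine hb (right_ne_zero_of_mul h0) fun y => ?_
        have : y ∈ LinearMap.ker (toEnd (aeval_mem_center hz b) V) := h1 ▸ Submodule.mem_top
        exact this
      · have h1 := eq_top_of_bot_isCompl (h ▸ hcomp.symm)
        refine ha (left_ne_zero_of_mul h0) fun y => ?_
        have : y ∈ LinearMap.ker (toEnd (aeval_mem_center hz a) V) := h1 ▸ Submodule.mem_top
        exact this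
  exact key (minpoly k z) (minpoly.ne_zero hint) fun y => by rw [minpoly.aeval, zero_smul]

theorem smul_eq_zero_of_isConstituent (hz : z ∈ Subalgebra.center k A) {V W : Type w}
    [AddCommGroup V] [Module A V] [AddCommGroup W] [Module A W] (hW : IsConstituent A W V) {m : ℕ}
    (h : ∀ y : V, z ^ m • y = 0) (y : W) : z • y = 0 := by
  obtain ⟨hs, Q, P, ⟨e⟩⟩ := hW
  refine smul_eq_zero_of_pow_smul_eq_zero hz (n := m) (fun y => ?_) y
  apply e.injective
  rw [map_smul, map_zero]
  obtain ⟨q, hq⟩ := Submodule.Quotient.mk_surjective P (e y)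
  rw [← hq, ← Submodule.Quotient.mk_smul]
  have : z ^ m • q = 0 := Subtype.ext (h q)
  rw [this]
  rfl

theorem dvd_of_smul_eq_zero {V : Type w} [AddCommGroup V] [Module A V] [Nontrivial V] {p q : k[X]}
    (hp : Irreducible p) (h1 : ∀ y : V, aeval z p • y = 0) (h2 : ∀ y : V, aeval z q • y = 0) :
    p ∣ q := by
  rcases EuclideanDomain.dvd_or_coprime p q hp with h | ⟨r, s, hrs⟩
  · exact h
  · obtain ⟨y, hy⟩ := exists_ne (0 : V)
    refine absurd ?_ hy
    calc y = aeval z (r * p + s * q) • y := by rw [hrs, map_one, one_smul]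
      _ = 0 := by
        rw [map_add, map_mul, map_mul, add_smul, mul_smul, mul_smul, h1, h2, smul_zero, smul_zero,
          add_zero]

/-- An indecomposable U determines an irreducible q with q(z) nilpotent on U, hence zero on all
constituents. On the nonzero module W₁ both p(z) and q(z) vanish, so q divides p, and therefore p(z)
vanishes on W₂ too. -/
theorem smul_eq_zero_iff_of_isConstituent [FiniteDimensional k A] (hz : z ∈ Subalgebra.center k A)
    {p : k[X]} (hp : Irreducible p) {U W₁ W₂ : Type w} [AddCommGroup U] [Module A U]
    [AddCommGroup W₁] [Module A W₁] [AddCommGroup W₂] [Module A W₂]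
    (hU : IsIndecomposableModule A U) (h₁ : IsConstituent A W₁ U) (h₂ : IsConstituent A W₂ U)
    (h : ∀ y : W₁, aeval z p • y = 0) (y : W₂) : aeval z p • y = 0 := by
  obtain ⟨q, m, hq, hqm⟩ := exists_irreducible_pow_smul_eq_zero hz U hU
  have e1 := smul_eq_zero_of_isConstituent (aeval_mem_center hz q) h₁ hqm
  have e2 := smul_eq_zero_of_isConstituent (aeval_mem_center hz q) h₂ hqm
  have := h₁.1
  have : Nontrivial W₁ := IsSimpleModule.nontrivial A W₁
  obtain ⟨r, rfl⟩ := dvd_of_smul_eq_zero hq e1 h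
  rw [mul_comm, map_mul, mul_smul, e2, smul_zero]

theorem smul_eq_zero_of_linked [FiniteDimensional k A] (hz : z ∈ Subalgebra.center k A)
    {p : k[X]} (hp : Irreducible p) {W₁ W₂ : ModuleCat.{w} A} (h : Linked A W₁ W₂) :
    (∀ y : W₁, aeval z p • y = 0) ↔ ∀ y : W₂, aeval z p • y = 0 := by
  induction h with
  | rel W₁ W₂ h =>
    obtain ⟨U, hU, h₁, h₂⟩ := h
    exact ⟨smul_eq_zero_iff_of_isConstituent hz hp hU h₁ h₂,
      smul_eq_zero_iff_of_isConstituent hz hp hU h₂ h₁⟩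
  | refl => rfl
  | symm _ _ _ ih => exact ih.symm
  | trans _ _ _ _ _ ih₁ ih₂ => exact ih₁.trans ih₂

/-- Rewriting the condition on m as divisibility by a fixed number is what allows passing from the
individual dimensions to their greatest common divisor. -/
theorem dvd_X_pow_mul_sub_one_iff (p : k[X]) (n m : ℕ) :
    p ∣ X ^ (n * m) - 1 ↔ orderOf (AdjoinRoot.root p ^ n) ∣ m := by
  rw [orderOf_dvd_iff_pow_eq_one, ← pow_mul, ← AdjoinRoot.mk_eq_zero, map_sub, map_pow,
    AdjoinRoot.mk_X, map_one, sub_eq_zero]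

/-- The order of a central element on a module killed by a power of `p(z)`, with `p` irreducible, is
governed by the greatest common divisor of the dimensions of the linked simple modules. -/
theorem isNilpotent_pow_setGcd_sub_one [FiniteDimensional k A] (hz : z ∈ Subalgebra.center k A)
    {n : ℕ}
    (hdet : ∀ (L W : Type w) [Field L] [Algebra k L] [AddCommGroup W] [Module k W] [Module L W]
      [IsScalarTower k L W] [FiniteDimensional L W] (ρ : A →ₐ[k] Module.End L W),
      LinearMap.det (ρ z) ^ n = 1)
    (V : Type w) [AddCommGroup V] [Module k V] [Module A V] [IsScalarTower k A V]
    {p : k[X]} {m : ℕ} (hp : Irreducible p) (hpm : ∀ y : V, aeval z p ^ m • y = 0) :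
    IsNilpotent (Algebra.lsmul k k V z ^ (n * linkageGcd k A V) - 1) := by
  have h1 : p ∣ X ^ (n * linkageGcd k A V) - 1 := by
    rw [dvd_X_pow_mul_sub_one_iff, linkageGcd, Nat.dvd_setGcd_iff]
    rintro _ ⟨W₀, W, h₀, hl, hs, rfl⟩
    rw [← dvd_X_pow_mul_sub_one_iff]
    -- The polynomial p annihilates z on the constituent W₀ and, through linkage, on W. There z^(n
    -- dim W) = 1 as well, so p divides X^(n dim W) - 1.
    have e1 := smul_eq_zero_of_isConstituent (aeval_mem_center hz p) h₀ hpm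
    have e2 := (smul_eq_zero_of_linked hz hp hl).1 e1
    let _ : Module k W := Module.compHom W (algebraMap k A)
    have : IsScalarTower k A W := ⟨fun c b y => by rw [Algebra.smul_def, mul_smul]; rfl⟩
    have e3 := pow_smul_eq_self_of_det hz hdet W
    have : Nontrivial W := IsSimpleModule.nontrivial A W
    refine dvd_of_smul_eq_zero (V := W) (z := z) hp e2 fun y => ?_
    have e4 : z ^ (n * Module.finrank k (RestrictScalars k A W)) • y = y := e3 y
    rw [map_sub, map_pow, aeval_X, map_one, sub_smul, e4, one_smul, sub_self]
  obtain ⟨r, hr⟩ := h1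
  refine ⟨m, LinearMap.ext fun y => ?_⟩
  have h2 : Algebra.lsmul k k V z ^ (n * linkageGcd k A V) - 1 =
      Algebra.lsmul k k V (aeval z (X ^ (n * linkageGcd k A V) - 1 : k[X])) := by
    rw [map_sub, map_pow, aeval_X, map_one, map_sub, map_pow, map_one]
  rw [h2, ← map_pow, ← map_pow, hr, mul_comm, mul_pow, map_mul, map_pow _ p]
  change (aeval z (r ^ m) * aeval z p ^ m) • y = 0
  rw [mul_smul, hpm, smul_zero]

end Indecomposable

/-! ### Eigenvalues after extension of scalars. -/

section Eigenvalue

variable {k : Type u} {A : Type v} [Field k] [Ring A] [Algebra k A] {V : Type w} [AddCommGroup V]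
  [Module k V] [Module A V] [IsScalarTower k A V] {K : Type x} [Field K] [Algebra k K]

theorem aeval_eq_zero_of_isEigenvalueOn {a : A} {μ : K} (hμ : IsEigenvalueOn (k := k) a V μ)
    {f : k[X]} (hf : aeval (Algebra.lsmul k k V a) f = 0) : aeval μ f = 0 := by
  obtain ⟨y, hy⟩ := hμ.exists_hasEigenvector
  have h1 := Module.End.aeval_apply_of_hasEigenvector (p := f.map (algebraMap k K)) hy
  have h2 : aeval ((Algebra.lsmul k k V a).baseChange K) (f.map (algebraMap k K)) = 0 := by
    rw [aeval_map_algebraMap]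
    change aeval (Module.End.baseChangeHom k K V (Algebra.lsmul k k V a)) f = 0
    rw [aeval_algHom_apply, hf, map_zero]
  rw [h2, LinearMap.zero_apply, eval_map_algebraMap] at h1
  exact (smul_eq_zero.1 h1.symm).resolve_right hy.2

theorem pow_eq_one_of_isEigenvalueOn {a : A} {μ : K} (hμ : IsEigenvalueOn (k := k) a V μ) {m : ℕ}
    (h : IsNilpotent (Algebra.lsmul k k V a ^ m - 1)) : μ ^ m = 1 := by
  obtain ⟨r, hr⟩ := h
  have h1 := aeval_eq_zero_of_isEigenvalueOn hμ (f := (X ^ m - 1) ^ r) (by simpa using hr)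
  rw [map_pow] at h1
  simpa [sub_eq_zero] using eq_zero_of_pow_eq_zero h1

/-- Two exponents are kept apart: n is positive and gives finiteness of the order, while m gives the
divisibility and is allowed to be zero. -/
theorem isOfFinOrder_and_orderOf_dvd {a : A} {n m : ℕ} (hn : 0 < n) (h : IsNilpotent (a ^ n - 1))
    (h' : IsNilpotent (Algebra.lsmul k k V a ^ m - 1)) {μ : K}
    (hμ : IsEigenvalueOn (k := k) a V μ) : IsOfFinOrder μ ∧ orderOf μ ∣ m := by
  have h₁ := h.map (Algebra.lsmul k k V)
  rw [map_sub, map_pow, map_one] at h₁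
  exact ⟨isOfFinOrder_iff_pow_eq_one.2 ⟨n, hn, pow_eq_one_of_isEigenvalueOn hμ h₁⟩,
    orderOf_dvd_of_pow_eq_one (pow_eq_one_of_isEigenvalueOn hμ h')⟩

/-- Every eigenvalue is a root of the same irreducible p, so all have the minimal polynomial that p
determines up to a scalar. -/
theorem isConjRoot_of_isEigenvalueOn {a : A} {p : k[X]} {m : ℕ} (hp : Irreducible p)
    (h : ∀ y : V, aeval a p ^ m • y = 0) {μ μ' : K} (hμ : IsEigenvalueOn (k := k) a V μ)
    (hμ' : IsEigenvalueOn (k := k) a V μ') : IsConjRoot k μ μ' := by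
  have h1 : aeval (Algebra.lsmul k k V a) (p ^ m) = 0 := by
    rw [aeval_algHom_apply, map_pow]
    exact LinearMap.ext h
  have h2 : ∀ μ : K, IsEigenvalueOn (k := k) a V μ → aeval μ p = 0 := fun μ hμ => by
    have := aeval_eq_zero_of_isEigenvalueOn hμ h1
    rw [map_pow] at this
    exact eq_zero_of_pow_eq_zero this
  exact (minpoly.eq_of_irreducible hp (h2 μ hμ)).symm.trans
    (minpoly.eq_of_irreducible hp (h2 μ' hμ'))

theorem hasEigenvalue_of_injective {M N : Type*} [AddCommGroup M] [Module K M] [AddCommGroup N]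
    [Module K N] {f : Module.End K M} {g : Module.End K N} (φ : M →ₗ[K] N)
    (hφ : Function.Injective φ) (h : ∀ y, φ (f y) = g (φ y)) {μ : K} (hμ : f.HasEigenvalue μ) :
    g.HasEigenvalue μ := by
  obtain ⟨y, hy⟩ := hμ.exists_hasEigenvector
  refine Module.End.hasEigenvalue_of_hasEigenvector (x := φ y)
    ⟨Module.End.mem_eigenspace_iff.2 ?_, fun h0 => hy.2 (hφ (h0.trans (map_zero φ).symm))⟩
  rw [← h, hy.apply_eq_smul, map_smul]

theorem exists_isEigenvalueOn [FiniteDimensional k A] [Nontrivial V] [IsAlgClosed K] (a : A) :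
    ∃ μ : K, IsEigenvalueOn (k := k) a V μ := by
  obtain ⟨y, hy⟩ := exists_ne (0 : V)
  -- V need not be finite-dimensional, but the cyclic submodule Ay is. An eigenvalue on its scalar
  -- extension is one on that of V, by flatness.
  let U : Submodule k V := LinearMap.range ((LinearMap.toSpanSingleton A V y).restrictScalars k)
  have hyU : y ∈ U := ⟨1, by simp⟩
  have hU : ∀ x ∈ U, Algebra.lsmul k k V a x ∈ U := by
    rintro _ ⟨b, rfl⟩
    exact ⟨a * b, by simp [mul_smul]⟩
  let f : Module.End k U := (Algebra.lsmul k k V a).restrict hU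
  have : Nontrivial U := ⟨⟨⟨y, hyU⟩, 0, fun h => hy congr(($h : V))⟩⟩
  have : Nontrivial (K ⊗[k] U) := inferInstance
  obtain ⟨μ, hμ⟩ := Module.End.exists_eigenvalue (f.baseChange K)
  refine ⟨μ, hasEigenvalue_of_injective (U.subtype.baseChange K)
    (Module.Flat.lTensor_preserves_injective_linearMap U.subtype U.injective_subtype) (fun t => ?_) hμ⟩
  induction t with
  | zero => simp
  | add x y hx hy => simp only [map_add, hx, hy]
  | tmul c x => simp [f]

theorem isEigenvalueOn_self {a : A} {μ : k} :
    IsEigenvalueOn (k := k) a V μ ↔ Module.End.HasEigenvalue (Algebra.lsmul k k V a) μ := by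
  constructor
  · refine hasEigenvalue_of_injective (TensorProduct.lid k V).toLinearMap
      (TensorProduct.lid k V).injective fun t => ?_
    induction t with
    | zero => simp
    | add x y hx hy => simp only [map_add, hx, hy]
    | tmul c x => exact (smul_comm a c x).symm
  · refine hasEigenvalue_of_injective (TensorProduct.lid k V).symm.toLinearMap
      (TensorProduct.lid k V).symm.injective fun t => ?_
    simp

end Eigenvalue

end CentralElement
end

/-! ### From z to the Drinfeld element, and the main theorem. -/

noncomputable section

namespace DrinfeldDouble

theorem isNilpotent_pow_mul_sub_one {B : Type*} [Ring B] {x : B} {n : ℕ}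
    (h : IsNilpotent (x ^ n - 1)) (m : ℕ) : IsNilpotent (x ^ (n * m) - 1) := by
  rw [pow_mul, ← geom_sum_mul]
  refine Commute.isNilpotent_mul_left ?_ h
  exact Commute.sum_left _ _ _ fun i _ =>
    ((Commute.refl (x ^ n)).pow_left i).sub_right (Commute.one_right _)

section Orders

variable {k H : Type*} [Field k] [Ring H] [HopfAlgebra k H] [FiniteDimensional k H]

/-- With u² = zg and z central, u^(2N) = z^N g^N for N = d²m. Both z^N - 1, by hypothesis, and g^N -
1, because dim D = d² divides N, are nilpotent in B. -/
theorem isNilpotent_drinfeldElement_pow_sub_one {B : Type*} [Ring B] [Algebra k B]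
    (ρ : DrinfeldDouble k H →ₐ[k] B) {m : ℕ}
    (h : IsNilpotent (ρ (drinfeldZ k H) ^ (Module.finrank k H ^ 2 * m) - 1)) :
    IsNilpotent (ρ (drinfeldElement k H) ^ (2 * (Module.finrank k H ^ 2 * m)) - 1) := by
  obtain ⟨g, hg, hu⟩ := (isUniversalR k H).exists_isGroupLikeElem HopfAux.antipode_bijective.2
  have hu' : drinfeldElement k H ^ 2 = drinfeldZ k H * g := (sq _).trans hu
  have hg' := QuasiTriangular.isNilpotent_pow_finrank_sub_one hg
  rw [finrank_eq] at hg'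
  have hg'' := (isNilpotent_pow_mul_sub_one hg' m).map ρ
  rw [map_sub, map_pow, map_one] at hg''
  have hc : ∀ a, Commute (ρ (drinfeldZ k H)) (ρ a) := fun a =>
    Commute.map (f := ρ) (Subalgebra.mem_center_iff.mp drinfeldZ_mem_center a).symm
  set N := Module.finrank k H ^ 2 * m
  -- A sum of two commuting nilpotents: the first summand is nilpotent because z^N - 1 commutes with
  -- g^N.
  have hsplit : ρ (drinfeldElement k H) ^ (2 * N) - 1 =
      (ρ (drinfeldZ k H) ^ N - 1) * ρ g ^ N + (ρ g ^ N - 1) := by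
    rw [pow_mul, ← map_pow _ _ 2, hu', map_mul, (hc g).mul_pow, sub_mul, one_mul]
    abel
  have hcN : Commute (ρ (drinfeldZ k H) ^ N - 1) (ρ g ^ N) :=
    ((hc g).pow_pow N N).sub_left (Commute.one_left _)
  rw [hsplit]
  refine Commute.isNilpotent_add ?_ (Commute.isNilpotent_mul_right hcN h) hg''
  exact Commute.sub_right (hcN.mul_left (Commute.refl _)) (Commute.one_right _)

end Orders

end DrinfeldDouble
end

theorem theorem4p8 {k : Type u} [Field k] {H : Type v} [Ring H] [HopfAlgebra k H]
    [FiniteDimensional k H] :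
    drinfeldZ k H ∈ Subalgebra.center k (DrinfeldDouble k H) ∧
    (∀ (V : Type w) [AddCommGroup V] [Module k V] [Module (DrinfeldDouble k H) V]
        [IsScalarTower k (DrinfeldDouble k H) V],
      IsIndecomposableModule (DrinfeldDouble k H) V →
      (IsAlgClosed k → ∃ lam : k,
        (∀ μ : k, Module.End.HasEigenvalue (Algebra.lsmul k k V (drinfeldZ k H)) μ ↔ μ = lam) ∧
        IsOfFinOrder lam ∧
        orderOf lam ∣ Module.finrank k H ^ 2 * linkageGcd k (DrinfeldDouble k H) V) ∧
      (∀ (K : Type x) [Field K] [Algebra k K],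
        (IsAlgClosed K → ∃ μ : K, IsEigenvalueOn (k := k) (drinfeldZ k H) V μ) ∧
        (∀ μ μ' : K, IsEigenvalueOn (k := k) (drinfeldZ k H) V μ →
          IsEigenvalueOn (k := k) (drinfeldZ k H) V μ' → IsConjRoot k μ μ') ∧
        (∀ μ : K, IsEigenvalueOn (k := k) (drinfeldZ k H) V μ →
          IsOfFinOrder μ ∧
          orderOf μ ∣ Module.finrank k H ^ 2 * linkageGcd k (DrinfeldDouble k H) V) ∧
        (∀ μ : K, IsEigenvalueOn (k := k) (drinfeldElement k H) V μ →
          IsOfFinOrder μ ∧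
          orderOf μ ∣ 2 * Module.finrank k H ^ 2 * linkageGcd k (DrinfeldDouble k H) V))) ∧
    (∀ (M : Type w) [AddCommGroup M] [Module k M] [Module (DrinfeldDouble k H) M]
        [IsScalarTower k (DrinfeldDouble k H) M] (K : Type x) [Field K] [Algebra k K] (μ : K),
      IsEigenvalueOn (k := k) (drinfeldElement k H) M μ → IsOfFinOrder μ) := by
  have hz := DrinfeldDouble.drinfeldZ_mem_center (k := k) (H := H)
  -- The factorial exponent serves only for finiteness of orders, on arbitrary modules. The sharp
  -- exponent for an indecomposable module is `hN` below.
  have hz₀ := CentralElement.isNilpotent_pow_factorial_sub_one hz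
    fun L W _ _ _ _ _ _ _ ρ => DrinfeldDouble.det_drinfeldZ_pow ρ
  have hpos : 0 < Module.finrank k H ^ 2 *
      (Module.finrank k (DrinfeldDouble k H)).factorial := by
    have : Nontrivial H := ⟨1, 0, fun h => by simpa using congr(counit (R := k) $h)⟩
    have : 0 < Module.finrank k H := Module.finrank_pos
    positivity
  have hufin : ∀ (M : Type w) [AddCommGroup M] [Module k M] [Module (DrinfeldDouble k H) M]
      [IsScalarTower k (DrinfeldDouble k H) M] (K : Type x) [Field K] [Algebra k K] (μ : K),
      IsEigenvalueOn (k := k) (drinfeldElement k H) M μ → IsOfFinOrder μ := by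
    intro M _ _ _ _ K _ _ μ hμ
    have h := hz₀.map (Algebra.lsmul k k M)
    rw [map_sub, map_pow, map_one] at h
    exact isOfFinOrder_iff_pow_eq_one.2 ⟨_, Nat.mul_pos two_pos hpos,
      CentralElement.pow_eq_one_of_isEigenvalueOn hμ
        (DrinfeldDouble.isNilpotent_drinfeldElement_pow_sub_one _ h)⟩
  refine ⟨hz, fun V _ _ _ _ hV => ?_, hufin⟩
  have : Nontrivial V := hV.1
  obtain ⟨p, m, hp, hpm⟩ := CentralElement.exists_irreducible_pow_smul_eq_zero hz V hV
  have hN := CentralElement.isNilpotent_pow_setGcd_sub_one hz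
    (fun L W _ _ _ _ _ _ _ ρ => DrinfeldDouble.det_drinfeldZ_pow ρ) V hp hpm
  refine ⟨fun _ => ?_, fun K _ _ => ⟨fun _ => CentralElement.exists_isEigenvalueOn _,
    fun μ μ' => CentralElement.isConjRoot_of_isEigenvalueOn hp hpm, fun μ hμ =>
      CentralElement.isOfFinOrder_and_orderOf_dvd hpos hz₀ hN hμ,
    fun μ hμ => ⟨hufin V K μ hμ, ?_⟩⟩⟩
  · obtain ⟨lam, hlam⟩ := CentralElement.exists_isEigenvalueOn (k := k) (V := V) (K := k)
      (drinfeldZ k H)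
    refine ⟨lam, fun μ => ⟨fun hμ => ?_, fun hμ => ?_⟩,
      CentralElement.isOfFinOrder_and_orderOf_dvd hpos hz₀ hN hlam⟩
    -- Over k itself, an element conjugate to one of k is equal to it, so conjugacy of eigenvalues
    -- becomes uniqueness.
    · exact isConjRoot_iff_eq_algebraMap.1
        (CentralElement.isConjRoot_of_isEigenvalueOn hp hpm hlam
          (CentralElement.isEigenvalueOn_self.2 hμ))
    · exact hμ ▸ CentralElement.isEigenvalueOn_self.1 hlam
  · rw [mul_assoc]
    exact orderOf_dvd_of_pow_eq_one (CentralElement.pow_eq_one_of_isEigenvalueOn hμ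
      (DrinfeldDouble.isNilpotent_drinfeldElement_pow_sub_one _ hN))
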